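/- Let $n,p,\kappa$ be positive integers. **The algebra.** Let $\dot{\mathfrak h}=\bigoplus_{i=1}^n\mathbb C\epsilon_i^\vee\oplus\mathbb C c$, let $P=\bigoplus_{i=1}^n\mathbb Z\epsilon_i$, and let $\dot W=P\rtimes\mathfrak S_n$ be the extended affine Weyl group of $\mathfrak{gl}_n$, with translations $t_\eta$ ($\eta\in P$) and $w t_\eta w^{-1}=t_{w(\eta)}$. It acts on $\dot{\mathfrak h}$: $w\in\mathfrak S_n$ permutes the $\epsilon_i^\vee$, $c$ is fixed, and $t_\eta(h)=h-\langle\eta|h\rangle c$, where $\langle\epsilon_i|\epsilon_j^\vee\rangle=\delta_{ij}$ and $\langle\epsilon_i|c\rangle=0$. For $n\ge 2$ let $\alpha_i=\epsilon_i-\epsilon_{i+1}$ $(1\le i\le n-1)$ and $\alpha_0=-(\epsilon_1-\epsilon_n)+\delta$ be the simple affine roots, where $\delta$ vanishes on $\dot{\mathfrak h}$; let $s_i=(i\;\,i+1)\in\mathfrak S_n$ for $1\le i\le n-1$, let $s_0=t_{\epsilon_1-\epsilon_n}\cdot(1\;\,n)$, and for $n\ge1$ let $\pi=t_{\epsilon_1}s_1\cdots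 s_{n-1}$. The degenerate double affine Hecke algebra $\ddot H_n$ is the unital associative $\mathbb C$-algebra generated by the group algebra $\mathbb C[\dot W]$ and the symmetric algebra $S(\dot{\mathfrak h})$ with the relations $$s_i h-s_i(h)s_i=-\langle\alpha_i|h\rangle\quad(0\le i\le n-1),\qquad \pi h=\pi(h)\pi\qquad(h\in\dot{\mathfrak h}),$$ the first one being absent if $n=1$. **The parameters.** For $\lambda\in\mathbb Z^p$ put $[\lambda]_0=\kappa-p+1-\lambda_1+\lambda_p$ and $[\lambda]_i=\lambda_i-\lambda_{i+1}+1$ for $1\le i\le p-1$. Let $\mathcal I^+_{p,\kappa}$ be the set of pairs $(\lambda,\mu)\in\mathbb Z^p\times\mathbb Z^p$ such that * $\lambda_i-\mu_i\ge0$ for all $i$ and $\sum_{i=1}^p(\lambda_i-\mu_i)=n$; * $[\mu]_i\ge0$ for all $0\le i\le p-1$; * $[\lambda]_i\ge0$ for all $0\le i\le p-1$ with $[\mu]_i=0$. **The induced module.** Given $(\lambda,\mu)\in\mathcal I^+_{p,\kappa}$, put $n_i=\sum_{j\le i}(\lambda_j-\mu_j)$ for $0\le i\le p$, let $W_{\lambda-\mu}\subseteq\mathfrak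 S_n$ be the subgroup generated by the $s_a$ with $a\in\{1,\dots,n-1\}\setminus\{n_1,\dots,n_{p-1}\}$, and let $\zeta^\kappa_{\lambda,\mu}\in\dot{\mathfrak h}^*$ be defined by $$\langle\zeta^\kappa_{\lambda,\mu}|c\rangle=\kappa,\qquad \langle\zeta^\kappa_{\lambda,\mu}|\epsilon_j^\vee\rangle=\mu_i-i+j-n_{i-1}\quad\text{for } n_{i-1}<j\le n_i .$$ Let $\ddot M(\lambda,\mu)$ be the $\ddot H_n$-module induced from the one-dimensional module $\mathbb C\mathbf 1_{\lambda,\mu}$ over the subalgebra generated by $W_{\lambda-\mu}$ and $\dot{\mathfrak h}$ on which $w\mathbf 1_{\lambda,\mu}=\mathbf 1_{\lambda,\mu}$ for $w\in W_{\lambda-\mu}$ and $h\mathbf 1_{\lambda,\mu}=\langle\zeta^\kappa_{\lambda,\mu}|h\rangle\mathbf 1_{\lambda,\mu}$ for $h\in\dot{\mathfrak h}$. **Theorem.** Let $(\lambda,\mu)\in\mathcal I^+_{p,\kappa}$. Then $\ddot M(\lambda,\mu)$ has a unique simple quotient $\ddot L(\lambda,\mu)$; that is, there is exactly one submodule $N\subseteq\ddot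 M(\lambda,\mu)$ such that $\ddot M(\lambda,\mu)/N$ is simple. Moreover, the weight space $$\ddot M(\lambda,\mu)_{\zeta^\kappa_{\lambda,\mu}}=\{v\in\ddot M(\lambda,\mu)\mid hv=\langle\zeta^\kappa_{\lambda,\mu}|h\rangle v\text{ for all }h\in\dot{\mathfrak h}\}$$ is one-dimensional and equal to $\mathbb C\,\mathbf 1_{\lambda,\mu}$. -/

import Mathlib

noncomputable section

namespace DegenerateDAHA

/-! ### The extended affine Weyl group of `gl_n` and its action

Indices are zero-based: `ε_j` (`1 ≤ j ≤ n`) is the coordinate `j - 1 : Fin n`. -/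

/-- The extended affine Weyl group of `gl_n`, the semidirect product of the weight lattice
`P = ℤⁿ` (written multiplicatively) and the symmetric group, with `w t_η w⁻¹ = t_{w(η)}`,
where `w (ε_i) = ε_{w(i)}`. -/
abbrev AffWeyl (n : ℕ) : Type :=
  (Fin n → Multiplicative ℤ) ⋊[mulAutArrow] (Equiv.Perm (Fin n))

/-- The translation `t_η`. -/
def translation {n : ℕ} (η : Fin n → ℤ) : AffWeyl n :=
  SemidirectProduct.inl (fun j => Multiplicative.ofAdd (η j))

/-- The finite Weyl group inside the extended affine Weyl group. -/
def finite {n : ℕ} (w : Equiv.Perm (Fin n)) : AffWeyl n :=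
  SemidirectProduct.inr w

/-- The space `⨁ ℂ ε^∨_i ⊕ ℂ c`; the pair `(x, z)` is `∑ x_i ε^∨_i + z c`. -/
abbrev Cartan (n : ℕ) : Type := (Fin n → ℂ) × ℂ

/-- The action of `t_η w` on the space `⨁ ℂ ε^∨_i ⊕ ℂ c`: the permutation `w` permutes
the `ε^∨_i`, the element `c` is fixed, and `t_η (h) = h - ⟨η, h⟩ c`. -/
def act {n : ℕ} (g : AffWeyl n) (h : Cartan n) : Cartan n :=
  (fun j => h.1 (g.right⁻¹ j),
    h.2 - ∑ j, ((Multiplicative.toAdd (g.left j) : ℤ) : ℂ) * h.1 (g.right⁻¹ j))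

/-- The affine root `ε_i - ε_j + k δ`, with `i ≠ j`. -/
structure AffRoot (n : ℕ) where
  i : Fin n
  j : Fin n
  ne : i ≠ j
  k : ℤ

/-- The simple affine roots: `α_a = ε_a - ε_{a+1}` for `1 ≤ a ≤ n - 1`, and
`α_0 = ε_n - ε_1 + δ`.  (There are none if `n = 1`.) -/
def AffRoot.IsSimple {n : ℕ} (α : AffRoot n) : Prop :=
  (α.k = 0 ∧ (α.j : ℕ) = α.i + 1) ∨ (α.k = 1 ∧ (α.i : ℕ) + 1 = n ∧ (α.j : ℕ) = 0)

/-- The reflection `s_β = t_{-k α} s_α` in the affine root `β = α + k δ`,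
`α = ε_i - ε_j`. -/
def AffRoot.reflection {n : ℕ} (β : AffRoot n) : AffWeyl n :=
  translation (-(β.k • (Pi.single β.i 1 - Pi.single β.j 1 : Fin n → ℤ))) *
    finite (Equiv.swap β.i β.j)

/-- The pairing `⟨β | h⟩`; `δ` vanishes on `⨁ ℂ ε^∨_i ⊕ ℂ c`. -/
def AffRoot.pairing {n : ℕ} (β : AffRoot n) (h : Cartan n) : ℂ := h.1 β.i - h.1 β.j

/-- The element `π = t_{ε_1} s_1 ⋯ s_{n-1}`; the product `s_1 ⋯ s_{n-1}` is the cycle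
`1 ↦ 2 ↦ ⋯ ↦ n ↦ 1`. -/
def piElt (n : ℕ) : AffWeyl n :=
  translation (fun j => if (j : ℕ) = 0 then 1 else 0) * finite (finRotate n)

/-! ### The degenerate double affine Hecke algebra -/

/-- The defining relations of the degenerate double affine Hecke algebra, on the free
algebra generated by the elements of the extended affine Weyl group and of the space
`⨁ ℂ ε^∨_i ⊕ ℂ c`.  The first five say that the group algebra of the former and the
symmetric algebra of the latter map to the algebra. -/
inductive Rel (n : ℕ) :
    FreeAlgebra ℂ (AffWeyl n ⊕ Cartan n) → FreeAlgebra ℂ (AffWeyl n ⊕ Cartan n) → Prop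
  | group_one : Rel n (FreeAlgebra.ι ℂ (Sum.inl 1)) 1
  | group_mul (g g' : AffWeyl n) :
      Rel n (FreeAlgebra.ι ℂ (Sum.inl (g * g')))
        (FreeAlgebra.ι ℂ (Sum.inl g) * FreeAlgebra.ι ℂ (Sum.inl g'))
  | cartan_add (h h' : Cartan n) :
      Rel n (FreeAlgebra.ι ℂ (Sum.inr (h + h')))
        (FreeAlgebra.ι ℂ (Sum.inr h) + FreeAlgebra.ι ℂ (Sum.inr h'))
  | cartan_smul (a : ℂ) (h : Cartan n) :
      Rel n (FreeAlgebra.ι ℂ (Sum.inr (a • h))) (a • FreeAlgebra.ι ℂ (Sum.inr h))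
  | cartan_comm (h h' : Cartan n) :
      Rel n (FreeAlgebra.ι ℂ (Sum.inr h) * FreeAlgebra.ι ℂ (Sum.inr h'))
        (FreeAlgebra.ι ℂ (Sum.inr h') * FreeAlgebra.ι ℂ (Sum.inr h))
  | simple (α : AffRoot n) (hα : α.IsSimple) (h : Cartan n) :
      Rel n
        (FreeAlgebra.ι ℂ (Sum.inl α.reflection) * FreeAlgebra.ι ℂ (Sum.inr h) -
          FreeAlgebra.ι ℂ (Sum.inr (act α.reflection h)) *
            FreeAlgebra.ι ℂ (Sum.inl α.reflection))
        (algebraMap ℂ _ (-(α.pairing h)))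
  | rotation (h : Cartan n) :
      Rel n (FreeAlgebra.ι ℂ (Sum.inl (piElt n)) * FreeAlgebra.ι ℂ (Sum.inr h))
        (FreeAlgebra.ι ℂ (Sum.inr (act (piElt n) h)) * FreeAlgebra.ι ℂ (Sum.inl (piElt n)))

end DegenerateDAHA

/-- The degenerate double affine Hecke algebra of `gl_n`, by generators and relations. -/
def DDAHA (n : ℕ) : Type := RingQuot (DegenerateDAHA.Rel n)

instance (n : ℕ) : Ring (DDAHA n) := inferInstanceAs (Ring (RingQuot (DegenerateDAHA.Rel n)))

instance (n : ℕ) : Algebra ℂ (DDAHA n) :=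
  inferInstanceAs (Algebra ℂ (RingQuot (DegenerateDAHA.Rel n)))

namespace DDAHA

open DegenerateDAHA

/-- The image in the algebra of an element of the extended affine Weyl group. -/
def ofGroup {n : ℕ} (g : AffWeyl n) : DDAHA n :=
  RingQuot.mkAlgHom ℂ (Rel n) (FreeAlgebra.ι ℂ (Sum.inl g))

/-- The image in the algebra of an element of `⨁ ℂ ε^∨_i ⊕ ℂ c`. -/
def ofCartan {n : ℕ} (h : Cartan n) : DDAHA n :=
  RingQuot.mkAlgHom ℂ (Rel n) (FreeAlgebra.ι ℂ (Sum.inr h))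

/-- The weight space `N_ζ` of a module `N` over the algebra. -/
def weightSpace {n : ℕ} (N : Type*) [AddCommGroup N] [Module (DDAHA n) N] [Module ℂ N]
    [IsScalarTower ℂ (DDAHA n) N] (ζ : Cartan n →ₗ[ℂ] ℂ) : Submodule ℂ N where
  carrier := {v | ∀ h : Cartan n, ofCartan h • v = ζ h • v}
  zero_mem' := by intro h; simp
  add_mem' := by
    intro v w hv hw h
    rw [smul_add, smul_add, hv h, hw h]
  smul_mem' := by
    intro a v hv h
    have e : ofCartan h • a • v = a • ofCartan h • v := by
      rw [← algebraMap_smul (DDAHA n) a v, ← algebraMap_smul (DDAHA n) a (ofCartan h • v),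
        ← mul_smul, ← mul_smul, Algebra.commutes]
    rw [e, hv h, smul_comm]

end DDAHA

namespace DegenerateDAHA

/-! ### Parameters -/

/-- The pairs `(λ, μ)` in `ℤ^p × ℤ^p` such that `λ - μ` has nonnegative entries
with sum `n`. -/
def Param (n p : ℕ) : Set ((Fin p → ℤ) × (Fin p → ℤ)) :=
  {x | (∀ i, 0 ≤ x.1 i - x.2 i) ∧ ∑ i, (x.1 i - x.2 i) = n}

/-- The numbers `[λ]_i` for `0 ≤ i ≤ p - 1`:
`[λ]_0 = κ - p + 1 - λ_1 + λ_p` and `[λ]_i = λ_i - λ_{i+1} + 1` for `i ≥ 1`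
(so `λ_i` is `lam (i - 1)` and `λ_{i+1}` is `lam i`). -/
def bracket {p : ℕ} (κ : ℤ) (lam : Fin p → ℤ) (i : Fin p) : ℤ :=
  if (i : ℕ) = 0 then
    κ - p + 1 - lam ⟨0, i.pos⟩ + lam ⟨p - 1, Nat.sub_lt i.pos Nat.one_pos⟩
  else
    lam ⟨i - 1, lt_of_le_of_lt (Nat.sub_le _ _) i.isLt⟩ - lam i + 1

/-- The affine dominant elements of `ℤ^p`. -/
def affDom (p : ℕ) (κ : ℤ) : Set (Fin p → ℤ) := {lam | ∀ i, 0 ≤ bracket κ lam i}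

/-- The elements of `ℤ^p` which are dominant at the walls containing `μ`. -/
def affDomAt {p : ℕ} (κ : ℤ) (mu : Fin p → ℤ) : Set (Fin p → ℤ) :=
  {lam | ∀ i, bracket κ mu i = 0 → 0 ≤ bracket κ lam i}

/-- The affine dominant parameters. -/
def affParam (n p : ℕ) (κ : ℤ) : Set ((Fin p → ℤ) × (Fin p → ℤ)) :=
  {x | x ∈ Param n p ∧ x.2 ∈ affDom p κ ∧ x.1 ∈ affDomAt κ x.2}

/-- `n_i = ∑_{j ≤ i} (λ_j - μ_j)`, for `0 ≤ i ≤ p`. -/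
def partialSum {p : ℕ} (lam mu : Fin p → ℤ) (i : ℕ) : ℤ :=
  ∑ j : Fin p, if (j : ℕ) < i then lam j - mu j else 0

/-- The Young subgroup `W_{λ-μ}`, generated by the `s_a`, `1 ≤ a ≤ n - 1`, with `a` different
from `n_1, …, n_{p-1}`; here `a = b + 1` and `s_a` exchanges `b` and `b + 1`
(zero-based). -/
def youngSubgroup (n : ℕ) {p : ℕ} (lam mu : Fin p → ℤ) : Subgroup (Equiv.Perm (Fin n)) :=
  Subgroup.closure
    {s | ∃ (b : ℕ) (hb : b + 1 < n),
      (∀ i : ℕ, 1 ≤ i → i < p → ((b + 1 : ℕ) : ℤ) ≠ partialSum lam mu i) ∧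
        s = Equiv.swap ⟨b, Nat.lt_of_succ_lt hb⟩ ⟨b + 1, hb⟩}

/-- The number `⟨ζ_{λ,μ} | ε^∨_j⟩ = μ_i - i + j - n_{i-1}` for `n_{i-1} < j ≤ n_i`.
For a parameter `(λ, μ)` exactly one summand has its condition satisfied. In the formula
`i` and `j` are zero-based, whence the `+ 1`s. -/
def zetaCoeff {n p : ℕ} (lam mu : Fin p → ℤ) (j : Fin n) : ℤ :=
  ∑ i : Fin p,
    if partialSum lam mu i < (j : ℤ) + 1 ∧ (j : ℤ) + 1 ≤ partialSum lam mu (i + 1) then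
      mu i - ((i : ℤ) + 1) + ((j : ℤ) + 1) - partialSum lam mu i
    else 0

/-- The weight `ζ^κ_{λ,μ} = ζ_{λ,μ} + κ c^*`. -/
def zeta (n : ℕ) {p : ℕ} (κ : ℤ) (lam mu : Fin p → ℤ) : Cartan n →ₗ[ℂ] ℂ where
  toFun h := ∑ j, (zetaCoeff lam mu j : ℂ) * h.1 j + (κ : ℂ) * h.2
  map_add' h h' := by
    simp only [Prod.fst_add, Prod.snd_add, Pi.add_apply, mul_add, Finset.sum_add_distrib]
    ring
  map_smul' a h := by
    simp only [Prod.smul_fst, Prod.smul_snd, Pi.smul_apply, smul_eq_mul, RingHom.id_apply,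
      mul_add, Finset.mul_sum]
    congr 1
    · exact Finset.sum_congr rfl fun j _ => by ring
    · ring

/-! ### The induced module -/

/-- The left ideal generated by the `w - 1`, `w ∈ W_{λ-μ}`, and the
`h - ⟨ζ^κ_{λ,μ} | h⟩`. It is the left ideal generated by the annihilator of the vector `𝟏` of
the one-dimensional module over the subalgebra generated by `W_{λ-μ}` and the `h`. -/
def inducingIdeal (n : ℕ) {p : ℕ} (κ : ℤ) (lam mu : Fin p → ℤ) :
    Submodule (DDAHA n) (DDAHA n) :=
  Submodule.span (DDAHA n)
    ({x | ∃ w ∈ youngSubgroup n lam mu, x = DDAHA.ofGroup (finite w) - 1} ∪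
      {x | ∃ h : Cartan n,
        x = DDAHA.ofCartan h - algebraMap ℂ (DDAHA n) (zeta n κ lam mu h)})

/-- The module induced from the one-dimensional module `ℂ 𝟏` over the subalgebra generated by
`W_{λ-μ}` and `⨁ ℂ ε^∨_i ⊕ ℂ c`, on which `W_{λ-μ}` acts trivially and the `h` by
`ζ^κ_{λ,μ}`. Since `ℂ 𝟏` is generated by `𝟏`, the tensor product is the quotient of the algebra
by the left ideal generated by the annihilator of `𝟏`. -/
abbrev InducedModule (n : ℕ) {p : ℕ} (κ : ℤ) (lam mu : Fin p → ℤ) : Type :=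
  DDAHA n ⧸ inducingIdeal n κ lam mu

/-- The generator `𝟏_{λ,μ}` of the induced module. -/
def inducedOne (n : ℕ) {p : ℕ} (κ : ℤ) (lam mu : Fin p → ℤ) : InducedModule n κ lam mu :=
  Submodule.Quotient.mk 1

end DegenerateDAHA

end

/-! The extended affine Weyl group acts faithfully on `ℤ` by permutations commuting with the shift
by `n`. If `e` has weight `ζ`, then `h • w e` equals `ζ (w⁻¹ h) w e` plus a combination of the `w *
refl r c` applied to `e`, over the pairs `(r, c)` inverted by `w` (`ofCartan_smul_ofGroup_smul`).
Undoing an inversion lowers `energy`, so the Cartan subalgebra acts triangularly. The same formula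
defines a module on the free vector space over the cosets of the parabolic subgroup (`modelHom`), so
the translates of the generator, one for each coset, form a basis of the induced module.

By triangularity, a term of maximal energy in a weight vector of weight `ζ'` comes from some `w`,
increasing on the blocks, with `w ζ = ζ'` (`exists_top_term`). The weight becomes a function `u` on
`ℤ`, increasing by one along each block. Dominance of `μ` gives a monotone function `G`, constant on
blocks, and the condition on `λ` says that blocks with equal `G` have weakly decreasing lengths. Two
combinatorial facts follow. A permutation that is increasing on blocks and preserves `u` also
preserves `G` (`mem_levi`), so a vector `v` of weight `ζ` involves only the finite group `levi`. No
permutation increasing on blocks carries `u` to `u` with two neighbours of a block exchanged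
(`not_exists_refl`), so `v` is invariant under the Young subgroup, and there is an endomorphism `E`
with `E e = v`.

Let `x` be the sum of the elements of `levi`. Then `x v` is a multiple `a x e`, because `x` absorbs
`levi`. Moreover `f x e = e` for some `f` (`exists_smul_symVec`), found by removing positions of a
period one by one. Hence `v = E (f x e) = f x v = a e`, so the weight space is the line spanned by
`e`.

For the simple quotient, a proper submodule contains no nonzero generalized weight vector for `ζ`:
the Cartan algebra would turn it into a nonzero multiple of `e`. Every vector is carried to the
generalized weight space by an element of the Cartan algebra fixing `e`
(`exists_smul_mem_genWeightSpace`). If two distinct maximal submodules existed, then `e = a + b`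
with `a`, `b` in them, and two such elements together would kill `a + b` while fixing `e`. -/

noncomputable section

/-! ### Affine permutations of the integers and their reflections -/

namespace DegenerateDAHA

variable {n : ℕ} [NeZero n]

/-- The residue class of an integer, as an element of `Fin n`. -/
def res (q : ℤ) : Fin n :=
  ⟨(q % n).toNat, by
    have hn : (0 : ℤ) < n := by exact_mod_cast Nat.pos_of_neZero n
    have := Int.emod_nonneg q hn.ne'
    have := Int.emod_lt_of_pos q hn
    omega⟩

theorem natCast_pos' : (0 : ℤ) < n := by exact_mod_cast Nat.pos_of_neZero n

theorem coe_res (q : ℤ) : ((res q : Fin n) : ℤ) = q % n := by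
  have := Int.emod_nonneg q (natCast_pos' (n := n)).ne'
  simp [res, this]

theorem res_add_mul_ediv (q : ℤ) : ((res q : Fin n) : ℤ) + n * (q / n) = q := by
  rw [coe_res]; exact Int.emod_add_mul_ediv q n

theorem res_fin_add (i : Fin n) (k : ℤ) : (res ((i : ℤ) + n * k) : Fin n) = i := by
  apply Fin.ext
  have := coe_res (n := n) ((i : ℤ) + n * k)
  rw [Int.add_mul_emod_self_left, Int.emod_eq_of_lt (by positivity) (by exact_mod_cast i.isLt)]
    at this
  exact_mod_cast this

theorem ediv_fin_add (i : Fin n) (k : ℤ) : ((i : ℤ) + n * k) / n = k := by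
  rw [Int.add_mul_ediv_left _ _ (natCast_pos' (n := n)).ne',
    Int.ediv_eq_zero_of_lt (by positivity) (by exact_mod_cast i.isLt), zero_add]

@[simp] theorem res_fin (i : Fin n) : (res (i : ℤ) : Fin n) = i := by
  simpa using res_fin_add i 0

@[simp] theorem fin_ediv (i : Fin n) : ((i : ℤ)) / (n : ℤ) = 0 := by
  simpa using ediv_fin_add i 0

theorem res_add_mul (q k : ℤ) : (res (q + n * k) : Fin n) = res q := by
  apply Fin.ext
  have := coe_res (n := n) (q + n * k)
  rw [Int.add_mul_emod_self_left, ← coe_res] at this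
  exact_mod_cast this

theorem res_eq_iff {a b : ℤ} : (res a : Fin n) = res b ↔ ∃ k : ℤ, a = b + n * k := by
  constructor
  · intro h
    refine ⟨a / n - b / n, ?_⟩
    have h1 := res_add_mul_ediv (n := n) a
    have h2 := res_add_mul_ediv (n := n) b
    rw [h] at h1
    linarith [mul_sub (n : ℤ) (a / n) (b / n)]
  · rintro ⟨k, rfl⟩
    exact res_add_mul b k

/-- The extended affine Weyl group acts on the integers by affine permutations. -/
instance affWeylMulAction : MulAction (AffWeyl n) ℤ where
  smul g q := (g.right (res q) : ℤ) +
    n * (q / n + Multiplicative.toAdd (g.left (g.right (res q))))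
  one_smul q := by
    change ((res q : Fin n) : ℤ) + n * (q / n + 0) = q
    rw [add_zero, res_add_mul_ediv]
  mul_smul g g' q := by
    change ((g * g').right (res q) : ℤ) +
      n * (q / n + Multiplicative.toAdd ((g * g').left ((g * g').right (res q)))) =
      (g.right (res ((g'.right (res q) : ℤ) +
        n * (q / n + Multiplicative.toAdd (g'.left (g'.right (res q)))))) : ℤ) +
      n * (((g'.right (res q) : ℤ) +
        n * (q / n + Multiplicative.toAdd (g'.left (g'.right (res q))))) / n +
        Multiplicative.toAdd (g.left (g.right (res ((g'.right (res q) : ℤ) +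
        n * (q / n + Multiplicative.toAdd (g'.left (g'.right (res q)))))))))
    rw [res_fin_add, ediv_fin_add]
    simp only [SemidirectProduct.mul_right, SemidirectProduct.mul_left, Equiv.Perm.mul_apply,
      Pi.mul_apply, toAdd_mul]
    rw [show (mulAutArrow g.right) g'.left (g.right (g'.right (res q))) =
      g'.left (g'.right (res q)) from congrArg g'.left (g.right.symm_apply_apply _)]
    ring

theorem smul_def (g : AffWeyl n) (q : ℤ) : g • q = (g.right (res q) : ℤ) +
    n * (q / n + Multiplicative.toAdd (g.left (g.right (res q)))) := rfl

theorem res_smul (g : AffWeyl n) (q : ℤ) : (res (g • q) : Fin n) = g.right (res q) := by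
  rw [smul_def, res_fin_add]

theorem smul_ediv (g : AffWeyl n) (q : ℤ) :
    (g • q) / (n : ℤ) = q / n + Multiplicative.toAdd (g.left (g.right (res q))) := by
  rw [smul_def, ediv_fin_add]

theorem smul_add_mul (g : AffWeyl n) (q k : ℤ) : g • (q + n * k) = g • q + n * k := by
  rw [smul_def, smul_def, res_add_mul, Int.add_mul_ediv_left _ _ (natCast_pos' (n := n)).ne']
  ring

theorem smul_add_self (g : AffWeyl n) (q : ℤ) : g • (q + n) = g • q + n := by
  simpa using smul_add_mul g q 1

theorem smul_eq_res (g : AffWeyl n) (q : ℤ) :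
    g • q = g • (((res q : Fin n) : ℕ) : ℤ) + n * (q / n) := by
  conv_lhs => rw [← res_add_mul_ediv (n := n) q]
  rw [smul_add_mul]

/-- Faithfulness of the action on `ℤ`: residues recover the finite part and quotients by `n` the
translation part. Identities in the group are checked on integers from here on. -/
theorem ext_smul {g g' : AffWeyl n} (h : ∀ q : ℤ, g • q = g' • q) : g = g' := by
  have hr : g.right = g'.right := by
    ext1 i
    have := congrArg (res (n := n)) (h i)
    simpa [res_smul] using this
  refine SemidirectProduct.ext ?_ hr
  funext j
  have := congrArg (fun x : ℤ => x / (n : ℤ)) (h (g.right.symm j))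
  simp only [smul_ediv, res_fin, hr.symm, Equiv.apply_symm_apply] at this
  exact Multiplicative.toAdd.injective (by simpa using this)

theorem smul_inj (g : AffWeyl n) {a b : ℤ} : g • a = g • b ↔ a = b :=
  smul_left_cancel_iff g

theorem res_smul_eq_iff (g : AffWeyl n) {a b : ℤ} :
    (res (g • a) : Fin n) = res (g • b) ↔ (res a : Fin n) = res b := by
  rw [res_smul, res_smul, g.right.injective.eq_iff]

/-- The reflection exchanging the integers `a` and `b`, together with all their simultaneous
translates by multiples of `n`. -/
def refl (a b : ℤ) : AffWeyl n :=
  translation (-((b / n - a / n) • (Pi.single (res a) 1 - Pi.single (res b) 1 : Fin n → ℤ))) *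
    finite (Equiv.swap (res a) (res b))

theorem refl_smul_of_ne {a b q : ℤ} (ha : (res q : Fin n) ≠ res a) (hb : (res q : Fin n) ≠ res b) :
    (refl a b : AffWeyl n) • q = q := by
  rw [smul_def]
  simp only [refl, translation, finite, SemidirectProduct.mul_right, SemidirectProduct.right_inl,
    SemidirectProduct.right_inr, one_mul, SemidirectProduct.mul_left, SemidirectProduct.left_inl,
    SemidirectProduct.left_inr, map_one, mul_one, Equiv.swap_apply_of_ne_of_ne ha hb]
  simp [ha, hb, res_add_mul_ediv]

theorem refl_smul_left {a b : ℤ} (h : (res a : Fin n) ≠ res b) :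
    (refl a b : AffWeyl n) • a = b := by
  rw [smul_def]
  simp only [refl, translation, finite, SemidirectProduct.mul_right, SemidirectProduct.right_inl,
    SemidirectProduct.right_inr, one_mul, SemidirectProduct.mul_left, SemidirectProduct.left_inl,
    SemidirectProduct.left_inr, map_one, mul_one, Equiv.swap_apply_left]
  simp [h.symm, res_add_mul_ediv]

theorem refl_smul_right {a b : ℤ} (h : (res a : Fin n) ≠ res b) :
    (refl a b : AffWeyl n) • b = a := by
  rw [smul_def]
  simp only [refl, translation, finite, SemidirectProduct.mul_right, SemidirectProduct.right_inl,
    SemidirectProduct.right_inr, one_mul, SemidirectProduct.mul_left, SemidirectProduct.left_inl,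
    SemidirectProduct.left_inr, map_one, mul_one, Equiv.swap_apply_right]
  simp [h, res_add_mul_ediv]

theorem refl_smul_left_add {a b : ℤ} (h : (res a : Fin n) ≠ res b) (k : ℤ) :
    (refl a b : AffWeyl n) • (a + n * k) = b + n * k := by
  rw [smul_add_mul, refl_smul_left h]

theorem refl_smul_right_add {a b : ℤ} (h : (res a : Fin n) ≠ res b) (k : ℤ) :
    (refl a b : AffWeyl n) • (b + n * k) = a + n * k := by
  rw [smul_add_mul, refl_smul_right h]

theorem refl_eq_one {a b : ℤ} (h : (res a : Fin n) = res b) : (refl a b : AffWeyl n) = 1 := by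
  simp only [refl, h, sub_self, smul_zero, neg_zero, Equiv.swap_self]
  rfl

theorem mul_refl (g : AffWeyl n) (a b : ℤ) : g * refl a b = refl (g • a) (g • b) * g := by
  by_cases h : (res a : Fin n) = res b
  · rw [refl_eq_one h, refl_eq_one ((res_smul_eq_iff g).2 h), mul_one, one_mul]
  have h' : (res (g • a) : Fin n) ≠ res (g • b) := (res_smul_eq_iff g).not.2 h
  apply ext_smul
  intro q
  rw [mul_smul, mul_smul]
  by_cases ha : (res q : Fin n) = res a
  · obtain ⟨k, rfl⟩ := res_eq_iff.1 ha
    rw [refl_smul_left_add h, smul_add_mul, smul_add_mul, refl_smul_left_add h']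
  by_cases hb : (res q : Fin n) = res b
  · obtain ⟨k, rfl⟩ := res_eq_iff.1 hb
    rw [refl_smul_right_add h, smul_add_mul, smul_add_mul, refl_smul_right_add h']
  rw [refl_smul_of_ne ha hb, refl_smul_of_ne ((res_smul_eq_iff g).not.2 ha)
    ((res_smul_eq_iff g).not.2 hb)]

theorem refl_mul_self (a b : ℤ) : (refl a b : AffWeyl n) * refl a b = 1 := by
  by_cases h : (res a : Fin n) = res b
  · rw [refl_eq_one h, mul_one]
  apply ext_smul
  intro q
  rw [mul_smul, one_smul]
  by_cases ha : (res q : Fin n) = res a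
  · obtain ⟨k, rfl⟩ := res_eq_iff.1 ha
    rw [refl_smul_left_add h, refl_smul_right_add h]
  by_cases hb : (res q : Fin n) = res b
  · obtain ⟨k, rfl⟩ := res_eq_iff.1 hb
    rw [refl_smul_right_add h, refl_smul_left_add h]
  rw [refl_smul_of_ne ha hb, refl_smul_of_ne ha hb]

theorem refl_inv (a b : ℤ) : (refl a b : AffWeyl n)⁻¹ = refl a b :=
  inv_eq_of_mul_eq_one_left (refl_mul_self a b)

theorem refl_smul_smul (a b q : ℤ) : (refl a b : AffWeyl n) • (refl a b : AffWeyl n) • q = q := by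
  rw [← mul_smul, refl_mul_self, one_smul]

theorem refl_comm (a b : ℤ) : (refl a b : AffWeyl n) = refl b a := by
  have := mul_refl (refl a b : AffWeyl n) a b
  by_cases h : (res a : Fin n) = res b
  · rw [refl_eq_one h, refl_eq_one h.symm]
  rw [refl_smul_left h, refl_smul_right h] at this
  exact mul_right_cancel this

theorem refl_add_mul (a b k : ℤ) : (refl (a + n * k) (b + n * k) : AffWeyl n) = refl a b := by
  have hn := (natCast_pos' (n := n)).ne'
  simp only [refl, res_add_mul, Int.add_mul_ediv_left _ _ hn, add_sub_add_right_eq_sub]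

theorem res_ne_succ (hn : 1 < n) (a : ℤ) : (res a : Fin n) ≠ res (a + 1) := by
  intro h
  obtain ⟨k, hk⟩ := res_eq_iff.1 h
  have h1 : (n : ℤ) * k = -1 := by linarith
  have : (n : ℤ) ∣ 1 := ⟨-k, by linarith⟩
  have := Int.le_of_dvd one_pos this
  omega

/-- A simple reflection reverses the order of no two integers but the ones that it exchanges. -/
theorem refl_succ_lt_iff (hn : 1 < n) {a p q : ℤ}
    (h : ∀ k : ℤ, ¬ (p = a + n * k ∧ q = a + 1 + n * k))
    (h' : ∀ k : ℤ, ¬ (q = a + n * k ∧ p = a + 1 + n * k)) :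
    (refl a (a + 1) : AffWeyl n) • p < (refl a (a + 1) : AffWeyl n) • q ↔ p < q := by
  have hne := res_ne_succ hn a
  -- The reflection moves each integer by at most one, so only neighbours or integers at distance
  -- two could change order; the cases below exclude all but the exchanged pairs.
  have hcase : ∀ x : ℤ, (∃ k : ℤ, x = a + n * k ∧ (refl a (a + 1) : AffWeyl n) • x = x + 1) ∨
      (∃ k : ℤ, x = a + 1 + n * k ∧ (refl a (a + 1) : AffWeyl n) • x = x - 1) ∨
      ((∀ k : ℤ, x ≠ a + n * k) ∧ (∀ k : ℤ, x ≠ a + 1 + n * k) ∧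
        (refl a (a + 1) : AffWeyl n) • x = x) := by
    intro x
    by_cases ha : (res x : Fin n) = res a
    · obtain ⟨k, rfl⟩ := res_eq_iff.1 ha
      exact Or.inl ⟨k, rfl, by rw [refl_smul_left_add hne]; ring⟩
    by_cases hb : (res x : Fin n) = res (a + 1)
    · obtain ⟨k, rfl⟩ := res_eq_iff.1 hb
      exact Or.inr (Or.inl ⟨k, rfl, by rw [refl_smul_right_add hne]; ring⟩)
    · refine Or.inr (Or.inr ⟨fun k hk => ha ?_, fun k hk => hb ?_, refl_smul_of_ne ha hb⟩)
      · rw [hk, res_add_mul]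
      · rw [hk, res_add_mul]
  rcases hcase p with ⟨k, hp, ep⟩ | ⟨k, hp, ep⟩ | ⟨hp, hp', ep⟩ <;>
  rcases hcase q with ⟨l, hq, eq⟩ | ⟨l, hq, eq⟩ | ⟨hq, hq', eq⟩ <;> rw [ep, eq]
  · omega
  · have : q ≠ p + 1 := fun e => h k ⟨hp, by rw [e, hp]; ring⟩
    have : q ≠ p + 2 := by
      intro e
      have h1 : (n : ℤ) * (l - k) = 1 := by rw [mul_sub]; linarith
      have := Int.le_of_dvd one_pos ⟨_, h1.symm⟩
      omega
    omega
  · have : q ≠ p + 1 := fun e => hq' k (by rw [e, hp]; ring)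
    omega
  · have : p ≠ q + 1 := fun e => h' l ⟨hq, by rw [e, hq]; ring⟩
    have : p ≠ q := by
      rintro rfl
      exact hne (by rw [← res_add_mul a l, ← hq, hp, res_add_mul])
    omega
  · exact sub_lt_sub_iff_right 1
  · have : q ≠ p - 1 := fun e => hq k (by rw [e, hp]; ring)
    have : q ≠ p := fun e => hq' k (by rw [e, hp])
    omega
  · have : p ≠ q + 1 := fun e => hp' l (by rw [e, hq]; ring)
    have : p ≠ q := fun e => hp l (by rw [e, hq])
    omega
  · have : p ≠ q - 1 := fun e => hp l (by rw [e, hq]; ring)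
    have : p ≠ q := fun e => hp' l (by rw [e, hq])
    omega

end DegenerateDAHA

namespace DegenerateDAHA

variable {n : ℕ}

/-! ### The action on the Cartan subalgebra -/

theorem act_one (h : Cartan n) : act 1 h = h := by
  refine Prod.ext rfl ?_
  simp [act]

theorem act_mul (g g' : AffWeyl n) (h : Cartan n) : act (g * g') h = act g (act g' h) := by
  refine Prod.ext ?_ ?_
  · funext j
    simp [act, Equiv.Perm.mul_apply]
  · have key : ∀ j, (g * g').left j = g.left j * g'.left (g.right⁻¹ j) := fun j => rfl
    have e := Equiv.sum_comp g.right⁻¹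
      (fun j => ((Multiplicative.toAdd (g'.left j) : ℤ) : ℂ) * h.1 (g'.right⁻¹ j))
    simp only [act, key, SemidirectProduct.mul_right, mul_inv_rev, Equiv.Perm.mul_apply,
      toAdd_mul, Int.cast_add, add_mul, Finset.sum_add_distrib, ← e]
    ring

theorem act_add (g : AffWeyl n) (h h' : Cartan n) : act g (h + h') = act g h + act g h' := by
  refine Prod.ext rfl ?_
  simp only [act, Prod.fst_add, Prod.snd_add, Pi.add_apply, mul_add, Finset.sum_add_distrib]
  ring

theorem act_smul (g : AffWeyl n) (a : ℂ) (h : Cartan n) : act g (a • h) = a • act g h := by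
  refine Prod.ext rfl ?_
  simp only [act, Prod.smul_fst, Prod.smul_snd, Pi.smul_apply, smul_eq_mul, mul_sub,
    Finset.mul_sum]
  congr 1
  exact Finset.sum_congr rfl fun j _ => by ring

theorem act_inv_act (g : AffWeyl n) (h : Cartan n) : act g⁻¹ (act g h) = h := by
  rw [← act_mul, inv_mul_cancel, act_one]

theorem act_act_inv (g : AffWeyl n) (h : Cartan n) : act g (act g⁻¹ h) = h := by
  rw [← act_mul, mul_inv_cancel, act_one]

theorem act_fst_right (g : AffWeyl n) (h : Cartan n) (i : Fin n) :
    (act g h).1 (g.right i) = h.1 i := by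
  simp [act]

theorem act_inv_fst (g : AffWeyl n) (h : Cartan n) (i : Fin n) :
    (act g⁻¹ h).1 i = h.1 (g.right i) := by
  simp [act]

variable [NeZero n]

/-- The element `ε_q^∨`, for any integer `q`, with `ε_{q+n}^∨ = ε_q^∨ - c`. -/
def epsCheck (q : ℤ) : Cartan n := (Pi.single (res q) 1, -((q / (n : ℤ) : ℤ) : ℂ))

/-- Indexing by all integers absorbs the component along `c`, so the affine action is a permutation
of indices and a weight becomes a function on `ℤ`. -/
theorem act_epsCheck (g : AffWeyl n) (q : ℤ) : act g (epsCheck q) = epsCheck (g • q) := by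
  refine Prod.ext ?_ ?_
  · funext j
    simp only [act, epsCheck, res_smul, Pi.single_apply, Equiv.Perm.inv_eq_iff_eq]
  · simp only [act, epsCheck, smul_ediv, Pi.single_apply, mul_ite, mul_one, mul_zero,
      Equiv.Perm.inv_eq_iff_eq, Finset.sum_ite_eq', Finset.mem_univ, if_true]
    push_cast
    ring

/-! ### The energy of an affine permutation -/

/-- The sum over a period of the squares of the displacements. -/
def energy (g : AffWeyl n) : ℕ := (∑ i : Fin n, (g • (i : ℤ) - (i : ℤ)) ^ 2).toNat

theorem sub_res (g : AffWeyl n) (q : ℤ) :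
    g • (((res q : Fin n) : ℕ) : ℤ) - (((res q : Fin n) : ℕ) : ℤ) = g • q - q := by
  have h1 := smul_eq_res g q
  have h2 := res_add_mul_ediv (n := n) q
  linarith

/-- Only the displacements at the residues of `r` and `c` change, and the sum of squares drops by `2
(c - r) (g • r - g • c)`. -/
theorem energy_mul_refl_lt_of_lt (g : AffWeyl n) {r c : ℤ} (hrc : r < c) (h : g • c < g • r) :
    energy (g * refl r c) < energy g := by
  have hne : (res r : Fin n) ≠ res c := by
    intro e
    obtain ⟨k, rfl⟩ := res_eq_iff.1 e
    rw [smul_add_mul] at h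
    linarith
  have hpos : 0 ≤ ∑ i : Fin n, (g • (i : ℤ) - (i : ℤ)) ^ 2 :=
    Finset.sum_nonneg fun i _ => sq_nonneg _
  have key : ∑ i : Fin n, (((g * refl r c) • (i : ℤ) - (i : ℤ)) ^ 2 - (g • (i : ℤ) - (i : ℤ)) ^ 2)
      = ((g • c - r) ^ 2 - (g • r - r) ^ 2) + ((g • r - c) ^ 2 - (g • c - c) ^ 2) := by
    rw [Finset.sum_eq_add (res r) (res c) hne]
    · rw [sub_res, sub_res, sub_res, sub_res, mul_smul, mul_smul, refl_smul_left hne,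
        refl_smul_right hne]
    · rintro i - ⟨h1, h2⟩
      rw [mul_smul, refl_smul_of_ne (by simpa using h1) (by simpa using h2), sub_self]
    · simp
    · simp
  rw [Finset.sum_sub_distrib] at key
  have h1 : 0 < (c - r) * (g • r - g • c) := mul_pos (by linarith) (by linarith)
  have h2 : ∑ i : Fin n, ((g * refl r c) • (i : ℤ) - (i : ℤ)) ^ 2 <
      ∑ i : Fin n, (g • (i : ℤ) - (i : ℤ)) ^ 2 := by nlinarith
  unfold energy
  have := Finset.sum_nonneg (s := Finset.univ)
    fun (i : Fin n) _ => sq_nonneg ((g * refl r c) • (i : ℤ) - (i : ℤ))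
  omega

/-- `1` if `g` inverts the pair `r < c`, and `-1` if it inverts the pair `c < r`. -/
def invSign (g : AffWeyl n) (r c : ℤ) : ℤ :=
  (if r < c then 1 else 0) - (if g • r < g • c then 1 else 0)

theorem invSign_ne_zero {g : AffWeyl n} {r c : ℤ} (h : invSign g r c ≠ 0) :
    (r < c ∧ g • c < g • r) ∨ (c < r ∧ g • r < g • c) := by
  rcases lt_trichotomy r c with h1 | rfl | h1
  · left
    refine ⟨h1, lt_of_le_of_ne (not_lt.1 fun h2 => ?_) fun h2 => h1.ne ((smul_inj g).1 h2).symm⟩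
    simp [invSign, h1, h2] at h
  · simp [invSign] at h
  · right
    refine ⟨h1, not_le.1 fun h2 => ?_⟩
    simp [invSign, h1.asymm, h2.not_gt] at h

theorem energy_mul_refl_lt (g : AffWeyl n) {r c : ℤ} (h : invSign g r c ≠ 0) :
    energy (g * refl r c) < energy g := by
  rcases invSign_ne_zero h with h1 | h2
  · exact energy_mul_refl_lt_of_lt g h1.1 h1.2
  · rw [refl_comm]
    exact energy_mul_refl_lt_of_lt g h2.1 h2.2

theorem exists_abs_smul_sub_le (g : AffWeyl n) : ∃ C : ℤ, ∀ q : ℤ, |g • q - q| ≤ C := by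
  refine ⟨∑ i : Fin n, |g • (i : ℤ) - (i : ℤ)|, fun q => ?_⟩
  rw [← sub_res]
  exact Finset.single_le_sum (f := fun i : Fin n => |g • (i : ℤ) - (i : ℤ)|)
    (fun i _ => abs_nonneg _) (Finset.mem_univ _)

/-- Displacements are bounded by periodicity, so `r` forms inversions only with integers in a
bounded interval. This makes the sum in `invSum` finite. -/
theorem finite_invSign_ne_zero (g : AffWeyl n) (r : ℤ) : {c | invSign g r c ≠ 0}.Finite := by
  obtain ⟨C, hC⟩ := exists_abs_smul_sub_le g
  apply (Set.finite_Icc (min r (g • r - C)) (max r (g • r + C))).subset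
  intro c hc
  have h3 := abs_le.1 (hC c)
  rcases invSign_ne_zero hc with h1 | h2
  · exact ⟨(min_le_left _ _).trans h1.1.le, le_max_of_le_right (by linarith)⟩
  · exact ⟨min_le_of_right_le (by linarith), h2.1.le.trans (le_max_left _ _)⟩

theorem invSign_add_mul (g : AffWeyl n) (r c k : ℤ) :
    invSign g (r + n * k) (c + n * k) = invSign g r c := by
  simp [invSign, smul_add_mul]

theorem invSign_mul_of_strictMono {g : AffWeyl n} (hg : StrictMono (fun q : ℤ => g • q))
    (w : AffWeyl n) (r c : ℤ) : invSign (g * w) r c = invSign w r c := by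
  simp only [invSign, mul_smul, hg.lt_iff_lt]

theorem invSign_of_strictMono {g : AffWeyl n} (hg : StrictMono (fun q : ℤ => g • q))
    (r c : ℤ) : invSign g r c = 0 := by
  simp only [invSign, hg.lt_iff_lt, sub_self]

/-! ### The inversion formula for the action of the Cartan subalgebra -/

section Cherednik

variable {X : Type*} [AddCommGroup X] [Module ℂ X] (b : AffWeyl n → X)

/-- The part of the action of `ε_{w(r)}^∨` on the vector `b w` which involves the vectors of
lower energy. -/
def invSum (w : AffWeyl n) (r : ℤ) : X := ∑ᶠ c : ℤ, (invSign w r c : ℂ) • b (w * refl r c)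

theorem invSum_support (w : AffWeyl n) (r : ℤ) (f : ℤ → X) :
    (fun c : ℤ => (invSign w r c : ℂ) • f c).HasFiniteSupport := by
  apply (finite_invSign_ne_zero w r).subset
  intro c hc h0
  apply hc
  simp [h0]

theorem invSum_add_mul (w : AffWeyl n) (r k : ℤ) : invSum b w (r + n * k) = invSum b w r := by
  unfold invSum
  rw [← finsum_comp_equiv (Equiv.addRight ((n : ℤ) * k))]
  refine finsum_congr fun c => ?_
  rw [Equiv.coe_addRight, invSign_add_mul, refl_add_mul]

theorem invSum_res (w : AffWeyl n) (r : ℤ) :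
    invSum b w (((res r : Fin n) : ℕ) : ℤ) = invSum b w r := by
  conv_rhs => rw [← res_add_mul_ediv (n := n) r]
  rw [invSum_add_mul]

theorem map_invSum {X' : Type*} [AddCommGroup X'] [Module ℂ X'] (L : X →ₗ[ℂ] X') (w : AffWeyl n)
    (r : ℤ) : L (invSum b w r) = ∑ᶠ c : ℤ, (invSign w r c : ℂ) • L (b (w * refl r c)) := by
  unfold invSum
  have := (L.toAddMonoidHom).map_finsum (invSum_support w r fun c => b (w * refl r c))
  simpa using this

theorem invSum_of_strictMono {w : AffWeyl n} (hw : StrictMono (fun q : ℤ => w • q)) (r : ℤ) :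
    invSum b w r = 0 := by
  simp [invSum, invSign_of_strictMono hw]

/-- `1` if `(r, c)` is a translate of `(j, j + 1)` and `-1` if `(c, r)` is one. -/
def adjSign (n : ℕ) [NeZero n] (j r c : ℤ) : ℤ :=
  (if (res r : Fin n) = res j ∧ c = r + 1 then 1 else 0) -
    (if (res r : Fin n) = res (j + 1) ∧ c = r - 1 then 1 else 0)

theorem refl_succ_order (hn : 1 < n) (j p q : ℤ) :
    (if (refl j (j + 1) : AffWeyl n) • p < (refl j (j + 1) : AffWeyl n) • q then 1 else 0 : ℤ) =
      (if p < q then 1 else 0) - adjSign n j p q := by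
  have hne := res_ne_succ hn j
  unfold adjSign
  by_cases h1 : (res p : Fin n) = res j ∧ q = p + 1
  · obtain ⟨h1, rfl⟩ := h1
    obtain ⟨k, rfl⟩ := res_eq_iff.1 h1
    rw [show j + n * k + 1 = j + 1 + n * k by ring, refl_smul_left_add hne,
      refl_smul_right_add hne]
    simp [h1, hne]
  by_cases h2 : (res p : Fin n) = res (j + 1) ∧ q = p - 1
  · obtain ⟨h2, rfl⟩ := h2
    obtain ⟨k, rfl⟩ := res_eq_iff.1 h2
    rw [show j + 1 + n * k - 1 = j + n * k by ring, refl_smul_left_add hne,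
      refl_smul_right_add hne]
    simp [h2, hne.symm]
  rw [if_neg h1, if_neg h2, sub_zero, sub_zero]
  congr 1
  refine propext (refl_succ_lt_iff hn ?_ ?_)
  · rintro k ⟨rfl, rfl⟩
    exact h1 ⟨res_add_mul _ _, by ring⟩
  · rintro k ⟨rfl, rfl⟩
    exact h2 ⟨res_add_mul _ _, by ring⟩

theorem invSign_refl_mul (hn : 1 < n) (j : ℤ) (w : AffWeyl n) (r c : ℤ) :
    invSign (refl j (j + 1) * w) r c = invSign w r c + adjSign n j (w • r) (w • c) := by
  simp only [invSign, mul_smul, refl_succ_order hn]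
  ring

theorem invSign_mul_refl (hn : 1 < n) (j : ℤ) (w : AffWeyl n) (r c : ℤ) :
    invSign (w * refl j (j + 1)) ((refl j (j + 1) : AffWeyl n) • r)
      ((refl j (j + 1) : AffWeyl n) • c) = invSign w r c - adjSign n j r c := by
  simp only [invSign, mul_smul, refl_succ_order hn, refl_smul_smul]
  ring

theorem adjSign_ne_zero {j r c : ℤ} (h : adjSign n j r c ≠ 0) :
    (c = r + 1 ∨ c = r - 1) ∧ (refl r c : AffWeyl n) = refl j (j + 1) := by
  unfold adjSign at h
  by_cases h1 : (res r : Fin n) = res j ∧ c = r + 1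
  · obtain ⟨h1, rfl⟩ := h1
    obtain ⟨k, rfl⟩ := res_eq_iff.1 h1
    exact ⟨Or.inl rfl, by rw [add_right_comm, refl_add_mul]⟩
  by_cases h2 : (res r : Fin n) = res (j + 1) ∧ c = r - 1
  · obtain ⟨h2, rfl⟩ := h2
    obtain ⟨k, rfl⟩ := res_eq_iff.1 h2
    exact ⟨Or.inr rfl, by rw [show j + 1 + n * k - 1 = j + n * k by ring, refl_add_mul, refl_comm]⟩
  · simp [h1, h2] at h

theorem adjSign_support (g : AffWeyl n) (j r : ℤ) (f : ℤ → X) :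
    (fun c : ℤ => (adjSign n j r (g • c) : ℂ) • f c).HasFiniteSupport := by
  apply (Set.toFinite {g⁻¹ • (r + 1), g⁻¹ • (r - 1)}).subset
  intro c hc
  have : adjSign n j r (g • c) ≠ 0 := fun h0 => hc (by simp [h0])
  rcases (adjSign_ne_zero this).1 with h | h
  · exact Or.inl (by rw [← h, inv_smul_smul])
  · exact Or.inr (by rw [Set.mem_singleton_iff, ← h, inv_smul_smul])

theorem finsum_adjSign (hn : 1 < n) (g : AffWeyl n) (j r : ℤ) (x : X) :
    ∑ᶠ c : ℤ, (adjSign n j r (g • c) : ℂ) • x =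
      ((if (res r : Fin n) = res j then (1 : ℂ) else 0) -
        (if (res r : Fin n) = res (j + 1) then (1 : ℂ) else 0)) • x := by
  have hne := res_ne_succ hn j
  refine (finsum_comp_equiv (MulAction.toPerm g) (f := fun c => (adjSign n j r c : ℂ) • x)).trans ?_
  unfold adjSign
  by_cases h1 : (res r : Fin n) = res j
  · have h2 : ¬ (res r : Fin n) = res (j + 1) := h1 ▸ hne
    rw [finsum_eq_single _ (r + 1) (fun c hc => by simp [h2, hc])]
    simp [h1, hne]
  by_cases h2 : (res r : Fin n) = res (j + 1)
  · rw [finsum_eq_single _ (r - 1) (fun c hc => by simp [h1, hc])]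
    simp [h2, hne.symm]
  · simp [h1, h2]

/-- A simple reflection on the left changes the order of the exchanged neighbours only, so at most
one inversion involving `r` is gained or lost. For that pair, the reflection `refl r c` on the right
cancels the new factor on the left, so the correction is a multiple of `b w`. -/
theorem invSum_refl_mul (hn : 1 < n) (j : ℤ) (w : AffWeyl n) (r : ℤ) :
    invSum b (refl j (j + 1) * w) r = invSum (fun g => b (refl j (j + 1) * g)) w r +
      ((if (res (w • r) : Fin n) = res j then (1 : ℂ) else 0) -
        (if (res (w • r) : Fin n) = res (j + 1) then (1 : ℂ) else 0)) • b w := by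
  rw [← finsum_adjSign hn w]
  unfold invSum
  rw [← finsum_add_distrib (invSum_support w r _) (adjSign_support w j _ _)]
  refine finsum_congr fun c => ?_
  rw [invSign_refl_mul hn, Int.cast_add, add_smul, mul_assoc]
  congr 1
  by_cases h : adjSign n j (w • r) (w • c) = 0
  · simp [h]
  · rw [mul_refl, (adjSign_ne_zero h).2, ← mul_assoc, refl_mul_self, one_mul]

theorem invSum_mul_refl (hn : 1 < n) {j : ℤ} (hb : ∀ w, b (w * refl j (j + 1)) = b w)
    (w : AffWeyl n) (r : ℤ) :
    invSum b (w * refl j (j + 1)) ((refl j (j + 1) : AffWeyl n) • r) = invSum b w r -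
      ((if (res r : Fin n) = res j then (1 : ℂ) else 0) -
        (if (res r : Fin n) = res (j + 1) then (1 : ℂ) else 0)) • b w := by
  rw [← finsum_adjSign hn 1]
  unfold invSum
  rw [← finsum_sub_distrib (invSum_support w r _) (adjSign_support 1 j _ _),
    ← finsum_comp_equiv (MulAction.toPerm (refl j (j + 1) : AffWeyl n))]
  refine finsum_congr fun c => ?_
  rw [MulAction.toPerm_apply, invSign_mul_refl hn, Int.cast_sub, sub_smul, mul_assoc, mul_refl,
    refl_smul_smul, refl_smul_smul, ← mul_assoc, hb, one_smul]
  congr 1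
  by_cases h : adjSign n j r c = 0
  · simp [h]
  · rw [(adjSign_ne_zero h).2, hb]

variable (ζ : Cartan n →ₗ[ℂ] ℂ)

/-- The action of the Cartan subalgebra on the vectors `b w` which span an induced module. -/
def cherednik (h : Cartan n) (w : AffWeyl n) : X :=
  ζ (act w⁻¹ h) • b w + ∑ r : Fin n, h.1 (w.right r) • invSum b w r

theorem cherednik_add (h h' : Cartan n) (w : AffWeyl n) :
    cherednik b ζ (h + h') w = cherednik b ζ h w + cherednik b ζ h' w := by
  simp only [cherednik, act_add, map_add, add_smul, Prod.fst_add, Pi.add_apply,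
    Finset.sum_add_distrib]
  abel

theorem cherednik_smul (a : ℂ) (h : Cartan n) (w : AffWeyl n) :
    cherednik b ζ (a • h) w = a • cherednik b ζ h w := by
  simp only [cherednik, act_smul, map_smul, Prod.smul_fst, Pi.smul_apply, smul_eq_mul, smul_add,
    Finset.smul_sum, mul_smul]

theorem map_cherednik {X' : Type*} [AddCommGroup X'] [Module ℂ X'] (L : X →ₗ[ℂ] X')
    (h : Cartan n) (w : AffWeyl n) :
    L (cherednik b ζ h w) = cherednik (fun g => L (b g)) ζ h w := by
  simp only [cherednik, map_add, map_smul, map_sum, map_invSum]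
  rfl

theorem cherednik_of_strictMono {w : AffWeyl n} (hw : StrictMono (fun q : ℤ => w • q))
    (h : Cartan n) : cherednik b ζ h w = ζ (act w⁻¹ h) • b w := by
  simp [cherednik, invSum_of_strictMono b hw]

theorem cherednik_mul_of_strictMono {g : AffWeyl n} (hg : StrictMono (fun q : ℤ => g • q))
    (h : Cartan n) (w : AffWeyl n) :
    cherednik b ζ (act g h) (g * w) = cherednik (fun w => b (g * w)) ζ h w := by
  simp only [cherednik, mul_inv_rev, act_mul, act_inv_act, invSum, invSign_mul_of_strictMono hg,
    SemidirectProduct.mul_right, Equiv.Perm.mul_apply, act_fst_right, mul_assoc]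

/-- This is the defining relation between a simple reflection and `h`, read on the formula: the
corrections from `invSum_refl_mul` add up to the pairing of `h` with the simple root. -/
theorem cherednik_refl_mul (hn : 1 < n) (j : ℤ) (h : Cartan n) (w : AffWeyl n) :
    cherednik b ζ (act (refl j (j + 1)) h) (refl j (j + 1) * w) =
      cherednik (fun w => b (refl j (j + 1) * w)) ζ h w +
        (h.1 (res j) - h.1 (res (j + 1))) • b w := by
  simp only [cherednik, mul_inv_rev, act_mul, act_inv_act, invSum_refl_mul b hn, smul_add,
    SemidirectProduct.mul_right, Equiv.Perm.mul_apply, act_fst_right, Finset.sum_add_distrib,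
    res_smul, res_fin, smul_smul, ← Finset.sum_smul, add_assoc]
  congr 3
  rw [Equiv.sum_comp w.right (fun i => h.1 i * ((if i = res j then (1 : ℂ) else 0) -
    if i = res (j + 1) then 1 else 0))]
  simp [mul_sub, Finset.sum_sub_distrib]

/-- The inversions gained or lost contribute a multiple of `b w` that cancels the change of `ζ`
prescribed by `hζ`. Hence the formula depends only on the coset of `w`. -/
theorem cherednik_mul_refl (hn : 1 < n) {j : ℤ} (hb : ∀ w, b (w * refl j (j + 1)) = b w)
    (hζ : ∀ h : Cartan n, ζ (act (refl j (j + 1)) h) = ζ h + (h.1 (res j) - h.1 (res (j + 1))))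
    (h : Cartan n) (w : AffWeyl n) :
    cherednik b ζ h (w * refl j (j + 1)) = cherednik b ζ h w := by
  set s : AffWeyl n := refl j (j + 1) with hs
  have e1 : ∑ r : Fin n, h.1 ((w * s).right r) • invSum b (w * s) r =
      ∑ r : Fin n, h.1 (w.right r) • (invSum b w r -
      ((if r = res j then (1 : ℂ) else 0) - (if r = res (j + 1) then (1 : ℂ) else 0)) • b w) := by
    rw [← Equiv.sum_comp s.right]
    refine Finset.sum_congr rfl fun r _ => ?_
    have h1 : (w * s).right (s.right r) = w.right r := by
      have := congrArg (SemidirectProduct.right) (refl_mul_self (n := n) j (j + 1))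
      rw [SemidirectProduct.mul_right, Equiv.Perm.mul_apply, ← Equiv.Perm.mul_apply,
        ← Equiv.Perm.mul_apply, mul_assoc]
      rw [SemidirectProduct.mul_right, SemidirectProduct.one_right] at this
      rw [hs, this, mul_one]
    have h2 : invSum b (w * s) ((s.right r : ℕ) : ℤ) = invSum b (w * s) (s • (r : ℤ)) := by
      rw [← invSum_res b (w * s) (s • (r : ℤ)), res_smul, res_fin]
    rw [h1, h2, invSum_mul_refl b hn hb, res_fin]
  rw [cherednik, e1, mul_inv_rev, hs, refl_inv, act_mul, hζ, hb, act_inv_fst, act_inv_fst]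
  simp only [cherednik, smul_sub, Finset.sum_sub_distrib, smul_smul, ← Finset.sum_smul, add_smul,
    sub_smul]
  have e2 (i : Fin n) : ∑ r : Fin n, h.1 (w.right r) * (if r = i then (1 : ℂ) else 0) =
      h.1 (w.right i) := by simp
  simp only [e2]
  abel

end Cherednik

end DegenerateDAHA

/-! ### Generation by simple reflections and rotations -/

namespace DegenerateDAHA

variable {n : ℕ} [NeZero n]

theorem strictMono_inv {g : AffWeyl n} (hg : StrictMono (fun q : ℤ => g • q)) :
    StrictMono (fun q : ℤ => g⁻¹ • q) := by
  intro a b hab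
  rw [← hg.lt_iff_lt]
  simpa using hab

theorem exists_smul_succ_lt {g : AffWeyl n} (hg : ¬ StrictMono (fun q : ℤ => g • q)) :
    1 < n ∧ ∃ j : ℤ, g • (j + 1) < g • j := by
  have h : ∃ j : ℤ, g • (j + 1) < g • j := by
    by_contra! h
    refine hg (strictMono_int_of_lt_succ fun j => lt_of_le_of_ne (h j) fun e => ?_)
    have := (smul_inj g).1 e
    omega
  refine ⟨?_, h⟩
  obtain ⟨j, hj⟩ := h
  by_contra hn
  have h1 : n = 1 := by
    have := Nat.pos_of_neZero n
    omega
  have h2 := smul_add_self g j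
  have h3 : (n : ℤ) = 1 := by exact_mod_cast h1
  rw [h3] at h2
  linarith

/-- Affine permutations are products of simple reflections and of an increasing one. -/
theorem affWeyl_induction {P : AffWeyl n → Prop}
    (h0 : ∀ w : AffWeyl n, StrictMono (fun q : ℤ => w • q) → P w)
    (hs : ∀ (j : ℤ) (w : AffWeyl n), 1 < n → P w → P (refl j (j + 1) * w)) (w : AffWeyl n) :
    P w := by
  induction hm : energy w using Nat.strong_induction_on generalizing w with
  | _ m ih =>
    by_cases hw : StrictMono (fun q : ℤ => w⁻¹ • q)
    · exact h0 w (by simpa using strictMono_inv hw)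
    obtain ⟨hn, j, hj⟩ := exists_smul_succ_lt hw
    -- A descent of `w⁻¹` at `j` is an inversion of `w`, so left multiplication by the simple
    -- reflection lowers the energy.
    have e : w * refl (w⁻¹ • (j + 1)) (w⁻¹ • j) = refl j (j + 1) * w := by
      rw [mul_refl, smul_inv_smul, smul_inv_smul, refl_comm]
    have h1 : energy (refl j (j + 1) * w) < m := by
      rw [← hm, ← e]
      exact energy_mul_refl_lt_of_lt w hj (by simp)
    have := hs j _ hn (ih _ h1 _ rfl)
    rwa [← mul_assoc, refl_mul_self, one_mul] at this

theorem piElt_smul (q : ℤ) : piElt n • q = q + 1 := by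
  obtain ⟨m, rfl⟩ := Nat.exists_eq_succ_of_ne_zero (NeZero.ne n)
  have hq := res_add_mul_ediv (n := m + 1) q
  rw [smul_def]
  simp only [piElt, translation, finite, SemidirectProduct.mul_right, SemidirectProduct.right_inl,
    SemidirectProduct.right_inr, one_mul, SemidirectProduct.mul_left, SemidirectProduct.left_inl,
    SemidirectProduct.left_inr, map_one, mul_one, toAdd_ofAdd, finRotate_apply]
  by_cases h : (res q : Fin (m + 1)) = Fin.last m
  · rw [h] at hq ⊢
    rw [Fin.last_add_one]
    simp only [Fin.val_zero, if_true, Fin.val_last] at hq ⊢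
    push_cast at hq ⊢
    linarith
  · have h1 : ((res q + 1 : Fin (m + 1)) : ℕ) = (res q : Fin (m + 1)) + 1 :=
      Fin.val_add_one_of_lt (Fin.lt_last_iff_ne_last.2 h)
    rw [h1]
    simp only [Nat.succ_ne_zero, if_false]
    push_cast at hq ⊢
    linarith

theorem piElt_zpow_smul (k q : ℤ) : piElt n ^ k • q = q + k := by
  induction k using Int.induction_on generalizing q with
  | zero => simp
  | succ i ih => rw [zpow_add_one, mul_smul, ih, piElt_smul]; ring
  | pred i ih =>
    have : (piElt n)⁻¹ • q = q - 1 := by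
      rw [inv_smul_eq_iff, piElt_smul, sub_add_cancel]
    rw [zpow_sub_one, mul_smul, ih, this]
    ring

/-- An increasing bijection of `ℤ` sends neighbours to neighbours, so it is a shift, and `piElt n`
is the shift by one. -/
theorem exists_eq_piElt_zpow {g : AffWeyl n} (hg : StrictMono (fun q : ℤ => g • q)) :
    ∃ k : ℤ, g = piElt n ^ k := by
  have hs : ∀ q : ℤ, g • (q + 1) = g • q + 1 := by
    intro q
    apply le_antisymm
    · have h1 : q < g⁻¹ • (g • q + 1) := by
        rw [← hg.lt_iff_lt]
        simp
      have h2 := hg.monotone (Int.add_one_le_iff.2 h1)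
      simpa using h2
    · exact Int.add_one_le_iff.2 (hg (lt_add_one q))
  refine ⟨g • 0, ext_smul fun q => ?_⟩
  rw [piElt_zpow_smul]
  induction q using Int.induction_on with
  | zero => simp
  | succ i ih => rw [hs, ih]; ring
  | pred i ih =>
    have := hs (-(i : ℤ) - 1)
    rw [sub_add_cancel, ih] at this
    linarith

theorem strictMono_piElt : StrictMono (fun q : ℤ => piElt n • q) := by
  intro a b h
  simpa [piElt_smul] using h

theorem AffRoot.IsSimple.exists_refl {α : AffRoot n} (hα : α.IsSimple) :
    1 < n ∧ ∃ j : ℤ, α.reflection = refl j (j + 1) ∧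
      ∀ h : Cartan n, α.pairing h = h.1 (res j) - h.1 (res (j + 1)) := by
  have key (b : ℤ) (h1 : (res b : Fin n) = α.j) (h2 : b / n = α.k) :
      α.reflection = refl (α.i : ℤ) b ∧
      ∀ h : Cartan n, α.pairing h = h.1 (res (α.i : ℤ)) - h.1 (res b) := by
    constructor
    · rw [AffRoot.reflection, refl, h1, h2, res_fin, fin_ediv, sub_zero]
    · intro h
      rw [res_fin, h1, AffRoot.pairing]
  refine ⟨?_, (α.i : ℤ), ?_⟩
  · have := α.i.isLt
    have := α.j.isLt
    have := Fin.val_ne_of_ne α.ne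
    omega
  · have e : (α.i : ℤ) + 1 = (α.j : ℤ) + n * α.k := by
      rcases hα with ⟨h1, h2⟩ | ⟨h1, h2, h3⟩ <;> rw [h1]
      · rw [h2]
        push_cast
        ring
      · have : ((α.i : ℕ) : ℤ) + 1 = n := by exact_mod_cast h2
        rw [h3, this]
        simp
    rw [e]
    exact key _ (res_fin_add _ _) (ediv_fin_add _ _)

/-- Modulo simultaneous shifts by `n`, the pairs `(j, j + 1)` are the simple roots; the pair
crossing a multiple of `n` gives `α_0`. -/
theorem exists_isSimple (hn : 1 < n) (j : ℤ) :
    ∃ α : AffRoot n, α.IsSimple ∧ α.reflection = refl j (j + 1) ∧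
      ∀ h : Cartan n, α.pairing h = h.1 (res j) - h.1 (res (j + 1)) := by
  have hne := res_ne_succ hn j
  have hlt := (res j : Fin n).isLt
  have h1 := coe_res (n := n) j
  have h2 := coe_res (n := n) (j + 1)
  have hd := res_add_mul_ediv (n := n) j
  have hd' := res_add_mul_ediv (n := n) (j + 1)
  refine ⟨⟨res j, res (j + 1), hne, (j + 1) / n - j / n⟩, ?_, rfl, fun h => rfl⟩
  unfold AffRoot.IsSimple
  rcases Nat.lt_or_ge ((res j : Fin n) + 1) n with h | h
  · left
    have e : j + 1 = ((⟨(res j : Fin n) + 1, h⟩ : Fin n) : ℤ) + n * (j / n) := by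
      push_cast
      linarith
    refine ⟨?_, ?_⟩
    · change (j + 1) / (n : ℤ) - j / n = 0
      conv_lhs => rw [e]
      rw [ediv_fin_add, sub_self]
    · change ((res (j + 1) : Fin n) : ℕ) = _
      conv_lhs => rw [e]
      rw [res_fin_add]
  · right
    have e : j + 1 = (((0 : Fin n) : ℕ) : ℤ) + n * (j / n + 1) := by
      have : ((res j : Fin n) : ℤ) + 1 = n := by
        have : (res j : Fin n) + 1 = n := le_antisymm hlt h
        exact_mod_cast this
      rw [Fin.val_zero]
      push_cast
      linarith
    refine ⟨?_, le_antisymm hlt h, ?_⟩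
    · change (j + 1) / (n : ℤ) - j / n = 1
      conv_lhs => rw [e]
      rw [ediv_fin_add, add_sub_cancel_left]
    · change ((res (j + 1) : Fin n) : ℕ) = _
      conv_lhs => rw [e]
      rw [res_fin_add, Fin.val_zero]

end DegenerateDAHA

/-! ### Relations in the algebra and the action on translates of a weight vector -/

namespace DDAHA

open DegenerateDAHA

variable {n : ℕ}

theorem ofGroup_one : (ofGroup 1 : DDAHA n) = 1 :=
  (RingQuot.mkAlgHom_rel ℂ Rel.group_one).trans (map_one _)

theorem ofGroup_mul (g g' : AffWeyl n) : ofGroup (g * g') = ofGroup g * ofGroup g' :=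
  (RingQuot.mkAlgHom_rel ℂ (Rel.group_mul g g')).trans (map_mul _ _ _)

theorem ofCartan_add (h h' : Cartan n) : ofCartan (h + h') = ofCartan h + ofCartan h' :=
  (RingQuot.mkAlgHom_rel ℂ (Rel.cartan_add h h')).trans (map_add _ _ _)

theorem ofCartan_smul (a : ℂ) (h : Cartan n) : ofCartan (a • h) = a • ofCartan h :=
  (RingQuot.mkAlgHom_rel ℂ (Rel.cartan_smul a h)).trans (map_smul _ _ _)

theorem ofCartan_comm (h h' : Cartan n) :
    ofCartan h * ofCartan h' = ofCartan h' * ofCartan h := by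
  have := RingQuot.mkAlgHom_rel ℂ (Rel.cartan_comm h h')
  rw [map_mul, map_mul] at this
  exact this

theorem ofGroup_pi_mul (h : Cartan n) :
    ofGroup (piElt n) * ofCartan h = ofCartan (act (piElt n) h) * ofGroup (piElt n) := by
  have := RingQuot.mkAlgHom_rel ℂ (Rel.rotation h)
  rw [map_mul, map_mul] at this
  exact this

theorem ofGroup_reflection_mul (α : AffRoot n) (hα : α.IsSimple) (h : Cartan n) :
    ofGroup α.reflection * ofCartan h - ofCartan (act α.reflection h) * ofGroup α.reflection =
      algebraMap ℂ _ (-(α.pairing h)) := by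
  have := RingQuot.mkAlgHom_rel ℂ (Rel.simple α hα h)
  rw [map_sub, map_mul, map_mul, AlgHom.commutes] at this
  exact this

theorem induction_gen {P : DDAHA n → Prop} (hg : ∀ g, P (ofGroup g)) (hh : ∀ h, P (ofCartan h))
    (hc : ∀ a : ℂ, P (algebraMap ℂ _ a)) (ha : ∀ x y, P x → P y → P (x + y))
    (hm : ∀ x y, P x → P y → P (x * y)) (x : DDAHA n) : P x := by
  obtain ⟨y, rfl⟩ := RingQuot.mkAlgHom_surjective ℂ (Rel n) x
  induction y using FreeAlgebra.induction with
  | grade0 r => rw [AlgHom.commutes]; exact hc r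
  | grade1 x => rcases x with g | h
                · exact hg g
                · exact hh h
  | mul a b h1 h2 => rw [map_mul]; exact hm _ _ h1 h2
  | add a b h1 h2 => rw [map_add]; exact ha _ _ h1 h2

theorem smul_smul_comm {M : Type*} [AddCommGroup M] [Module (DDAHA n) M] [Module ℂ M]
    [IsScalarTower ℂ (DDAHA n) M] (x : DDAHA n) (a : ℂ) (v : M) : x • a • v = a • x • v := by
  rw [← algebraMap_smul (DDAHA n) a v, ← algebraMap_smul (DDAHA n) a (x • v),
    ← mul_smul, ← mul_smul, Algebra.commutes]

/-- The action of an element of the algebra, as a linear map over the complex numbers. -/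
def smulHom {M : Type*} [AddCommGroup M] [Module (DDAHA n) M] [Module ℂ M]
    [IsScalarTower ℂ (DDAHA n) M] (x : DDAHA n) : M →ₗ[ℂ] M where
  toFun v := x • v
  map_add' := smul_add x
  map_smul' := smul_smul_comm x

variable [NeZero n]

theorem ofGroup_refl_mul (hn : 1 < n) (j : ℤ) (h : Cartan n) :
    ofGroup (refl j (j + 1)) * ofCartan h =
      ofCartan (act (refl j (j + 1)) h) * ofGroup (refl j (j + 1)) -
        algebraMap ℂ _ (h.1 (res j) - h.1 (res (j + 1))) := by
  obtain ⟨α, hα, h1, h2⟩ := exists_isSimple hn j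
  have := ofGroup_reflection_mul α hα h
  rw [h1, h2, map_neg] at this
  rw [sub_eq_iff_eq_add.1 this]
  abel

theorem ofGroup_mul_of_strictMono {g : AffWeyl n} (hg : StrictMono (fun q : ℤ => g • q))
    (h : Cartan n) : ofGroup g * ofCartan h = ofCartan (act g h) * ofGroup g := by
  let S : Subgroup (AffWeyl n) :=
    { carrier := {g | ∀ h : Cartan n, ofGroup g * ofCartan h = ofCartan (act g h) * ofGroup g}
      one_mem' := fun h => by rw [ofGroup_one, act_one, one_mul, mul_one]
      mul_mem' := fun {g g'} hg hg' h => by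
        rw [ofGroup_mul, mul_assoc, hg' h, ← mul_assoc, hg, act_mul, mul_assoc]
      inv_mem' := fun {g} hg h => by
        have h1 := hg (act g⁻¹ h)
        rw [act_act_inv] at h1
        have e1 : ofGroup g⁻¹ * ofGroup g = (1 : DDAHA n) := by
          rw [← ofGroup_mul, inv_mul_cancel, ofGroup_one]
        have e2 : ofGroup g * ofGroup g⁻¹ = (1 : DDAHA n) := by
          rw [← ofGroup_mul, mul_inv_cancel, ofGroup_one]
        calc ofGroup g⁻¹ * ofCartan h
            = ofGroup g⁻¹ * (ofCartan h * ofGroup g) * ofGroup g⁻¹ := by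
              rw [mul_assoc, mul_assoc, e2, mul_one]
          _ = _ := by rw [← h1, ← mul_assoc, e1, one_mul] }
  obtain ⟨k, rfl⟩ := exists_eq_piElt_zpow hg
  exact S.zpow_mem (show piElt n ∈ S from fun h => ofGroup_pi_mul h) k h

section Module

variable {M : Type*} [AddCommGroup M] [Module (DDAHA n) M] [Module ℂ M]
  [IsScalarTower ℂ (DDAHA n) M]

/-- The action of the Cartan subalgebra on the translates of a weight vector. -/
theorem ofCartan_smul_ofGroup_smul {ζ : Cartan n →ₗ[ℂ] ℂ} {v : M} (hv : v ∈ weightSpace M ζ)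
    (h : Cartan n) (w : AffWeyl n) :
    (ofCartan h : DDAHA n) • (ofGroup w : DDAHA n) • v =
      cherednik (fun w => (ofGroup w : DDAHA n) • v) ζ h w := by
  induction w using affWeyl_induction generalizing h with
  | h0 w hw =>
    rw [cherednik_of_strictMono _ _ hw]
    have := ofGroup_mul_of_strictMono hw (act w⁻¹ h)
    rw [act_act_inv] at this
    rw [← mul_smul, ← this, mul_smul, hv, smul_smul_comm]
  | hs j w hn ih =>
    -- With `h` written as the image of another element, the relation moves it past the reflection
    -- and its scalar term cancels the one in `cherednik_refl_mul`.
    obtain ⟨h, rfl⟩ : ∃ h' : Cartan n, h = act (refl j (j + 1)) h' := ⟨_, (act_act_inv _ h).symm⟩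
    have e := ofGroup_refl_mul hn j h
    rw [cherednik_refl_mul _ _ hn]
    simp only [ofGroup_mul, mul_smul]
    have e2 := map_cherednik (fun w => (ofGroup w : DDAHA n) • v) ζ
      (smulHom (M := M) (ofGroup (refl j (j + 1) : AffWeyl n))) h w
    simp only [smulHom, LinearMap.coe_mk, AddHom.coe_mk] at e2
    rw [← e2, ← ih, ← mul_smul, ← mul_smul (ofGroup (refl j (j + 1))), e, sub_smul,
      algebraMap_smul, sub_add_cancel]

end Module

end DDAHA

namespace DegenerateDAHA

variable {n : ℕ}

/-! ### The model of the induced module -/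

/-- The vector of the free vector space on `W̃ / W` given by a coset. -/
def cosetVec (W : Subgroup (AffWeyl n)) (w : AffWeyl n) : (AffWeyl n ⧸ W) →₀ ℂ :=
  Finsupp.single (w : AffWeyl n ⧸ W) 1

theorem end_ext {W : Subgroup (AffWeyl n)} {X : Type*} [AddCommGroup X] [Module ℂ X]
    {f f' : ((AffWeyl n ⧸ W) →₀ ℂ) →ₗ[ℂ] X}
    (h : ∀ w, f (cosetVec W w) = f' (cosetVec W w)) : f = f' := by
  refine Finsupp.lhom_ext' fun C => LinearMap.ext_ring ?_
  obtain ⟨w, rfl⟩ := QuotientGroup.mk_surjective C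
  exact h w

variable [NeZero n]

/-- The weight `ζ` takes the value `-1` on the simple coroots `ε_j^∨ - ε_{j+1}^∨`, `j ∈ Y`. -/
def IsSteinberg (Y : Set ℤ) (ζ : Cartan n →ₗ[ℂ] ℂ) : Prop :=
  ∀ j ∈ Y, 1 < n ∧
    ∀ h : Cartan n, ζ (act (refl j (j + 1)) h) = ζ h + (h.1 (res j) - h.1 (res (j + 1)))

/-- The subgroup generated by the reflections exchanging `j` and `j + 1`, for `j ∈ Y`. -/
def parabolic (n : ℕ) [NeZero n] (Y : Set ℤ) : Subgroup (AffWeyl n) :=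
  Subgroup.closure {s | ∃ j ∈ Y, s = refl j (j + 1)}

section Model

variable {Y : Set ℤ} {ζ : Cartan n →ₗ[ℂ] ℂ}

theorem cosetVec_mul (w : AffWeyl n) {g : AffWeyl n} (hg : g ∈ parabolic n Y) :
    cosetVec (parabolic n Y) (w * g) = cosetVec (parabolic n Y) w := by
  rw [cosetVec, QuotientGroup.mk_mul_of_mem _ hg, cosetVec]

theorem cherednik_cosetVec_mul (hζ : IsSteinberg Y ζ) (h : Cartan n) {g : AffWeyl n}
    (hg : g ∈ parabolic n Y) (w : AffWeyl n) :
    cherednik (cosetVec (parabolic n Y)) ζ h (w * g) =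
      cherednik (cosetVec (parabolic n Y)) ζ h w := by
  induction hg using Subgroup.closure_induction generalizing w with
  | mem g hg =>
    obtain ⟨j, hj, rfl⟩ := hg
    exact cherednik_mul_refl _ _ (hζ j hj).1
      (fun w => cosetVec_mul w (Subgroup.subset_closure ⟨j, hj, rfl⟩)) (hζ j hj).2 h w
  | one => rw [mul_one]
  | mul x y _ _ hx hy => rw [← mul_assoc, hy, hx]
  | inv x _ hx => rw [← hx, inv_mul_cancel_right]

/-- The action of the Cartan subalgebra on the model. -/
def cartanOp (Y : Set ℤ) (ζ : Cartan n →ₗ[ℂ] ℂ) (h : Cartan n) :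
    Module.End ℂ ((AffWeyl n ⧸ parabolic n Y) →₀ ℂ) :=
  Finsupp.linearCombination ℂ
    fun C : AffWeyl n ⧸ parabolic n Y => cherednik (cosetVec (parabolic n Y)) ζ h C.out

/-- The representative chosen in `cartanOp` is irrelevant, by invariance of the formula on cosets.
-/
theorem cartanOp_cosetVec (hζ : IsSteinberg Y ζ) (h : Cartan n) (w : AffWeyl n) :
    cartanOp Y ζ h (cosetVec _ w) = cherednik (cosetVec (parabolic n Y)) ζ h w := by
  obtain ⟨g, hg⟩ := QuotientGroup.mk_out_eq_mul (parabolic n Y) w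
  rw [cartanOp, cosetVec, Finsupp.linearCombination_single, one_smul, hg,
    cherednik_cosetVec_mul hζ h g.2]

/-- The action of the extended affine Weyl group on the model. -/
def groupOp (Y : Set ℤ) (g : AffWeyl n) : Module.End ℂ ((AffWeyl n ⧸ parabolic n Y) →₀ ℂ) :=
  Finsupp.lmapDomain ℂ ℂ (fun C => g • C)

theorem groupOp_cosetVec (g w : AffWeyl n) :
    groupOp Y g (cosetVec _ w) = cosetVec (parabolic n Y) (g * w) := by
  rw [groupOp, cosetVec, Finsupp.lmapDomain_apply, Finsupp.mapDomain_single]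
  rfl

theorem groupOp_one : groupOp Y (1 : AffWeyl n) = 1 :=
  end_ext fun w => by rw [groupOp_cosetVec, one_mul, Module.End.one_apply]

theorem groupOp_mul (g g' : AffWeyl n) : groupOp Y (g * g') = groupOp Y g * groupOp Y g' :=
  end_ext fun w => by simp only [groupOp_cosetVec, Module.End.mul_apply, mul_assoc]

theorem groupOp_cherednik (g : AffWeyl n) (h : Cartan n) (w : AffWeyl n) :
    groupOp Y g (cherednik (cosetVec _) ζ h w) =
      cherednik (fun w => cosetVec (parabolic n Y) (g * w)) ζ h w := by
  rw [map_cherednik]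
  simp only [groupOp_cosetVec]

theorem groupOp_refl_mul_cartanOp (hζ : IsSteinberg Y ζ) (hn : 1 < n) (j : ℤ) (h : Cartan n) :
    cartanOp Y ζ (act (refl j (j + 1)) h) * groupOp Y (refl j (j + 1)) =
      groupOp Y (refl j (j + 1)) * cartanOp Y ζ h +
        (h.1 (res j) - h.1 (res (j + 1))) • 1 := by
  refine end_ext fun w => ?_
  rw [LinearMap.add_apply, Module.End.mul_apply, Module.End.mul_apply, groupOp_cosetVec,
    cartanOp_cosetVec hζ, cartanOp_cosetVec hζ, groupOp_cherednik, cherednik_refl_mul _ _ hn,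
    LinearMap.smul_apply, Module.End.one_apply]

theorem groupOp_mul_cartanOp_of_strictMono (hζ : IsSteinberg Y ζ) {g : AffWeyl n}
    (hg : StrictMono (fun q : ℤ => g • q)) (h : Cartan n) :
    groupOp Y g * cartanOp Y ζ h = cartanOp Y ζ (act g h) * groupOp Y g := by
  refine end_ext fun w => ?_
  rw [Module.End.mul_apply, Module.End.mul_apply, groupOp_cosetVec,
    cartanOp_cosetVec hζ, cartanOp_cosetVec hζ, groupOp_cherednik,
    cherednik_mul_of_strictMono _ _ hg]

theorem cartanOp_add (h h' : Cartan n) : cartanOp Y ζ (h + h') = cartanOp Y ζ h + cartanOp Y ζ h' :=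
  Finsupp.lhom_ext fun C a => by
    simp [cartanOp, cherednik_add]

theorem cartanOp_smul (a : ℂ) (h : Cartan n) : cartanOp Y ζ (a • h) = a • cartanOp Y ζ h :=
  Finsupp.lhom_ext fun C c => by
    simp only [cartanOp, cherednik_smul, Finsupp.linearCombination_single, LinearMap.smul_apply]
    rw [smul_comm]

theorem act_refl_succ (hn : 1 < n) (j : ℤ) (h : Cartan n) :
    act (refl j (j + 1)) h = h - (h.1 (res j) - h.1 (res (j + 1))) •
      (epsCheck j - epsCheck (j + 1)) := by
  have hne := res_ne_succ hn j
  refine Prod.ext ?_ ?_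
  · funext i
    obtain ⟨q, rfl⟩ : ∃ q : ℤ, i = res q := ⟨i, (res_fin i).symm⟩
    have h0 : (res ((refl j (j + 1) : AffWeyl n) • q) : Fin n) =
        (refl j (j + 1) : AffWeyl n).right (res q) := res_smul _ _
    have : (act (refl j (j + 1)) h).1 (res q) =
        h.1 (res ((refl j (j + 1) : AffWeyl n) • q)) := by
      rw [h0, ← act_inv_fst, refl_inv]
    rw [this]
    simp only [epsCheck, Prod.fst_sub, Prod.smul_fst, Pi.sub_apply, Pi.smul_apply, smul_eq_mul,
      Pi.single_apply]
    by_cases h1 : (res q : Fin n) = res j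
    · obtain ⟨k, rfl⟩ := res_eq_iff.1 h1
      rw [refl_smul_left_add hne, h1, res_add_mul]
      simp [hne]
    by_cases h2 : (res q : Fin n) = res (j + 1)
    · obtain ⟨k, rfl⟩ := res_eq_iff.1 h2
      rw [refl_smul_right_add hne, h2, res_add_mul]
      simp [hne.symm]
    · rw [refl_smul_of_ne h1 h2]
      simp [h1, h2]
  · have e1 (x : Fin n) : ((refl j (j + 1) : AffWeyl n).left x) = Multiplicative.ofAdd
        (-(((j + 1) / n - j / n) * ((Pi.single (res j) 1 - Pi.single (res (j + 1)) 1 :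
          Fin n → ℤ) x))) := by
      simp [refl, translation, finite]
    have e2 : (refl j (j + 1) : AffWeyl n).right = Equiv.swap (res j) (res (j + 1)) := by
      simp [refl, translation, finite]
    simp only [act, e1, e2, toAdd_ofAdd, Equiv.swap_inv, Pi.sub_apply]
    rw [Finset.sum_eq_add (res j) (res (j + 1)) hne]
    · simp only [Pi.single_eq_same, Pi.single_eq_of_ne hne, Pi.single_eq_of_ne hne.symm,
        Equiv.swap_apply_left, Equiv.swap_apply_right, epsCheck, Prod.snd_sub, Prod.smul_snd,
        smul_eq_mul]
      push_cast
      ring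
    · rintro i - ⟨h1, h2⟩
      simp [Pi.single_eq_of_ne h1, Pi.single_eq_of_ne h2]
    · simp
    · simp

/-- In terms of commutators this says `[D, D'] S = S [C, C']`. Moving `S` to the left leaves `a (C'
- D') - a' (C - D)`, which is `a a' A - a' a A = 0`. -/
theorem commutator_intertwine {R : Type*} [Ring R] [Algebra ℂ R] {S C C' D D' A : R} {a a' : ℂ}
    (h1 : D * S = S * C + a • 1) (h1' : D' * S = S * C' + a' • 1)
    (h2 : D + a • A = C) (h2' : D' + a' • A = C') :
    D * D' * S + S * (C' * C) = D' * D * S + S * (C * C') := by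
  rw [mul_assoc D, h1', mul_assoc D', h1, mul_add, mul_add, ← mul_assoc D, ← mul_assoc D', h1, h1',
    mul_smul_comm, mul_smul_comm, mul_one, mul_one, add_mul, add_mul, smul_one_mul, smul_one_mul,
    ← h2, ← h2', smul_add, smul_add, smul_comm a' a, mul_assoc, mul_assoc]
  abel

/-- Commutativity is the one relation not visible from the formula. It is clear on increasing
permutations, where all operators are diagonal, and `commutator_intertwine` carries it across a
simple reflection. -/
theorem cartanOp_comm (hζ : IsSteinberg Y ζ) (h h' : Cartan n) :
    cartanOp Y ζ h * cartanOp Y ζ h' = cartanOp Y ζ h' * cartanOp Y ζ h := by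
  refine end_ext fun w => ?_
  induction w using affWeyl_induction generalizing h h' with
  | h0 w hw =>
    simp only [Module.End.mul_apply, cartanOp_cosetVec hζ, cherednik_of_strictMono _ _ hw,
      map_smul]
    rw [smul_comm]
  | hs j w hn ih =>
    obtain ⟨h, rfl⟩ : ∃ h₁ : Cartan n, h = act (refl j (j + 1)) h₁ :=
      ⟨_, (act_act_inv (refl j (j + 1)) h).symm⟩
    obtain ⟨h', rfl⟩ : ∃ h₁ : Cartan n, h' = act (refl j (j + 1)) h₁ :=
      ⟨_, (act_act_inv (refl j (j + 1)) h').symm⟩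
    have e1 (h : Cartan n) := groupOp_refl_mul_cartanOp (Y := Y) hζ hn j h
    have e2 (h : Cartan n) : cartanOp Y ζ (act (refl j (j + 1)) h) +
        (h.1 (res j) - h.1 (res (j + 1))) • cartanOp Y ζ (epsCheck j - epsCheck (j + 1)) =
        cartanOp Y ζ h := by
      rw [act_refl_succ hn, ← cartanOp_smul, ← cartanOp_add, sub_add_cancel]
    have := commutator_intertwine (S := groupOp Y (refl j (j + 1))) (C := cartanOp Y ζ h)
      (C' := cartanOp Y ζ h') (D := cartanOp Y ζ (act (refl j (j + 1)) h))
      (D' := cartanOp Y ζ (act (refl j (j + 1)) h'))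
      (A := cartanOp Y ζ (epsCheck j - epsCheck (j + 1))) (e1 h) (e1 h') (e2 h) (e2 h')
    have h3 := LinearMap.congr_fun this (cosetVec _ w)
    simp only [LinearMap.add_apply, Module.End.mul_apply (_ * _), Module.End.mul_apply (groupOp _ _),
      ih h h', groupOp_cosetVec] at h3
    exact add_right_cancel h3

theorem sub_add_smul_one {R : Type*} [Ring R] [Algebra ℂ R] (x : R) (a : ℂ) :
    x - (x + a • 1) = (-a) • 1 := by
  rw [sub_add_cancel_left, neg_smul]

/-- The action of the algebra on the model. -/
def modelHom (hζ : IsSteinberg Y ζ) :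
    DDAHA n →ₐ[ℂ] Module.End ℂ ((AffWeyl n ⧸ parabolic n Y) →₀ ℂ) :=
  RingQuot.liftAlgHom ℂ ⟨FreeAlgebra.lift ℂ (Sum.elim (groupOp Y) (cartanOp Y ζ)), by
    intro x y hxy
    induction hxy with
    | group_one => simp [groupOp_one]
    | group_mul g g' => simp [groupOp_mul]
    | cartan_add h h' => simp [cartanOp_add]
    | cartan_smul a h => simp [cartanOp_smul]
    | cartan_comm h h' => simp [cartanOp_comm hζ h h']
    | simple α hα h =>
      obtain ⟨hn, j, h1, h2⟩ := hα.exists_refl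
      have := groupOp_refl_mul_cartanOp (Y := Y) hζ hn j h
      rw [AlgHom.commutes, map_sub, map_mul, map_mul, FreeAlgebra.lift_ι_apply,
        FreeAlgebra.lift_ι_apply, FreeAlgebra.lift_ι_apply, Sum.elim_inl, Sum.elim_inr,
        Sum.elim_inr, h1, this, h2, Algebra.algebraMap_eq_smul_one]
      exact sub_add_smul_one (groupOp Y (refl j (j + 1)) * cartanOp Y ζ h) _
    | rotation h =>
      simpa using groupOp_mul_cartanOp_of_strictMono hζ strictMono_piElt h⟩

theorem modelHom_ofGroup (hζ : IsSteinberg Y ζ) (g : AffWeyl n) :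
    modelHom hζ (DDAHA.ofGroup g) = groupOp Y g := by
  refine (RingQuot.liftAlgHom_mkAlgHom_apply ℂ _ _ _).trans ?_
  simp

theorem modelHom_ofCartan (hζ : IsSteinberg Y ζ) (h : Cartan n) :
    modelHom hζ (DDAHA.ofCartan h) = cartanOp Y ζ h := by
  refine (RingQuot.liftAlgHom_mkAlgHom_apply ℂ _ _ _).trans ?_
  simp

end Model
end DegenerateDAHA

namespace DegenerateDAHA

open DDAHA

variable {n : ℕ} [NeZero n]

/-! ### Induced modules -/

theorem finsum_mem_of_forall_mem {X : Type*} [AddCommGroup X] [Module ℂ X] (S : Submodule ℂ X)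
    {ι : Type*} {f : ι → X} (hf : ∀ i, f i ∈ S) : ∑ᶠ i, f i ∈ S :=
  finsum_induction (· ∈ S) S.zero_mem (fun _ _ => S.add_mem) hf

theorem cherednik_mem {X : Type*} [AddCommGroup X] [Module ℂ X] (S : Submodule ℂ X)
    {b : AffWeyl n → X} (ζ : Cartan n →ₗ[ℂ] ℂ) (h : Cartan n) {w : AffWeyl n} (hw : b w ∈ S)
    (hr : ∀ r c, invSign w r c ≠ 0 → b (w * refl r c) ∈ S) : cherednik b ζ h w ∈ S := by
  refine S.add_mem (S.smul_mem _ hw) (S.sum_mem fun r _ => S.smul_mem _ ?_)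
  refine finsum_mem_of_forall_mem S fun c => ?_
  by_cases h0 : invSign w r c = 0
  · simp [h0]
  · exact S.smul_mem _ (hr _ _ h0)

/-- The module `M` is induced from the one-dimensional module spanned by `e`, of weight `ζ` and
trivial under the reflections exchanging `j` and `j + 1`, for `j ∈ Y`. -/
structure IsInduced (Y : Set ℤ) (ζ : Cartan n →ₗ[ℂ] ℂ) {M : Type*} [AddCommGroup M]
    [Module (DDAHA n) M] [Module ℂ M] [IsScalarTower ℂ (DDAHA n) M] (e : M) : Prop where
  mem_weightSpace : e ∈ weightSpace M ζ
  refl_smul : ∀ j ∈ Y, (ofGroup (refl j (j + 1)) : DDAHA n) • e = e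
  span_eq : Submodule.span (DDAHA n) {e} = ⊤
  exists_coord : ∃ θ : M →ₗ[ℂ] ((AffWeyl n ⧸ parabolic n Y) →₀ ℂ),
    ∀ w, θ ((ofGroup w : DDAHA n) • e) = cosetVec _ w
  exists_lift : ∀ v ∈ weightSpace M ζ,
    (∀ j ∈ Y, (ofGroup (refl j (j + 1)) : DDAHA n) • v = v) → ∃ E : M →ₗ[DDAHA n] M, E e = v

namespace IsInduced

variable {Y : Set ℤ} {ζ : Cartan n →ₗ[ℂ] ℂ} {M : Type*} [AddCommGroup M]
    [Module (DDAHA n) M] [Module ℂ M] [IsScalarTower ℂ (DDAHA n) M] {e : M}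

theorem ofGroup_mem_smul (hM : IsInduced Y ζ e) {g : AffWeyl n} (hg : g ∈ parabolic n Y) :
    (ofGroup g : DDAHA n) • e = e := by
  induction hg using Subgroup.closure_induction with
  | mem g hg =>
    obtain ⟨j, hj, rfl⟩ := hg
    exact hM.refl_smul j hj
  | one => rw [ofGroup_one, one_smul]
  | mul x y _ _ hx hy => rw [ofGroup_mul, mul_smul, hy, hx]
  | inv x _ hx =>
    conv_lhs => rw [← hx]
    rw [← mul_smul, ← ofGroup_mul, inv_mul_cancel, ofGroup_one, one_smul]

/-- The span of the translates of `e` is stable under the generators of the algebra: the group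
permutes the translates, and the Cartan subalgebra acts by the inversion formula. -/
theorem cspan_eq_top (hM : IsInduced Y ζ e) :
    Submodule.span ℂ (Set.range fun w : AffWeyl n => (ofGroup w : DDAHA n) • e) = ⊤ := by
  set S := Submodule.span ℂ (Set.range fun w : AffWeyl n => (ofGroup w : DDAHA n) • e) with hS
  have hw (w : AffWeyl n) : (ofGroup w : DDAHA n) • e ∈ S := Submodule.subset_span ⟨w, rfl⟩
  have key (x : DDAHA n) : ∀ v ∈ S, x • v ∈ S := by
    induction x using induction_gen with
    | hg g =>
      intro v hv
      induction hv using Submodule.span_induction with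
      | mem x hx =>
        obtain ⟨w, rfl⟩ := hx
        simp only [← mul_smul, ← ofGroup_mul]
        exact hw _
      | zero => rw [smul_zero]; exact S.zero_mem
      | add x y _ _ h1 h2 => rw [smul_add]; exact S.add_mem h1 h2
      | smul a x _ h1 => rw [smul_smul_comm]; exact S.smul_mem _ h1
    | hh h =>
      intro v hv
      induction hv using Submodule.span_induction with
      | mem x hx =>
        obtain ⟨w, rfl⟩ := hx
        simp only [ofCartan_smul_ofGroup_smul hM.mem_weightSpace]
        exact cherednik_mem S _ _ (hw _) fun _ _ _ => hw _
      | zero => rw [smul_zero]; exact S.zero_mem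
      | add x y _ _ h1 h2 => rw [smul_add]; exact S.add_mem h1 h2
      | smul a x _ h1 => rw [smul_smul_comm]; exact S.smul_mem _ h1
    | hc a =>
      intro v hv
      rw [algebraMap_smul]
      exact S.smul_mem _ hv
    | ha x y hx hy =>
      intro v hv
      rw [add_smul]
      exact S.add_mem (hx v hv) (hy v hv)
    | hm x y hx hy =>
      intro v hv
      rw [mul_smul]
      exact hx _ (hy v hv)
  refine eq_top_iff.2 fun v _ => ?_
  have hv : v ∈ Submodule.span (DDAHA n) {e} := hM.span_eq ▸ Submodule.mem_top
  obtain ⟨x, rfl⟩ := Submodule.mem_span_singleton.1 hv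
  refine key x e ?_
  have := hw 1
  rwa [ofGroup_one, one_smul] at this

/-- Every vector is determined by its coordinates. -/
theorem eq_sum_coord (hM : IsInduced Y ζ e)
    {θ : M →ₗ[ℂ] ((AffWeyl n ⧸ parabolic n Y) →₀ ℂ)}
    (hθ : ∀ w, θ ((ofGroup w : DDAHA n) • e) = cosetVec _ w) (v : M)
    {rep : (AffWeyl n ⧸ parabolic n Y) → AffWeyl n}
    (hrep : ∀ C, (rep C : AffWeyl n ⧸ parabolic n Y) = C) :
    v = (θ v).sum fun C a => a • (ofGroup (rep C) : DDAHA n) • e := by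
  have hv : v ∈ Submodule.span ℂ (Set.range fun w : AffWeyl n => (ofGroup w : DDAHA n) • e) :=
    hM.cspan_eq_top ▸ Submodule.mem_top
  change v = Finsupp.linearCombination ℂ (fun C => (ofGroup (rep C) : DDAHA n) • e) (θ v)
  induction hv using Submodule.span_induction with
  | mem x hx =>
    obtain ⟨w, rfl⟩ := hx
    simp only [hθ, cosetVec, Finsupp.linearCombination_single, one_smul]
    have h1 := hrep (w : AffWeyl n ⧸ parabolic n Y)
    rw [eq_comm, QuotientGroup.eq] at h1
    rw [show rep (w : AffWeyl n ⧸ parabolic n Y) = w * (w⁻¹ * rep (w : AffWeyl n ⧸ parabolic n Y))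
      by rw [mul_inv_cancel_left], ofGroup_mul, mul_smul, hM.ofGroup_mem_smul h1]
  | zero => simp
  | add x y _ _ h1 h2 => rw [map_add, map_add, ← h1, ← h2]
  | smul a x _ h1 => rw [map_smul, map_smul, ← h1]

theorem ne_zero (hM : IsInduced Y ζ e) : e ≠ 0 := by
  obtain ⟨θ, hθ⟩ := hM.exists_coord
  intro h
  have := hθ 1
  rw [h, smul_zero, map_zero, cosetVec, eq_comm, Finsupp.single_eq_zero] at this
  exact one_ne_zero this

end IsInduced

/-- This isolates the diagonal coefficient, once no inversion of `w` leads into the coset `C`. -/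
theorem cherednik_cosetVec_apply {W : Subgroup (AffWeyl n)} (ζ : Cartan n →ₗ[ℂ] ℂ) (h : Cartan n)
    (w : AffWeyl n) (C : AffWeyl n ⧸ W)
    (hC : ∀ r c, invSign w r c ≠ 0 → ((w * refl r c : AffWeyl n) : AffWeyl n ⧸ W) ≠ C) :
    cherednik (cosetVec W) ζ h w C = ζ (act w⁻¹ h) * cosetVec W w C := by
  have h1 (r : ℤ) : invSum (cosetVec W) w r C = 0 := by
    have := map_invSum (cosetVec W) (Finsupp.lapply (R := ℂ) C) w r
    rw [Finsupp.lapply_apply] at this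
    rw [this]
    refine finsum_eq_zero_of_forall_eq_zero fun c => ?_
    by_cases h0 : invSign w r c = 0
    · simp [h0]
    · simp [cosetVec, hC r c h0]
  simp [cherednik, h1]

theorem exists_rep (W : Subgroup (AffWeyl n)) (C : AffWeyl n ⧸ W) :
    ∃ w : AffWeyl n, (w : AffWeyl n ⧸ W) = C ∧
      ∀ w' : AffWeyl n, (w' : AffWeyl n ⧸ W) = C → energy w ≤ energy w' := by
  obtain ⟨w, hw⟩ := QuotientGroup.mk_surjective C
  have hwf := (measure (energy (n := n))).wf
  obtain ⟨m, hm, hmin⟩ := hwf.has_min {w : AffWeyl n | (w : AffWeyl n ⧸ W) = C} ⟨w, hw⟩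
  exact ⟨m, hm, fun w' hw' => not_lt.1 (hmin w' hw')⟩

/-- A weight vector, not all of whose terms lie in a set `S` of cosets stable under the Cartan
subalgebra, has a term outside `S` given by an affine permutation `w`, increasing on `Y`, which
maps `ζ` to the weight of the vector. -/
theorem IsInduced.exists_top_term {Y : Set ℤ} {ζ : Cartan n →ₗ[ℂ] ℂ} {M : Type*} [AddCommGroup M]
    [Module (DDAHA n) M] [Module ℂ M] [IsScalarTower ℂ (DDAHA n) M] {e : M}
    (hM : IsInduced Y ζ e)
    {θ : M →ₗ[ℂ] ((AffWeyl n ⧸ parabolic n Y) →₀ ℂ)}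
    (hθ : ∀ w, θ ((ofGroup w : DDAHA n) • e) = cosetVec _ w)
    {S : Set (AffWeyl n)} (hS : ∀ w ∈ S, ∀ g ∈ parabolic n Y, w * g ∈ S)
    (hS' : ∀ w ∈ S, ∀ r c, invSign w r c ≠ 0 → w * refl r c ∈ S)
    {ζ' : Cartan n →ₗ[ℂ] ℂ} {v : M} (hv : v ∈ weightSpace M ζ')
    {w₀ : AffWeyl n} (hw₀ : θ v w₀ ≠ 0) (hw₀S : w₀ ∉ S) :
    ∃ w : AffWeyl n, w ∉ S ∧ (∀ j ∈ Y, w • j < w • (j + 1)) ∧ ∀ h, ζ (act w⁻¹ h) = ζ' h := by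
  classical
  choose rep hrep hmin using exists_rep (parabolic n Y)
  have hrS (w : AffWeyl n) : rep w ∈ S → w ∈ S := by
    intro h
    have h1 := QuotientGroup.eq.1 (hrep w)
    simpa using hS _ h _ h1
  -- Each coset is represented by an element of least energy. Among the terms outside `S`, one whose
  -- representative has largest energy is taken; minimality in the coset makes it increasing on `Y`.
  set T := (θ v).support.filter fun C => rep C ∉ S with hT
  obtain ⟨C, hCT, hCmax⟩ := T.exists_max_image (fun C => energy (rep C))
    ⟨w₀, by simpa [hT, hw₀] using fun h => hw₀S (hrS _ h)⟩
  rw [hT, Finset.mem_filter, Finsupp.mem_support_iff] at hCT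
  refine ⟨rep C, hCT.2, fun j hj => ?_, fun h => ?_⟩
  · by_contra h
    have hne : rep C • j ≠ rep C • (j + 1) := by
      rw [Ne, smul_inj]
      omega
    have h1 := energy_mul_refl_lt_of_lt (rep C) (lt_add_one j)
      (lt_of_le_of_ne (not_lt.1 h) hne.symm)
    refine absurd (hmin C (rep C * refl j (j + 1)) ?_) (not_le.2 h1)
    have h2 : refl j (j + 1) ∈ parabolic n Y := Subgroup.subset_closure ⟨j, hj, rfl⟩
    rw [QuotientGroup.mk_mul_of_mem _ h2, hrep]
  · have e1 := hM.eq_sum_coord hθ v hrep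
    have e2 : θ ((ofCartan h : DDAHA n) • v) C =
        (θ v).sum fun C' a => a * cherednik (cosetVec (parabolic n Y)) ζ h (rep C') C := by
      conv_lhs => rw [e1]
      rw [Finsupp.sum, Finset.smul_sum, map_sum, Finsupp.finsetSum_apply]
      refine Finset.sum_congr rfl fun C' _ => ?_
      rw [smul_smul_comm, map_smul, ofCartan_smul_ofGroup_smul hM.mem_weightSpace, map_cherednik]
      simp only [hθ]
      rfl
    -- Comparing coefficients of `C` in `h • v`, only the diagonal term survives: a term in `S`
    -- stays in `S`, and a term outside `S` leads to strictly smaller energy than the maximum.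
    rw [hv h, map_smul, Finsupp.smul_apply, smul_eq_mul, Finsupp.sum,
      Finset.sum_eq_single_of_mem C (Finsupp.mem_support_iff.2 hCT.1)] at e2
    · rw [cherednik_cosetVec_apply] at e2
      · rw [cosetVec, hrep, Finsupp.single_eq_same, mul_one, mul_comm] at e2
        exact (mul_left_cancel₀ hCT.1 e2).symm
      · intro r c hrc h1
        exact absurd (hmin C _ h1) (not_le.2 (energy_mul_refl_lt _ hrc))
    · intro C' hC' hne
      rw [cherednik_cosetVec_apply]
      · rw [cosetVec, hrep, Finsupp.single_eq_of_ne hne.symm, mul_zero, mul_zero]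
      · intro r c hrc h1
        by_cases hCS : rep C' ∈ S
        · refine hCT.2 ?_
          have h2 := hS' _ hCS r c hrc
          rw [← hrep C] at h1
          have h3 := hS _ h2 _ (QuotientGroup.eq.1 h1)
          rwa [mul_inv_cancel_left] at h3
        · have h2 := hCmax C' (Finset.mem_filter.2 ⟨hC', hCS⟩)
          have h3 := hmin C _ h1
          have h4 := energy_mul_refl_lt _ hrc
          omega

end DegenerateDAHA

namespace DegenerateDAHA

open DDAHA

/-! ### Periodic sequences of segments -/

/-- The combinatorial data of a periodic sequence of segments: the integers are cut into
consecutive blocks, with `q` and `q + 1` in the same block when `q ∈ Y`; on each block, `u`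
increases by one from its value `1 - G` at the start of the block, where `G` is constant on the
block; blocks with the same value of `G` have weakly decreasing lengths. -/
structure SegmentData (n : ℕ) (κ : ℤ) where
  u : ℤ → ℤ
  G : ℤ → ℤ
  Y : Set ℤ
  pos : 0 < κ
  u_add : ∀ q, u (q + n) = u q - κ
  G_add : ∀ q, G (q + n) = G q + κ
  mono : Monotone G
  G_succ : ∀ q ∈ Y, G (q + 1) = G q
  u_succ : ∀ q ∈ Y, u (q + 1) = u q + 1
  u_start : ∀ q ∉ Y, u (q + 1) = 1 - G (q + 1)
  one_sub_le : ∀ q, 1 - G q ≤ u q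
  mem_of_lt : ∀ q a, q < a → G q = G a → u q = u a → a ∈ Y → q ∈ Y

namespace SegmentData

variable {n : ℕ} {κ : ℤ} (D : SegmentData n κ)

theorem G_add_mul (q k : ℤ) : D.G (q + n * k) = D.G q + κ * k := by
  induction k using Int.induction_on with
  | zero => simp
  | succ i ih =>
    have := D.G_add (q + n * i)
    rw [show q + n * ((i : ℤ) + 1) = q + n * i + n by ring, this, ih]
    ring
  | pred i ih =>
    have := D.G_add (q + n * (-(i : ℤ) - 1))
    rw [show q + n * (-(i : ℤ) - 1) + n = q + n * (-i) by ring, ih] at this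
    linarith

theorem u_add_mul (q k : ℤ) : D.u (q + n * k) = D.u q - κ * k := by
  induction k using Int.induction_on with
  | zero => simp
  | succ i ih =>
    have := D.u_add (q + n * i)
    rw [show q + n * ((i : ℤ) + 1) = q + n * i + n by ring, this, ih]
    ring
  | pred i ih =>
    have := D.u_add (q + n * (-(i : ℤ) - 1))
    rw [show q + n * (-(i : ℤ) - 1) + n = q + n * (-i) by ring, ih] at this
    linarith

theorem lt_of_G_lt {a b : ℤ} (h : D.G a < D.G b) : a < b := D.mono.reflect_lt h

/-- Since `G` grows by `κ > 0` over a period, each of its levels is shorter than a period. -/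
theorem sub_lt_of_G_eq {a b : ℤ} (h : D.G a = D.G b) : a - n < b := by
  apply D.lt_of_G_lt
  have := D.G_add (a - n)
  rw [sub_add_cancel] at this
  have := D.pos
  omega

variable [NeZero n]

theorem one_lt {j : ℤ} (hj : j ∈ D.Y) : 1 < n := by
  by_contra hn
  have h1 : n = 1 := by
    have := Nat.pos_of_neZero n
    omega
  have h2 := D.G_add j
  have h3 : (n : ℤ) = 1 := by exact_mod_cast h1
  rw [h3, D.G_succ j hj] at h2
  have := D.pos
  omega

/-- The stabilizer of the function `G`. -/
def levi : Subgroup (AffWeyl n) where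
  carrier := {g | ∀ q : ℤ, D.G (g • q) = D.G q}
  one_mem' q := by rw [one_smul]
  mul_mem' {a b} ha hb q := by rw [mul_smul, ha, hb]
  inv_mem' {a} ha q := by
    have := ha (a⁻¹ • q)
    rw [smul_inv_smul] at this
    exact this.symm

theorem refl_mem_levi {a b : ℤ} (h : D.G a = D.G b) : refl a b ∈ D.levi (n := n) := by
  by_cases hne : (res a : Fin n) = res b
  · rw [refl_eq_one hne]
    exact one_mem _
  intro q
  by_cases h1 : (res q : Fin n) = res a
  · obtain ⟨k, rfl⟩ := res_eq_iff.1 h1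
    rw [refl_smul_left_add hne, D.G_add_mul, D.G_add_mul, h]
  by_cases h2 : (res q : Fin n) = res b
  · obtain ⟨k, rfl⟩ := res_eq_iff.1 h2
    rw [refl_smul_right_add hne, D.G_add_mul, D.G_add_mul, h]
  rw [refl_smul_of_ne h1 h2]

theorem parabolic_le_levi : parabolic n D.Y ≤ D.levi := by
  refine (Subgroup.closure_le _).2 ?_
  rintro _ ⟨j, hj, rfl⟩
  exact D.refl_mem_levi (D.G_succ j hj).symm

/-- As `G` is monotone and `w` preserves it, an inverted pair must lie in a single level of `G`. -/
theorem mul_refl_mem_levi {w : AffWeyl n} (hw : w ∈ D.levi) {r c : ℤ} (h : invSign w r c ≠ 0) :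
    w * refl r c ∈ D.levi := by
  refine mul_mem hw (D.refl_mem_levi ?_)
  have h1 := hw r
  have h2 := hw c
  rcases invSign_ne_zero h with ⟨h3, h4⟩ | ⟨h3, h4⟩
  · have h5 := D.mono h3.le
    have h6 := D.mono h4.le
    omega
  · have h5 := D.mono h3.le
    have h6 := D.mono h4.le
    omega

/-- The elements preserve the levels of `G`, so they move integers by less than `n` and are
determined by finitely many values. -/
theorem finite_levi : (D.levi (n := n) : Set (AffWeyl n)).Finite := by
  have hf : (Set.pi Set.univ fun i : Fin n => Set.Icc ((i : ℤ) - n) ((i : ℤ) + n)).Finite :=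
    Set.Finite.pi fun i => Set.finite_Icc _ _
  refine Set.Finite.of_injOn (f := fun (g : AffWeyl n) (i : Fin n) => g • (i : ℤ)) ?_ ?_ hf
  · intro g hg i _
    have h1 := D.sub_lt_of_G_eq (n := n) (hg (i : ℤ))
    have h2 := D.sub_lt_of_G_eq (n := n) (hg (i : ℤ)).symm
    exact ⟨by linarith, by linarith⟩
  · intro g _ g' _ h
    refine ext_smul fun q => ?_
    have h1 : g • (((res q : Fin n) : ℕ) : ℤ) = g' • (((res q : Fin n) : ℕ) : ℤ) :=
      congrFun h (res q)
    rw [smul_eq_res g, smul_eq_res g', h1]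

/-- An affine permutation which is increasing on the blocks, and which permutes the values of `u`
up to an element of the stabilizer of `G`, stabilizes `G`. -/
theorem mem_levi {g τ : AffWeyl n} (hτ : τ ∈ D.levi) (hu : ∀ q : ℤ, D.u (τ • g • q) = D.u q)
    (hg : ∀ j ∈ D.Y, g • j < g • (j + 1)) : g ∈ D.levi := by
  -- Induction on the position `m` of `q` in its block. At the start, `1 - G ≤ u` at `τ • g • q`
  -- gives `G q ≤ G (g • q)`; later positions follow since `g` is increasing on the block.
  have h1 (m : ℕ) : ∀ q : ℤ, D.u q + D.G q - 1 = m → D.G q ≤ D.G (g • q) := by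
    induction m with
    | zero =>
      intro q hq
      have h2 := D.one_sub_le (τ • g • q)
      rw [hu, hτ] at h2
      push_cast at hq
      linarith
    | succ m ih =>
      intro q hq
      push_cast at hq
      by_cases hY : q - 1 ∈ D.Y
      · have h2 := D.G_succ _ hY
        have h3 := D.u_succ _ hY
        have h4 := D.mono (hg _ hY).le
        rw [sub_add_cancel] at h2 h3 h4
        have := ih (q - 1) (by linarith)
        linarith
      · have h3 := D.u_start _ hY
        rw [sub_add_cancel] at h3
        linarith
  have h2 (q : ℤ) : D.G q ≤ D.G (g • q) := by
    have := D.one_sub_le q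
    exact h1 (D.u q + D.G q - 1).toNat q (by omega)
  have hper (q : ℤ) : D.u q + D.G q =
      D.u ((res q : Fin n) : ℕ) + D.G ((res q : Fin n) : ℕ) := by
    have h4 := res_add_mul_ediv (n := n) q
    conv_lhs => rw [← h4]
    rw [D.u_add_mul, D.G_add_mul]
    ring
  -- The function `u + G` is `n`-periodic, so its sum over a period is unchanged by an affine
  -- permutation. Hence the inequalities between the values of `G` are equalities.
  have hsum : ∑ i : Fin n, (D.u (τ • g • (i : ℤ)) + D.G (τ • g • (i : ℤ))) =
      ∑ i : Fin n, (D.u i + D.G i) := by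
    rw [← Equiv.sum_comp (τ * g).right (fun i : Fin n => D.u i + D.G i)]
    refine Finset.sum_congr rfl fun i _ => ?_
    rw [hper, ← mul_smul, res_smul, res_fin]
  have hτ' (q : ℤ) : D.G (τ • q) = D.G q := hτ q
  simp only [Finset.sum_add_distrib, hu, hτ'] at hsum
  have heq := (Finset.sum_eq_sum_iff_of_le fun (i : Fin n) _ => h2 i).1
    (add_left_cancel hsum).symm
  intro q
  have h4 := res_add_mul_ediv (n := n) q
  rw [smul_eq_res, D.G_add_mul, ← heq _ (Finset.mem_univ _), ← D.G_add_mul, h4]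

/-- Distinct integers in one level of `G` are never congruent modulo `n`. -/
theorem refl_succ_smul_of_G_eq {a r : ℤ} (hG : D.G r = D.G a) (hG' : D.G (a + 1) = D.G a)
    (h1 : r ≠ a) (h2 : r ≠ a + 1) : (refl a (a + 1) : AffWeyl n) • r = r := by
  have key (b : ℤ) (hb : D.G r = D.G b) (hr : r ≠ b) : (res r : Fin n) ≠ res b := by
    intro h
    obtain ⟨k, hk⟩ := res_eq_iff.1 h
    rw [hk, D.G_add_mul] at hb
    have h0 : κ * k = 0 := by linarith
    rcases mul_eq_zero.1 h0 with h0 | h0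
    · exact D.pos.ne' h0
    · rw [h0, mul_zero, add_zero] at hk
      exact hr hk
  exact refl_smul_of_ne (key a hG h1) (key (a + 1) (hG.trans hG'.symm) h2)

/-- The sequence obtained from `u` by exchanging two successive values in a block is not a
rearrangement of `u` keeping the order of each block. -/
theorem not_exists_refl {a : ℤ} (ha : a ∈ D.Y) {g : AffWeyl n}
    (hg : ∀ j ∈ D.Y, g • j < g • (j + 1))
    (hu : ∀ q : ℤ, D.u ((refl a (a + 1) : AffWeyl n) • g • q) = D.u q) : False := by
  have hne := res_ne_succ (D.one_lt ha) a
  have hGa := D.G_succ a ha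
  have hua := D.u_succ a ha
  have hL := D.mem_levi (D.refl_mem_levi hGa.symm) hu hg
  set s : AffWeyl n := refl a (a + 1) with hs
  -- The set `A` collects the positions up to `a` in the level of `a` where the exchanged sequence
  -- has the value `u a + 1`; it contains `a`. The lower bound of the interval is automatic and only
  -- serves finiteness.
  set A := (Finset.Ioc (a - n) a).filter fun r => D.G r = D.G a ∧ D.u (s • r) = D.u a + 1 with hA
  have hmemA {r : ℤ} : r ∈ A ↔ r ≤ a ∧ D.G r = D.G a ∧ D.u (s • r) = D.u a + 1 := by
    rw [hA, Finset.mem_filter, Finset.mem_Ioc]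
    refine ⟨fun h => ⟨h.1.2, h.2⟩, fun h => ⟨⟨?_, h.1⟩, h.2⟩⟩
    exact D.sub_lt_of_G_eq h.2.1.symm
  have haA : a ∈ A := hmemA.2 ⟨le_rfl, rfl, by rw [hs, refl_smul_left hne, hua]⟩
  have hcard : A.card ≤ (A.erase a).card := by
    -- For `r` in `A`, the preimage `q` is not the start of a block, so `g • (q - 1)` lies before
    -- `r` and carries the value `u a`. By `mem_of_lt` its block continues, so its successor carries
    -- `u a + 1` and differs from `a`. This injects `A` into `A` without `a`.
    refine Finset.card_le_card_of_injOn (fun r => g • (g⁻¹ • r - 1) + 1) ?_ ?_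
    · intro r hr
      obtain ⟨hra, hrG, hru⟩ := hmemA.1 hr
      set q := g⁻¹ • r with hq
      have hgq : g • q = r := by rw [hq, smul_inv_smul]
      have hqu : D.u q = D.u a + 1 := by rw [← hu, hgq, hru]
      have hqG : D.G q = D.G a := by rw [← hL, hgq, hrG]
      have hY : q - 1 ∈ D.Y := by
        by_contra h
        have h1 := D.u_start _ h
        rw [sub_add_cancel] at h1
        have := D.one_sub_le a
        linarith
      have h1 := D.G_succ _ hY
      have h2 := D.u_succ _ hY
      have h3 := hg _ hY
      rw [sub_add_cancel] at h1 h2 h3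
      rw [hgq] at h3
      have h4 : D.G (g • (q - 1)) = D.G a := by rw [hL, ← h1, hqG]
      have h5 : s • g • (q - 1) = g • (q - 1) :=
        D.refl_succ_smul_of_G_eq h4 hGa (by omega) (by omega)
      have h6 : D.u (g • (q - 1)) = D.u a := by
        rw [← h5, hu]
        linarith
      have h7 : g • (q - 1) ∈ D.Y := D.mem_of_lt _ a (by omega) h4 h6 ha
      have h8 := D.G_succ _ h7
      have h9 := D.u_succ _ h7
      have h10 : g • (q - 1) + 1 ≠ a := by
        intro h
        rw [h] at h9
        linarith
      have h11 : s • (g • (q - 1) + 1) = g • (q - 1) + 1 :=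
        D.refl_succ_smul_of_G_eq (h8.trans h4) hGa h10 (by omega)
      change g • (q - 1) + 1 ∈ A.erase a
      refine (Finset.mem_erase.2 ⟨h10, hmemA.2 ⟨by omega, h8.trans h4, ?_⟩⟩)
      rw [h11, h9, h6]
    · intro r _ r' _ h
      have h1 := add_right_cancel h
      rw [smul_inj, sub_left_inj, smul_inj] at h1
      exact h1
  rw [Finset.card_erase_of_mem haA] at hcard
  have := Finset.card_pos.2 ⟨a, haA⟩
  omega

/-- The weight `ζ` is the one given by `u`. -/
def IsWeight (ζ : Cartan n →ₗ[ℂ] ℂ) : Prop := ∀ q : ℤ, ζ (epsCheck q) = D.u q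

variable {D} {ζ : Cartan n →ₗ[ℂ] ℂ}

theorem IsWeight.isSteinberg (hζ : D.IsWeight ζ) : IsSteinberg D.Y ζ := by
  intro j hj
  refine ⟨D.one_lt hj, fun h => ?_⟩
  rw [act_refl_succ (D.one_lt hj), map_sub, map_smul, map_sub, hζ, hζ, D.u_succ j hj, smul_eq_mul]
  push_cast
  ring

end SegmentData

/-- The action on the Cartan subalgebra, as a linear map. -/
def actHom {n : ℕ} (g : AffWeyl n) : Cartan n →ₗ[ℂ] Cartan n where
  toFun := act g
  map_add' := act_add g
  map_smul' := act_smul g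

/-! ### Weight vectors of weight `ζ`: support and invariance -/

namespace IsInduced

variable {n : ℕ} [NeZero n] {κ : ℤ} {D : SegmentData n κ} {ζ : Cartan n →ₗ[ℂ] ℂ} {M : Type*}
  [AddCommGroup M] [Module (DDAHA n) M] [Module ℂ M] [IsScalarTower ℂ (DDAHA n) M] {e : M}

/-- The group `levi` is stable under undoing inversions, so it can serve as the set `S` in
`exists_top_term`. A term outside it would give a permutation preserving `u`, which `mem_levi`
excludes. -/
theorem mem_span_levi (hM : IsInduced D.Y ζ e) (hζ : D.IsWeight ζ) {v : M}
    (hv : v ∈ weightSpace M ζ) :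
    v ∈ Submodule.span ℂ {x | ∃ w ∈ D.levi (n := n), x = (ofGroup w : DDAHA n) • e} := by
  obtain ⟨θ, hθ⟩ := hM.exists_coord
  have key (w : AffWeyl n) (hw : θ v w ≠ 0) : w ∈ D.levi := by
    by_contra h
    obtain ⟨w', h1, h2, h3⟩ := hM.exists_top_term hθ (S := (D.levi (n := n) : Set (AffWeyl n)))
      (fun w hw g hg => mul_mem hw (D.parabolic_le_levi hg))
      (fun w hw r c hrc => D.mul_refl_mem_levi hw hrc) hv hw h
    refine h1 (D.mem_levi (one_mem _) (fun q => ?_) h2)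
    have h4 := h3 (epsCheck (w' • q))
    rw [act_epsCheck, inv_smul_smul, hζ, hζ] at h4
    rw [one_smul]
    exact_mod_cast h4.symm
  rw [hM.eq_sum_coord hθ v (rep := Quotient.out) (fun C => QuotientGroup.out_eq' C)]
  refine Submodule.sum_mem _ fun C hC => Submodule.smul_mem _ _ (Submodule.subset_span ⟨_, ?_, rfl⟩)
  apply key
  rw [QuotientGroup.out_eq']
  exact Finsupp.mem_support_iff.1 hC

/-- The difference between `v` and its reflection is a weight vector for the reflected weight. If it
were nonzero, its top term would contradict `not_exists_refl`. -/
theorem refl_smul_of_mem_weightSpace (hM : IsInduced D.Y ζ e) (hζ : D.IsWeight ζ) {v : M}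
    (hv : v ∈ weightSpace M ζ) {a : ℤ} (ha : a ∈ D.Y) :
    (ofGroup (refl a (a + 1)) : DDAHA n) • v = v := by
  have hn := D.one_lt ha
  set v' := v - (ofGroup (refl a (a + 1)) : DDAHA n) • v with hv'
  have hw : v' ∈ weightSpace M (ζ ∘ₗ actHom (refl a (a + 1))) := by
    intro h
    have h1 := ofGroup_refl_mul hn a (act (refl a (a + 1)) h)
    rw [← act_mul, refl_mul_self, act_one, eq_sub_iff_add_eq] at h1
    have h2 := congrArg (· • v) h1
    simp only [add_smul, mul_smul, algebraMap_smul] at h2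
    rw [hv, smul_smul_comm] at h2
    have h3 := (hζ.isSteinberg a ha).2 (act (refl a (a + 1)) h)
    rw [← act_mul, refl_mul_self, act_one] at h3
    rw [hv', smul_sub, hv, ← h2, h3]
    simp only [LinearMap.comp_apply, actHom, LinearMap.coe_mk, AddHom.coe_mk, add_smul, smul_sub]
    abel
  by_contra hne
  obtain ⟨θ, hθ⟩ := hM.exists_coord
  have h0 : θ v' ≠ 0 := by
    intro h0
    have := hM.eq_sum_coord hθ v' (rep := Quotient.out) (fun C => QuotientGroup.out_eq' C)
    rw [h0, Finsupp.sum_zero_index, hv', sub_eq_zero] at this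
    exact hne this.symm
  obtain ⟨C, hC⟩ := Finsupp.ne_iff.1 h0
  obtain ⟨w, rfl⟩ := QuotientGroup.mk_surjective C
  obtain ⟨g, -, h2, h3⟩ := hM.exists_top_term hθ (S := ∅) (by simp) (by simp) hw hC (by simp)
  refine D.not_exists_refl ha h2 fun q => ?_
  have h4 := h3 (epsCheck (g • q))
  rw [act_epsCheck, inv_smul_smul, hζ, LinearMap.comp_apply] at h4
  change _ = ζ (act _ _) at h4
  rw [act_epsCheck, hζ] at h4
  exact_mod_cast h4.symm

end IsInduced

end DegenerateDAHA

namespace DegenerateDAHA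

open DDAHA

variable {n : ℕ} [NeZero n]

/-! ### Symmetrization -/

theorem cherednik_epsCheck {X : Type*} [AddCommGroup X] [Module ℂ X] (b : AffWeyl n → X)
    (ζ : Cartan n →ₗ[ℂ] ℂ) (g : AffWeyl n) (r : ℤ) :
    cherednik b ζ (epsCheck (g • r)) g = ζ (epsCheck r) • b g + invSum b g r := by
  rw [cherednik, act_epsCheck, inv_smul_smul, Finset.sum_eq_single (res r)]
  · simp [epsCheck, res_smul, invSum_res]
  · intro i _ hi
    have : g.right i ≠ g.right (res r) := fun h => hi (g.right.injective h)
    simp [epsCheck, res_smul, Pi.single_eq_of_ne this]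
  · simp

namespace SegmentData

variable {κ : ℤ} (D : SegmentData n κ)

/-- Such a jump makes `(o, o + n]` a period which is a union of levels of `G`, hence stable under
`levi`. -/
theorem exists_G_lt : ∃ o : ℤ, D.G o < D.G (o + 1) := by
  by_contra! h
  have h1 := antitone_int_of_succ_le h (show (0 : ℤ) ≤ 0 + n by positivity)
  rw [D.G_add] at h1
  have := D.pos
  omega

/-- The elements of the stabilizer of `G` which fix the elements of the interval `(b, l]`. -/
def leviFix (b l : ℤ) : Set (AffWeyl n) :=
  {g | g ∈ D.levi ∧ ∀ j : ℤ, b < j → j ≤ l → g • j = j}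

theorem finite_leviFix (b l : ℤ) : (D.leviFix b l).Finite :=
  D.finite_levi.subset fun _ hg => hg.1

section Window

variable {o : ℤ}

theorem lt_of_G_eq (ho : D.G o < D.G (o + 1)) {b r : ℤ} (hb : o < b) (h : D.G r = D.G b)
    : o < r := by
  apply D.lt_of_G_lt
  have := D.mono (Int.add_one_le_iff.2 hb)
  omega

theorem le_of_G_eq (ho : D.G o < D.G (o + 1)) {b r : ℤ} (hb : b ≤ o + n) (h : D.G r = D.G b)
    : r ≤ o + n := by
  have h1 := D.mono hb
  have h2 := D.G_add o
  have h3 := D.G_add (o + 1)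
  have : r < o + 1 + n := D.lt_of_G_lt (by omega)
  omega

theorem preimage_le (ho : D.G o < D.G (o + 1)) {b : ℤ} (hb' : b ≤ o + n) {g : AffWeyl n}
    (hg : g ∈ D.leviFix b (o + n)) {r : ℤ} (hr : g • r = b) : r ≤ b := by
  by_contra h
  have hG : D.G r = D.G b := by rw [← hr, hg.1]
  have := hg.2 r (not_le.1 h) (D.le_of_G_eq ho hb' hG)
  omega

/-- Within the level of `b`, everything after `b` is fixed, so `b` is the largest position reached
by the elements up to `b`. Thus `r` is inverted with each `c` in `(r, b]` and with nothing else. -/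
theorem invSign_of_mem_leviFix (ho : D.G o < D.G (o + 1)) {b : ℤ} (hb' : b ≤ o + n) {g : AffWeyl n}
    (hg : g ∈ D.leviFix b (o + n)) {r : ℤ} (hr : g • r = b) (c : ℤ) :
    invSign g r c = if r < c ∧ c ≤ b then 1 else 0 := by
  have hrb := D.preimage_le ho hb' hg hr
  have hG : D.G r = D.G b := by rw [← hr, hg.1]
  have hGc : D.G (g • c) = D.G c := hg.1 c
  have hne : c ≠ r → g • c ≠ b := fun h h' => h ((smul_inj g).1 (h'.trans hr.symm))
  have hfix : D.G c = D.G b → b < g • c → g • c = c := by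
    intro h1 h2
    have := hg.2 (g • c) h2 (D.le_of_G_eq ho hb' (hGc.trans h1))
    rwa [smul_inj] at this
  rw [invSign, hr]
  rcases lt_trichotomy c r with h | rfl | h
  · have : ¬ b < g • c := by
      intro h1
      have h2 := D.mono h.le
      have h3 := D.mono h1.le
      have := hfix (by omega) h1
      omega
    simp [h.asymm, this]
  · simp [hr]
  by_cases hc : c ≤ b
  · have : ¬ b < g • c := by
      intro h1
      have h2 := D.mono h.le
      have h3 := D.mono hc
      have := hfix (by omega) h1
      omega
    simp [h, hc, this]
  · have : b < g • c := by
      by_contra h1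
      have h2 := D.mono (not_lt.1 h1)
      have h3 := D.mono (not_le.1 hc).le
      have h4 := hg.2 c (not_le.1 hc) (D.le_of_G_eq ho hb' (by omega))
      omega
    simp [h, hc, this]

theorem mul_refl_mem_leviFix (ho : D.G o < D.G (o + 1)) {b : ℤ} (hb : o < b) {g : AffWeyl n}
    (hg : g ∈ D.leviFix b (o + n)) {r c : ℤ} (hr : D.G r = D.G b) (hc : D.G c = D.G b)
    (hrb : r ≤ b) (hcb : c ≤ b) : g * refl r c ∈ D.leviFix b (o + n) := by
  refine ⟨mul_mem hg.1 (D.refl_mem_levi (hr.trans hc.symm)), fun j hj hj' => ?_⟩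
  have key (x : ℤ) (hx : o < x) (hx' : x ≤ b) : (res j : Fin n) ≠ res x := by
    intro h
    obtain ⟨k, hk⟩ := res_eq_iff.1 h
    have h1 : 0 < (n : ℤ) * k := by linarith
    have h2 : (n : ℤ) * k < n * 1 := by linarith
    have h3 := pos_of_mul_pos_right h1 (by positivity)
    have h4 := lt_of_mul_lt_mul_left h2 (by positivity)
    omega
  rw [mul_smul, refl_smul_of_ne (key r (D.lt_of_G_eq ho hb hr) hrb)
    (key c (D.lt_of_G_eq ho hb hc) hcb), hg.2 j hj hj']

end Window

end SegmentData

/-! ### Recovering the generator from its symmetrization -/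

section Symmetrizer

variable {κ : ℤ} (D : SegmentData n κ) {ζ : Cartan n →ₗ[ℂ] ℂ} {M : Type*}
  [AddCommGroup M] [Module (DDAHA n) M] [Module ℂ M] [IsScalarTower ℂ (DDAHA n) M] (e : M)

open Classical in
/-- The sum of the translates of `e` by the elements `g` of the stabilizer of `G`, fixing the
elements of `(b, l]`, with `g r = b`. -/
def partialSym (b l r : ℤ) : M :=
  ∑ g ∈ (D.finite_leviFix b l).toFinset with g • r = b, (ofGroup g : DDAHA n) • e

/-- The sum of the translates of `e` by the elements of the stabilizer of `G` fixing the elements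
of `(b, l]`. -/
def symVec (b l : ℤ) : M := ∑ g ∈ (D.finite_leviFix b l).toFinset, (ofGroup g : DDAHA n) • e

variable {D e} {o : ℤ}

/-- Right multiplication by `refl r c` is a bijection from the elements sending `r` to `b` onto
those sending `c` to `b`. -/
theorem sum_mul_refl (ho : D.G o < D.G (o + 1)) {b : ℤ} (hb : o < b) {r c : ℤ} (hr : D.G r = D.G b)
    (hc : D.G c = D.G b) (hrb : r ≤ b) (hcb : c ≤ b) (hrc : r ≠ c) :
    ∑ g ∈ (D.finite_leviFix b (o + n)).toFinset with g • r = b,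
      (ofGroup (g * refl r c) : DDAHA n) • e = partialSym D e b (o + n) c := by
  classical
  have hne : (res r : Fin n) ≠ res c := by
    intro h
    obtain ⟨k, hk⟩ := res_eq_iff.1 h
    have h1 := D.G_add_mul c k
    rw [← hk, hr, hc] at h1
    have h0 : κ * k = 0 := by linarith
    rcases mul_eq_zero.1 h0 with h0 | h0
    · exact D.pos.ne' h0
    · rw [h0, mul_zero, add_zero] at hk
      exact hrc hk
  unfold partialSym
  refine Finset.sum_nbij' (fun g => g * refl r c) (fun g => g * refl r c) ?_ ?_ ?_ ?_ ?_
  · intro g hg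
    simp only [Finset.mem_filter, Set.Finite.mem_toFinset] at hg ⊢
    exact ⟨D.mul_refl_mem_leviFix ho hb hg.1 hr hc hrb hcb, by
      rw [mul_smul, refl_smul_right hne, hg.2]⟩
  · intro g hg
    simp only [Finset.mem_filter, Set.Finite.mem_toFinset] at hg ⊢
    exact ⟨D.mul_refl_mem_leviFix ho hb hg.1 hr hc hrb hcb, by
      rw [mul_smul, refl_smul_left hne, hg.2]⟩
  · intro g _
    rw [mul_assoc, refl_mul_self, mul_one]
  · intro g _
    rw [mul_assoc, refl_mul_self, mul_one]
  · intro g _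
    rfl

/-- In every term the inversions of `r` are the `c` in `(r, b]`, and undoing one turns the sum for
`r` into the sum for `c`. So `ε_b^∨` acts on the partial sums by a triangular matrix. -/
theorem epsCheck_smul_partialSym (ho : D.G o < D.G (o + 1)) (he : e ∈ weightSpace M ζ)
    (hζ : D.IsWeight ζ) {b : ℤ}
    (hb : o < b) (hb' : b ≤ o + n) {r : ℤ} (hr : D.G r = D.G b) (hrb : r ≤ b) :
    (ofCartan (epsCheck b) : DDAHA n) • partialSym D e b (o + n) r =
      (D.u r : ℂ) • partialSym D e b (o + n) r +
        ∑ c ∈ Finset.Ioc r b, partialSym D e b (o + n) c := by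
  classical
  have h1 : ∀ c ∈ Finset.Ioc r b, partialSym D e b (o + n) c =
      ∑ g ∈ (D.finite_leviFix b (o + n)).toFinset with g • r = b,
      (ofGroup (g * refl r c) : DDAHA n) • e := by
    intro c hc
    rw [Finset.mem_Ioc] at hc
    have h2 := D.mono hc.1.le
    have h3 := D.mono hc.2
    rw [sum_mul_refl ho hb hr (by omega) hrb hc.2 hc.1.ne]
  rw [Finset.sum_congr rfl h1, Finset.sum_comm, partialSym, Finset.smul_sum, Finset.smul_sum,
    ← Finset.sum_add_distrib]
  refine Finset.sum_congr rfl fun g hg => ?_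
  simp only [Finset.mem_filter, Set.Finite.mem_toFinset] at hg
  rw [ofCartan_smul_ofGroup_smul he]
  conv_lhs => rw [← hg.2, cherednik_epsCheck, hζ]
  congr 1
  rw [invSum, finsum_eq_sum_of_support_subset (s := Finset.Ioc r b)]
  · refine Finset.sum_congr rfl fun c hc => ?_
    rw [Finset.mem_Ioc] at hc
    rw [D.invSign_of_mem_leviFix ho hb' hg.1 hg.2, if_pos hc, Int.cast_one, one_smul]
  · intro c hc
    by_contra h
    rw [Finset.coe_Ioc, Set.mem_Ioc] at h
    rw [Function.mem_support, D.invSign_of_mem_leviFix ho hb' hg.1 hg.2, if_neg h] at hc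
    simp at hc

theorem partialSym_succ (ho : D.G o < D.G (o + 1)) (hM : IsInduced D.Y ζ e) {b : ℤ} (hb : o < b)
    {r : ℤ}
    (hr : D.G r = D.G b) (hrb : r < b) (hY : r ∈ D.Y) :
    partialSym D e b (o + n) (r + 1) = partialSym D e b (o + n) r := by
  classical
  rw [← sum_mul_refl ho hb hr ((D.G_succ r hY).trans hr) hrb.le hrb (by omega), partialSym]
  refine Finset.sum_congr rfl fun g _ => ?_
  rw [ofGroup_mul, mul_smul, hM.refl_smul r hY]

/-- Some element of the algebra maps a partial sum of the `partialSym` to the last one. -/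
theorem exists_smul_tail (ho : D.G o < D.G (o + 1)) (hM : IsInduced D.Y ζ e) (hζ : D.IsWeight ζ)
    {b : ℤ}
    (hb : o < b) (hb' : b ≤ o + n) {r : ℤ} (hr : D.G r = D.G b) (hrb : r ≤ b) (s : ℕ) :
    ∃ f : DDAHA n, f • (ofCartan (epsCheck b) + algebraMap ℂ _ (D.G b : ℂ) : DDAHA n) ^ s •
      (∑ c ∈ Finset.Icc r b, partialSym D e b (o + n) c +
        ((D.u r + D.G b - 1 : ℤ) : ℂ) • partialSym D e b (o + n) r) =
      partialSym D e b (o + n) b := by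
  set y : DDAHA n := ofCartan (epsCheck b) + algebraMap ℂ _ (D.G b : ℂ) with hy
  set Z : ℤ → M := partialSym D e b (o + n) with hZ
  have hyZ {r : ℤ} (hr : D.G r = D.G b) (hrb : r ≤ b) : y • Z r =
      ((D.u r + D.G b : ℤ) : ℂ) • Z r + ∑ c ∈ Finset.Icc (r + 1) b, Z c := by
    rw [hy, add_smul, algebraMap_smul, hZ,
      epsCheck_smul_partialSym ho hM.mem_weightSpace hζ hb hb' hr hrb, ← Finset.Icc_add_one_left_eq_Ioc]
    push_cast
    rw [add_smul]
    abel
  -- Write `Z_r` for the partial sums and `T_r` for the sum of the `Z_c`, `r ≤ c ≤ b`, plus `(u r +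
  -- G b - 1) Z_r`. Descending in `r`, it is shown that `y ^ s • T_r` can be carried to `Z_b` for
  -- every `s`. At `r = b` it is `(u b + G b) ^ (s + 1) Z_b`, with `u b + G b ≥ 1`.
  induction r, hrb using Int.leInductionDown generalizing s with
  | base =>
    have hk : (D.u b + D.G b : ℤ) ≠ 0 := by
      have := D.one_sub_le b
      omega
    have hk' : ((D.u b + D.G b : ℤ) : ℂ) ≠ 0 := by exact_mod_cast hk
    have h1 : y • Z b = ((D.u b + D.G b : ℤ) : ℂ) • Z b := by
      rw [hyZ rfl le_rfl, Finset.Icc_eq_empty (by omega), Finset.sum_empty, add_zero]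
    have h2 (s : ℕ) : y ^ s • Z b = ((D.u b + D.G b : ℤ) : ℂ) ^ s • Z b := by
      induction s with
      | zero => simp
      | succ s ih => rw [pow_succ, mul_smul, h1, smul_smul_comm, ih, smul_smul, pow_succ']
    refine ⟨algebraMap ℂ _ ((((D.u b + D.G b : ℤ) : ℂ) ^ (s + 1))⁻¹), ?_⟩
    have h3 : ∑ c ∈ Finset.Icc b b, Z c + ((D.u b + D.G b - 1 : ℤ) : ℂ) • Z b =
        ((D.u b + D.G b : ℤ) : ℂ) • Z b := by
      rw [Finset.Icc_self, Finset.sum_singleton]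
      push_cast
      module
    rw [h3, smul_smul_comm, h2, smul_smul, ← pow_succ', algebraMap_smul,
      inv_smul_smul₀ (pow_ne_zero _ hk')]
  | pred r hrb ih =>
    have hr' : D.G r = D.G b := by
      have h1 := D.mono (sub_one_lt r).le
      have h2 := D.mono hrb
      omega
    have hsum : ∑ c ∈ Finset.Icc (r - 1) b, Z c = Z (r - 1) + ∑ c ∈ Finset.Icc r b, Z c := by
      rw [← Finset.insert_Icc_add_one_left_eq_Icc (by omega), sub_add_cancel,
        Finset.sum_insert (by simp)]
    by_cases hY : r - 1 ∈ D.Y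
    -- Inside a block, `Z_{r-1} = Z_r` and `u` grows by one, so `T_{r-1} = T_r`.
    · have h1 := partialSym_succ ho hM hb hr (by omega) hY
      have h2 := D.u_succ _ hY
      rw [sub_add_cancel] at h1 h2
      obtain ⟨f, hf⟩ := ih hr' s
      refine ⟨f, ?_⟩
      replace h1 : Z r = Z (r - 1) := h1
      rw [← hf, hsum, ← h1, h2]
      congr 2
      push_cast
      module
    -- At the start `r` of a block, `T_r` is the plain tail sum. With `k = u (r - 1) + G b`, one has
    -- `y Z_{r-1} = k Z_{r-1} + T_r = T_{r-1}`, so `(y - k) T_{r-1} = y T_r`; the extra factor `y`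
    -- is why the exponent `s` is arbitrary.
    · have h2 := D.u_start _ hY
      rw [sub_add_cancel, hr'] at h2
      obtain ⟨f, hf⟩ := ih hr' (s + 1)
      have h3 := hyZ hr (by omega)
      rw [sub_add_cancel] at h3
      set k : ℤ := D.u (r - 1) + D.G b with hk
      refine ⟨f * (y - algebraMap ℂ _ (k : ℂ)), ?_⟩
      have hcomm : Commute (y - algebraMap ℂ _ (k : ℂ)) (y ^ s) :=
        Commute.pow_right ((Commute.refl y).sub_left (Algebra.commute_algebraMap_left (k : ℂ) y)) s
      rw [mul_smul, ← mul_smul (y - _), hcomm.eq, mul_smul, ← hf, hsum, h2, pow_succ, mul_smul]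
      refine congrArg (fun x => f • y ^ s • x) ?_
      rw [sub_smul, algebraMap_smul, smul_add, smul_add, smul_smul_comm, h3]
      have h4 : ((1 - D.G b + D.G b - 1 : ℤ) : ℂ) = 0 := by push_cast; ring
      rw [h4, zero_smul, add_zero]
      rw [Int.cast_sub, Int.cast_one]
      generalize y • ∑ c ∈ Finset.Icc r b, Z c = A
      module

/-- The sum over the elements fixing `(b, o + n]` is reduced to the sum over those also fixing `b`,
which is the last partial sum `Z_b`. After a whole period only the identity remains. -/
theorem exists_smul_symVec (ho : D.G o < D.G (o + 1)) (hM : IsInduced D.Y ζ e) (hζ : D.IsWeight ζ)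
    (t : ℕ) (ht : t ≤ n) :
    ∃ f : DDAHA n, f • symVec D e (o + t) (o + n) = e := by
  classical
  induction t with
  | zero =>
    refine ⟨1, ?_⟩
    have : (D.finite_leviFix (n := n) (o + (0 : ℕ)) (o + n)).toFinset = {1} := by
      ext g
      rw [Set.Finite.mem_toFinset, Finset.mem_singleton]
      constructor
      · rintro ⟨-, hg⟩
        refine ext_smul fun q => ?_
        rw [one_smul]
        have h1 := Int.emod_add_mul_ediv (q - (o + 1)) n
        have hn := natCast_pos' (n := n)
        have h2 := Int.emod_nonneg (q - (o + 1)) hn.ne'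
        have h3 := Int.emod_lt_of_pos (q - (o + 1)) hn
        have h4 : q = (o + 1 + (q - (o + 1)) % n) + n * ((q - (o + 1)) / n) := by linarith
        rw [h4, smul_add_mul, hg _ (by push_cast; omega) (by omega)]
      · rintro rfl
        exact ⟨one_mem _, fun j _ _ => one_smul _ _⟩
    rw [symVec, this, Finset.sum_singleton, ofGroup_one, one_smul, one_smul]
  | succ t ih =>
    obtain ⟨f, hf⟩ := ih (by omega)
    set b : ℤ := o + (t + 1 : ℕ) with hb
    have hb1 : o < b := by omega
    have hb2 : b ≤ o + n := by omega
    have hZb : partialSym D e b (o + n) b = symVec D e (o + t) (o + n) := by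
      refine Finset.sum_congr ?_ fun _ _ => rfl
      ext g
      simp only [Finset.mem_filter, Set.Finite.mem_toFinset]
      constructor
      · rintro ⟨⟨h1, h2⟩, h3⟩
        refine ⟨h1, fun j hj hj' => ?_⟩
        rcases (show b ≤ j by push_cast at hb; omega).eq_or_lt with h | h
        · rw [← h, h3]
        · exact h2 j h hj'
      · rintro ⟨h1, h2⟩
        exact ⟨⟨h1, fun j hj hj' => h2 j (by omega) hj'⟩, h2 b (by omega) hb2⟩
    -- Here `a` is the first element of the level of `b`. It starts a block, so the multiple of
    -- `Z_a` in `exists_smul_tail` has coefficient zero and the tail sum is the whole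
    -- symmetrization.
    obtain ⟨a, haA, hmin⟩ := Finset.exists_min_image
      ((Finset.Ioc o b).filter fun a => D.G a = D.G b) id ⟨b, by simp [hb1]⟩
    simp only [Finset.mem_filter, Finset.mem_Ioc, id] at haA hmin
    have hsym : symVec D e b (o + n) = ∑ c ∈ Finset.Icc a b, partialSym D e b (o + n) c := by
      rw [symVec, ← Finset.sum_fiberwise_of_maps_to (g := fun g : AffWeyl n => g⁻¹ • b)
        (t := Finset.Icc a b)]
      · refine Finset.sum_congr rfl fun c _ => ?_
        refine Finset.sum_congr (Finset.filter_congr fun g _ => ?_) fun _ _ => rfl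
        rw [inv_smul_eq_iff, eq_comm]
      · intro g hg
        rw [Set.Finite.mem_toFinset] at hg
        have h1 : g • (g⁻¹ • b) = b := smul_inv_smul _ _
        have h2 := D.preimage_le ho hb2 hg h1
        have h3 : D.G (g⁻¹ • b) = D.G b := by
          have := hg.1 (g⁻¹ • b)
          rw [h1] at this
          exact this.symm
        exact Finset.mem_Icc.2 ⟨hmin _ ⟨⟨D.lt_of_G_eq ho hb1 h3, h2⟩, h3⟩, h2⟩
    have hY : a - 1 ∉ D.Y := by
      intro h
      have h1 := D.G_succ _ h
      rw [sub_add_cancel, haA.2] at h1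
      have := hmin (a - 1) ⟨⟨D.lt_of_G_eq ho hb1 h1.symm, by omega⟩, h1.symm⟩
      omega
    have hu := D.u_start _ hY
    rw [sub_add_cancel, haA.2] at hu
    obtain ⟨f', hf'⟩ := exists_smul_tail ho hM hζ hb1 hb2 haA.2 haA.1.2 0
    rw [hu, pow_zero, one_smul, ← hsym] at hf'
    have h4 : ((1 - D.G b + D.G b - 1 : ℤ) : ℂ) = 0 := by push_cast; ring
    rw [h4, zero_smul, add_zero] at hf'
    exact ⟨f * f', by rw [mul_smul, hf', hZb, hf]⟩

end Symmetrizer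

/-- Invariance of `v` gives an endomorphism `E` with `E e = v`. Symmetrizing over `levi` makes `v`
proportional to `e`, and the inverse operation from `exists_smul_symVec` commutes with `E`. -/
theorem IsInduced.mem_span_singleton {κ : ℤ} {D : SegmentData n κ} {ζ : Cartan n →ₗ[ℂ] ℂ}
    {M : Type*} [AddCommGroup M] [Module (DDAHA n) M] [Module ℂ M] [IsScalarTower ℂ (DDAHA n) M]
    {e : M} (hM : IsInduced D.Y ζ e) (hζ : D.IsWeight ζ) {v : M} (hv : v ∈ weightSpace M ζ) :
    v ∈ Submodule.span ℂ {e} := by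
  classical
  obtain ⟨E, hE⟩ := hM.exists_lift v hv fun j hj => hM.refl_smul_of_mem_weightSpace hζ hv hj
  obtain ⟨o, ho⟩ := D.exists_G_lt
  obtain ⟨f, hf⟩ := exists_smul_symVec ho hM hζ n le_rfl
  set L := (D.finite_leviFix (n := n) (o + n) (o + n)).toFinset with hL
  have hmem (g : AffWeyl n) : g ∈ L ↔ g ∈ D.levi := by
    rw [hL, Set.Finite.mem_toFinset]
    exact ⟨fun h => h.1, fun h => ⟨h, fun j h1 h2 => absurd h1 (not_lt.2 h2)⟩⟩
  set x : DDAHA n := ∑ g ∈ L, ofGroup g with hx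
  have hxe : symVec D e (o + n) (o + n) = x • e := by rw [hx, Finset.sum_smul, symVec]
  have hxw (w : AffWeyl n) (hw : w ∈ D.levi) : x * ofGroup w = x := by
    rw [hx, Finset.sum_mul]
    refine Finset.sum_nbij' (fun g => g * w) (fun g => g * w⁻¹) ?_ ?_ ?_ ?_ ?_
    · intro g hg
      rw [hmem] at hg ⊢
      exact mul_mem hg hw
    · intro g hg
      rw [hmem] at hg ⊢
      exact mul_mem hg (inv_mem hw)
    · intro g _
      rw [mul_inv_cancel_right]
    · intro g _
      rw [inv_mul_cancel_right]
    · intro g _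
      rw [ofGroup_mul]
  have hxv : ∃ a : ℂ, x • v = a • x • e := by
    have h0 := hM.mem_span_levi hζ hv
    clear hE hv
    induction h0 using Submodule.span_induction with
    | mem y hy =>
      obtain ⟨w, hw, rfl⟩ := hy
      exact ⟨1, by rw [← mul_smul, hxw w hw, one_smul]⟩
    | zero => exact ⟨0, by rw [smul_zero, zero_smul]⟩
    | add y z _ _ h1 h2 =>
      obtain ⟨a, ha⟩ := h1
      obtain ⟨b, hb⟩ := h2
      exact ⟨a + b, by rw [smul_add, ha, hb, add_smul]⟩
    | smul c y _ h1 =>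
      obtain ⟨a, ha⟩ := h1
      exact ⟨c * a, by rw [smul_smul_comm, ha, mul_smul]⟩
  obtain ⟨a, ha⟩ := hxv
  refine Submodule.mem_span_singleton.2 ⟨a, ?_⟩
  rw [hxe] at hf
  calc a • e = a • f • x • e := by rw [hf]
    _ = f • x • E e := by rw [hE, ha, smul_smul_comm]
    _ = E (f • x • e) := by rw [map_smul, map_smul]
    _ = v := by rw [hf, hE]

end DegenerateDAHA

namespace DegenerateDAHA

open DDAHA

/-! ### The unique maximal submodule -/

/-- The subalgebra generated by the Cartan subalgebra. -/
def cartanAlg (n : ℕ) : Subalgebra ℂ (DDAHA n) := Algebra.adjoin ℂ (Set.range ofCartan)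

section CartanAlg

variable {n : ℕ}

theorem ofCartan_mem_cartanAlg (h : Cartan n) : ofCartan h ∈ cartanAlg n :=
  Algebra.subset_adjoin ⟨h, rfl⟩

theorem cartanAlg_comm {f g : DDAHA n} (hf : f ∈ cartanAlg n) (hg : g ∈ cartanAlg n) :
    f * g = g * f := by
  refine Algebra.commute_of_mem_adjoin_of_forall_mem_commute (s := Set.range ofCartan) hg ?_
  rintro _ ⟨h, rfl⟩
  refine (Algebra.commute_of_mem_adjoin_of_forall_mem_commute (s := Set.range ofCartan) hf ?_).symm
  rintro _ ⟨h', rfl⟩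
  exact ofCartan_comm h h'

/-- The operator `h - a`, for `h` in the Cartan subalgebra and a number `a`. -/
def shift (h : Cartan n) (a : ℂ) : DDAHA n := ofCartan h - algebraMap ℂ _ a

theorem shift_mem (h : Cartan n) (a : ℂ) : shift h a ∈ cartanAlg n :=
  sub_mem (ofCartan_mem_cartanAlg h) ((cartanAlg n).algebraMap_mem a)

variable {M : Type*} [AddCommGroup M] [Module (DDAHA n) M] [Module ℂ M]
  [IsScalarTower ℂ (DDAHA n) M]

theorem shift_smul (h : Cartan n) (a : ℂ) (v : M) :
    (shift h a : DDAHA n) • v = (ofCartan h : DDAHA n) • v - a • v := by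
  rw [shift, sub_smul, algebraMap_smul]

theorem smul_cartanAlg_comm {f g : DDAHA n} (hf : f ∈ cartanAlg n) (hg : g ∈ cartanAlg n) (v : M) :
    f • g • v = g • f • v := by
  rw [← mul_smul, cartanAlg_comm hf hg, mul_smul]

variable [NeZero n]

variable (M) in
/-- The generalized weight space for the restriction of `ζ` to the span of the `ε_j^∨`. -/
def genWeightSpace (ζ : Cartan n →ₗ[ℂ] ℂ) : Submodule ℂ M where
  carrier := {v | ∀ j : Fin n, ∃ k : ℕ,
    (shift (epsCheck (j : ℤ)) (ζ (epsCheck (j : ℤ))) : DDAHA n) ^ k • v = 0}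
  zero_mem' _ := ⟨0, smul_zero _⟩
  add_mem' {v w} hv hw j := by
    obtain ⟨k, hk⟩ := hv j
    obtain ⟨l, hl⟩ := hw j
    refine ⟨k + l, ?_⟩
    rw [smul_add, pow_add, mul_smul _ _ w, hl, smul_zero, add_zero, ← pow_add, add_comm, pow_add,
      mul_smul, hk, smul_zero]
  smul_mem' a v hv j := by
    obtain ⟨k, hk⟩ := hv j
    exact ⟨k, by rw [smul_smul_comm, hk, smul_zero]⟩

theorem smul_mem_genWeightSpace {ζ : Cartan n →ₗ[ℂ] ℂ} {f : DDAHA n} (hf : f ∈ cartanAlg n) {v : M}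
    (hv : v ∈ genWeightSpace M ζ) : f • v ∈ genWeightSpace M ζ := by
  intro j
  obtain ⟨k, hk⟩ := hv j
  exact ⟨k, by rw [smul_cartanAlg_comm (pow_mem (shift_mem _ _) k) hf, hk, smul_zero]⟩

theorem mem_genWeightSpace_of_shift {ζ : Cartan n →ₗ[ℂ] ℂ} {v : M}
    (hv : ∀ j : Fin n, (shift (epsCheck (j : ℤ)) (ζ (epsCheck (j : ℤ))) : DDAHA n) • v ∈
      genWeightSpace M ζ) : v ∈ genWeightSpace M ζ := by
  intro j
  obtain ⟨k, hk⟩ := hv j j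
  exact ⟨k + 1, by rw [pow_succ, mul_smul, hk]⟩

/-- The vectors which are mapped to the generalized weight space by an element of the Cartan
algebra fixing `e`. -/
def reach (ζ : Cartan n →ₗ[ℂ] ℂ) (e : M) : Submodule ℂ M where
  carrier := {v | ∃ f ∈ cartanAlg n, f • e = e ∧ f • v ∈ genWeightSpace M ζ}
  zero_mem' := ⟨1, one_mem _, one_smul _ _, by rw [smul_zero]; exact zero_mem _⟩
  add_mem' := by
    rintro v w ⟨f, hf, hfe, hfv⟩ ⟨g, hg, hge, hgw⟩
    refine ⟨f * g, mul_mem hf hg, by rw [mul_smul, hge, hfe], ?_⟩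
    rw [smul_add]
    refine add_mem ?_ ?_
    · rw [cartanAlg_comm hf hg, mul_smul]
      exact smul_mem_genWeightSpace hg hfv
    · rw [mul_smul]
      exact smul_mem_genWeightSpace hf hgw
  smul_mem' := by
    rintro a v ⟨f, hf, hfe, hfv⟩
    exact ⟨f, hf, hfe, by rw [smul_smul_comm]; exact Submodule.smul_mem _ _ hfv⟩

/-- The finitely many witnesses commute and fix `e`, so their product serves all `j` at once and
sends `v` to a vector whose shifts are all generalized weight vectors. -/
theorem mem_reach_of_shift {ζ : Cartan n →ₗ[ℂ] ℂ} {e v : M}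
    (hv : ∀ j : Fin n, (shift (epsCheck (j : ℤ)) (ζ (epsCheck (j : ℤ))) : DDAHA n) • v ∈
      reach ζ e) : v ∈ reach ζ e := by
  classical
  have h (s : Finset (Fin n)) : ∃ f ∈ cartanAlg n, f • e = e ∧ ∀ j ∈ s,
      f • (shift (epsCheck (j : ℤ)) (ζ (epsCheck (j : ℤ))) : DDAHA n) • v ∈ genWeightSpace M ζ := by
    induction s using Finset.induction_on with
    | empty => exact ⟨1, one_mem _, one_smul _ _, by simp⟩
    | insert i s _ ih =>
      obtain ⟨f, hf, hfe, hfs⟩ := ih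
      obtain ⟨g, hg, hge, hgv⟩ := hv i
      refine ⟨f * g, mul_mem hf hg, by rw [mul_smul, hge, hfe], fun j hj => ?_⟩
      rcases Finset.mem_insert.1 hj with rfl | hj
      · rw [mul_smul]
        exact smul_mem_genWeightSpace hf hgv
      · rw [cartanAlg_comm hf hg, mul_smul]
        exact smul_mem_genWeightSpace hg (hfs j hj)
  obtain ⟨f, hf, hfe, hfv⟩ := h Finset.univ
  refine ⟨f, hf, hfe, mem_genWeightSpace_of_shift fun j => ?_⟩
  rw [smul_cartanAlg_comm (shift_mem _ _) hf]
  exact hfv j (Finset.mem_univ j)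

theorem cherednik_zero_one {X : Type*} [AddCommGroup X] [Module ℂ X] (b : AffWeyl n → X)
    (ζ : Cartan n →ₗ[ℂ] ℂ) (w : AffWeyl n) : cherednik b ζ (0, 1) w = ζ (0, 1) • b w := by
  have : act w⁻¹ ((0, 1) : Cartan n) = (0, 1) := by
    ext <;> simp [act]
  simp [cherednik, this]

theorem eq_sum_epsCheck (h : Cartan n) :
    h = ∑ j : Fin n, h.1 j • epsCheck (j : ℤ) + h.2 • ((0, 1) : Cartan n) := by
  refine Prod.ext ?_ ?_
  · funext i
    simp [epsCheck, Prod.fst_sum, Finset.sum_apply, Pi.single_apply]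
  · simp [epsCheck, Prod.snd_sum]

end CartanAlg

namespace IsInduced

variable {n : ℕ} [NeZero n] {Y : Set ℤ} {ζ : Cartan n →ₗ[ℂ] ℂ} {M : Type*} [AddCommGroup M]
    [Module (DDAHA n) M] [Module ℂ M] [IsScalarTower ℂ (DDAHA n) M] {e : M}

/-- The group fixes `c` and the inversion terms do not see it. This is why the generalized weight
space only needs conditions on the `ε_j^∨`. -/
theorem smul_zero_one (hM : IsInduced Y ζ e) (v : M) :
    (ofCartan (0, 1) : DDAHA n) • v = ζ (0, 1) • v := by
  have hv : v ∈ Submodule.span ℂ (Set.range fun w : AffWeyl n => (ofGroup w : DDAHA n) • e) :=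
    hM.cspan_eq_top ▸ Submodule.mem_top
  induction hv using Submodule.span_induction with
  | mem x hx =>
    obtain ⟨w, rfl⟩ := hx
    simp only [ofCartan_smul_ofGroup_smul hM.mem_weightSpace, cherednik_zero_one]
  | zero => simp
  | add x y _ _ h1 h2 => rw [smul_add, smul_add, h1, h2]
  | smul a x _ h1 => rw [smul_smul_comm, h1, smul_comm]

theorem mem_weightSpace_of_shift (hM : IsInduced Y ζ e) {v : M}
    (hv : ∀ j : Fin n, (shift (epsCheck (j : ℤ)) (ζ (epsCheck (j : ℤ))) : DDAHA n) • v = 0) :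
    v ∈ weightSpace M ζ := by
  let S : Submodule ℂ (Cartan n) :=
    { carrier := {h | (ofCartan h : DDAHA n) • v = ζ h • v}
      zero_mem' := by
        have := ofCartan_smul (n := n) 0 0
        rw [zero_smul, zero_smul] at this
        simp [this]
      add_mem' := fun {h h'} h1 h2 => by
        have h1 : (ofCartan h : DDAHA n) • v = ζ h • v := h1
        have h2 : (ofCartan h' : DDAHA n) • v = ζ h' • v := h2
        change (ofCartan (h + h') : DDAHA n) • v = ζ (h + h') • v
        rw [ofCartan_add, add_smul, h1, h2, map_add, add_smul]
      smul_mem' := fun a h h1 => by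
        have h1 : (ofCartan h : DDAHA n) • v = ζ h • v := h1
        change (ofCartan (a • h) : DDAHA n) • v = ζ (a • h) • v
        rw [ofCartan_smul, smul_assoc, h1, map_smul, smul_assoc] }
  intro h
  have : h ∈ S := by
    rw [eq_sum_epsCheck h]
    refine add_mem (sum_mem fun j _ => S.smul_mem _ ?_) (S.smul_mem _ (hM.smul_zero_one v))
    have := hv j
    rw [shift_smul, sub_eq_zero] at this
    exact this
  exact this

/-- A nonzero generalized weight vector can be mapped to a nonzero weight vector. -/
theorem exists_smul_mem_weightSpace (hM : IsInduced Y ζ e) {v : M} (hv : v ∈ genWeightSpace M ζ)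
    (h0 : v ≠ 0) : ∃ f ∈ cartanAlg n, f • v ≠ 0 ∧ f • v ∈ weightSpace M ζ := by
  classical
  have h (s : Finset (Fin n)) : ∃ f ∈ cartanAlg n, f • v ≠ 0 ∧ ∀ j ∈ s,
      (shift (epsCheck (j : ℤ)) (ζ (epsCheck (j : ℤ))) : DDAHA n) • f • v = 0 := by
    induction s using Finset.induction_on with
    | empty => exact ⟨1, one_mem _, by rwa [one_smul], by simp⟩
    | insert i s _ ih =>
      obtain ⟨f, hf, hf0, hfs⟩ := ih
      have h1 := smul_mem_genWeightSpace hf hv i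
      set y : DDAHA n := shift (epsCheck (i : ℤ)) (ζ (epsCheck (i : ℤ))) with hy
      have hyA : y ∈ cartanAlg n := shift_mem _ _
      -- The last nonvanishing power of `y` yields a nonzero vector killed by `y`; commutativity
      -- keeps the conditions already obtained for `s`.
      obtain ⟨m, hm⟩ : ∃ m, Nat.find h1 = m + 1 := by
        refine Nat.exists_eq_succ_of_ne_zero fun h2 => hf0 ?_
        have := Nat.find_spec h1
        rwa [h2, pow_zero, one_smul] at this
      refine ⟨y ^ m * f, mul_mem (pow_mem hyA m) hf, ?_, fun j hj => ?_⟩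
      · rw [mul_smul]
        exact Nat.find_min h1 (by omega)
      rcases Finset.mem_insert.1 hj with rfl | hj
      · have := Nat.find_spec h1
        rwa [hm, pow_succ', mul_smul, ← mul_smul _ f] at this
      · rw [mul_smul, smul_cartanAlg_comm (shift_mem _ _) (pow_mem hyA m), hfs j hj, smul_zero]
  obtain ⟨f, hf, hf0, hfv⟩ := h Finset.univ
  exact ⟨f, hf, hf0, hM.mem_weightSpace_of_shift fun j => hfv j (Finset.mem_univ j)⟩

/-- By induction on the energy, `h` minus its diagonal value sends the translate into `reach`. If
`w` moves `ζ`, this operator suitably normalized fixes `e`; otherwise the diagonal values are those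
of `ζ` and `mem_reach_of_shift` applies. -/
theorem ofGroup_smul_mem_reach (hM : IsInduced Y ζ e) (w : AffWeyl n) :
    (ofGroup w : DDAHA n) • e ∈ reach ζ e := by
  induction hE : energy w using Nat.strong_induction_on generalizing w with
  | _ m ih =>
  have hlow (h : Cartan n) :
      (shift h (ζ (act w⁻¹ h)) : DDAHA n) • (ofGroup w : DDAHA n) • e ∈ reach ζ e := by
    rw [shift_smul, ofCartan_smul_ofGroup_smul hM.mem_weightSpace, cherednik, add_sub_cancel_left]
    refine sum_mem fun r _ => Submodule.smul_mem _ _ (finsum_mem_of_forall_mem _ fun c => ?_)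
    by_cases h0 : invSign w r c = 0
    · simp [h0]
    · exact Submodule.smul_mem _ _ (ih _ (hE ▸ energy_mul_refl_lt w h0) _ rfl)
  by_cases hne : ∃ h, ζ h ≠ ζ (act w⁻¹ h)
  · obtain ⟨h, hh⟩ := hne
    set a := ζ (act w⁻¹ h) with ha
    obtain ⟨f, hf, hfe, hfv⟩ := hlow h
    refine ⟨(ζ h - a)⁻¹ • (f * shift h a),
      Subalgebra.smul_mem _ (mul_mem hf (shift_mem _ _)) _, ?_, ?_⟩
    · rw [smul_assoc, mul_smul, shift_smul, hM.mem_weightSpace, ← sub_smul, smul_smul_comm, hfe,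
        inv_smul_smul₀ (sub_ne_zero.2 hh)]
    · rw [smul_assoc, mul_smul]
      exact Submodule.smul_mem _ _ hfv
  · push Not at hne
    refine mem_reach_of_shift fun j => ?_
    rw [hne]
    exact hlow _

theorem exists_smul_mem_genWeightSpace (hM : IsInduced Y ζ e) (v : M) :
    ∃ f ∈ cartanAlg n, f • e = e ∧ f • v ∈ genWeightSpace M ζ := by
  have h : (⊤ : Submodule ℂ M) ≤ reach ζ e := by
    rw [← hM.cspan_eq_top, Submodule.span_le]
    rintro _ ⟨w, rfl⟩
    exact hM.ofGroup_smul_mem_reach w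
  exact h Submodule.mem_top

/-- A nonzero such vector could be turned into a nonzero multiple of `e`, which generates the
module. -/
theorem eq_zero_of_mem (hM : IsInduced Y ζ e) (hw : weightSpace M ζ ≤ Submodule.span ℂ {e})
    {N : Submodule (DDAHA n) M} (hN : N ≠ ⊤) {v : M} (hv : v ∈ N) (hv' : v ∈ genWeightSpace M ζ) :
    v = 0 := by
  by_contra h0
  obtain ⟨f, -, hf0, hfw⟩ := hM.exists_smul_mem_weightSpace hv' h0
  obtain ⟨a, ha⟩ := Submodule.mem_span_singleton.1 (hw hfw)
  have ha0 : a ≠ 0 := by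
    rintro rfl
    rw [zero_smul] at ha
    exact hf0 ha.symm
  have he : e ∈ N := by
    have := N.smul_mem (algebraMap ℂ (DDAHA n) a⁻¹ * f) hv
    rwa [mul_smul, ← ha, algebraMap_smul, inv_smul_smul₀ ha0] at this
  exact hN (eq_top_iff.2 (hM.span_eq ▸ (Submodule.span_singleton_le_iff_mem _ _).2 he))

/-- An induced module whose weight space is spanned by the generator has a unique maximal
submodule. -/
theorem existsUnique_isSimpleModule (hM : IsInduced Y ζ e)
    (hw : weightSpace M ζ ≤ Submodule.span ℂ {e}) :
    ∃! N : Submodule (DDAHA n) M, IsSimpleModule (DDAHA n) (M ⧸ N) := by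
  simp only [isSimpleModule_iff_isCoatom]
  have : Nontrivial M := ⟨⟨e, 0, hM.ne_zero⟩⟩
  have : Module.Finite (DDAHA n) M := ⟨⟨{e}, by simpa using hM.span_eq⟩⟩
  obtain ⟨N, hN, -⟩ := (eq_top_or_exists_le_coatom (⊥ : Submodule (DDAHA n) M)).resolve_left
    bot_ne_top
  refine ⟨N, hN, fun N' hN' => ?_⟩
  by_contra hne
  have htop := hN'.sup_eq_top_of_ne hN hne
  -- The witness for `a` kills `a` and the one for `b` kills `b`. They commute and fix `e`, so their
  -- product gives `e = 0`.
  obtain ⟨a, ha, b, hb, hab⟩ := Submodule.mem_sup.1 (htop ▸ Submodule.mem_top : e ∈ N' ⊔ N)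
  obtain ⟨f, hf, hfe, hfa⟩ := hM.exists_smul_mem_genWeightSpace a
  obtain ⟨g, hg, hge, hgb⟩ := hM.exists_smul_mem_genWeightSpace b
  have h1 := hM.eq_zero_of_mem hw hN'.1 (N'.smul_mem f ha) hfa
  have h2 := hM.eq_zero_of_mem hw hN.1 (N.smul_mem g hb) hgb
  refine hM.ne_zero ?_
  rw [← hfe, ← hge, ← hab, smul_add, smul_add, smul_cartanAlg_comm hf hg, h1, h2, smul_zero,
    smul_zero, add_zero]

end IsInduced

end DegenerateDAHA

namespace DegenerateDAHA

open DDAHA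

/-! ### Segments from parameters -/

/-- A weakly increasing sequence `N`, with `N (i + p) = N i + n`, cuts the integers into blocks
`[N i, N (i + 1))`; here `m` is a weakly decreasing sequence, with `m (i + p) = m i - κ`, such that
the lengths of the blocks decrease weakly where `m` is constant. -/
structure BlockData (n p : ℕ) (κ : ℤ) where
  N : ℤ → ℤ
  m : ℤ → ℤ
  pos : 0 < κ
  npos : 0 < n
  mono : Monotone N
  anti : Antitone m
  N_add : ∀ i, N (i + p) = N i + n
  m_add : ∀ i, m (i + p) = m i - κ
  length_le : ∀ i, m (i - 1) = m i → N (i + 1) - N i ≤ N i - N (i - 1)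

namespace BlockData

variable {n p : ℕ} {κ : ℤ} (B : BlockData n p κ)

theorem N_add_mul (i k : ℤ) : B.N (i + p * k) = B.N i + n * k := by
  induction k using Int.induction_on with
  | zero => simp
  | succ k ih =>
    have := B.N_add (i + p * k)
    rw [show i + p * ((k : ℤ) + 1) = i + p * k + p by ring, this, ih]
    ring
  | pred k ih =>
    have := B.N_add (i + p * (-(k : ℤ) - 1))
    rw [show i + p * (-(k : ℤ) - 1) + p = i + p * (-k) by ring, ih] at this
    linarith

theorem exists_block (q : ℤ) : ∃ i, B.N i ≤ q ∧ q < B.N (i + 1) := by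
  have hn := B.npos
  -- The bounds come from `N (p k) = N 0 + n k`, which passes `q` once `|k|` exceeds `|q| + |N 0|`.
  -- Taking the greatest `i` skips empty blocks.
  obtain ⟨i, h1, h2⟩ := Int.exists_greatest_of_bdd (P := fun i => B.N i ≤ q)
    ⟨p * (|q| + |B.N 0| + 1), fun z hz => by
      by_contra h
      have h3 := B.mono (not_le.1 h).le
      have h4 := B.N_add_mul 0 (|q| + |B.N 0| + 1)
      rw [zero_add] at h4
      have h5 := le_abs_self q
      have h6 := neg_abs_le (B.N 0)
      have h7 := abs_nonneg q
      have h8 := abs_nonneg (B.N 0)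
      have h9 : |q| + |B.N 0| + 1 ≤ n * (|q| + |B.N 0| + 1) :=
        le_mul_of_one_le_left (by omega) (by exact_mod_cast hn)
      omega⟩
    ⟨p * (-(|q| + |B.N 0| + 1)), by
      have h4 := B.N_add_mul 0 (-(|q| + |B.N 0| + 1))
      rw [zero_add] at h4
      have h5 := neg_abs_le q
      have h6 := le_abs_self (B.N 0)
      have h7 := abs_nonneg q
      have h8 := abs_nonneg (B.N 0)
      have h9 : |q| + |B.N 0| + 1 ≤ n * (|q| + |B.N 0| + 1) :=
        le_mul_of_one_le_left (by omega) (by exact_mod_cast hn)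
      rw [h4, mul_neg]
      omega⟩
  refine ⟨i, h1, not_le.1 fun h => ?_⟩
  have := h2 _ h
  omega

/-- The index of the block containing `q`. -/
def block (q : ℤ) : ℤ := (B.exists_block q).choose

theorem N_block_le (q : ℤ) : B.N (B.block q) ≤ q := (B.exists_block q).choose_spec.1

theorem lt_N_block_succ (q : ℤ) : q < B.N (B.block q + 1) := (B.exists_block q).choose_spec.2

theorem le_block {q i : ℤ} (h : B.N i ≤ q) : i ≤ B.block q := by
  by_contra h1
  have h2 := B.mono (show B.block q + 1 ≤ i by omega)
  have h3 := B.lt_N_block_succ q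
  omega

theorem block_lt {q i : ℤ} (h : q < B.N i) : B.block q < i := by
  by_contra h1
  have h2 := B.mono (not_lt.1 h1)
  have h3 := B.N_block_le q
  omega

theorem block_eq {q i : ℤ} (h : B.N i ≤ q) (h' : q < B.N (i + 1)) : B.block q = i := by
  have h1 := B.le_block h
  have h2 := B.block_lt h'
  omega

theorem block_add (q : ℤ) : B.block (q + n) = B.block q + p := by
  apply B.block_eq
  · rw [B.N_add]
    have := B.N_block_le q
    omega
  · rw [add_right_comm, B.N_add]
    have := B.lt_N_block_succ q
    omega

theorem block_mono : Monotone B.block := fun _ _ h => B.le_block ((B.N_block_le _).trans h)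

theorem block_succ {q : ℤ} (h : ∀ i, B.N i ≠ q + 1) : B.block (q + 1) = B.block q := by
  have h1 := h (B.block q + 1)
  have h2 := B.lt_N_block_succ q
  have h3 := B.N_block_le q
  exact B.block_eq (by omega) (by omega)

theorem N_block_succ {q : ℤ} (h : ∃ i, B.N i = q + 1) : B.N (B.block (q + 1)) = q + 1 := by
  obtain ⟨i, hi⟩ := h
  have h1 := B.mono (B.le_block hi.le)
  have h2 := B.N_block_le (q + 1)
  omega

theorem length_le_of_le {i j : ℤ} (hij : i ≤ j) (h : B.m i = B.m j) :
    B.N (j + 1) - B.N j ≤ B.N (i + 1) - B.N i := by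
  induction j, hij using Int.leInduction with
  | base => exact le_rfl
  | succ j hij ih =>
    have h1 := B.anti hij
    have h2 := B.anti (show j ≤ j + 1 by omega)
    have h3 := B.length_le (j + 1)
    rw [add_sub_cancel_right] at h3
    have h4 := h3 (by omega)
    have h5 := ih (by omega)
    omega

/-- The segments cut out by the blocks. -/
def segments : SegmentData n κ where
  u q := B.m (B.block q) + 1 + (q - B.N (B.block q))
  G q := -B.m (B.block q)
  Y := {q | ∀ i, B.N i ≠ q + 1}
  pos := B.pos
  u_add q := by
    rw [B.block_add, B.m_add, B.N_add]
    ring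
  G_add q := by
    rw [B.block_add, B.m_add]
    ring
  mono a b h := by
    have := B.anti (B.block_mono h)
    change -_ ≤ -_
    omega
  G_succ q hq := by rw [B.block_succ hq]
  u_succ q hq := by
    rw [B.block_succ hq]
    ring
  u_start q hq := by
    have : ∃ i, B.N i = q + 1 := by simpa using hq
    rw [B.N_block_succ this]
    ring
  one_sub_le q := by
    have := B.N_block_le q
    omega
  -- Equal `G` and `u` mean equal offsets in the two blocks. If `q` were last in its block, `a`
  -- would be at least as far as the last position of its own, no longer block, contradicting `a ∈
  -- Y`.
  mem_of_lt q a hqa hG hu ha i hi := by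
    have h1 := B.block_mono hqa.le
    have h2 := B.length_le_of_le h1 (neg_inj.1 hG)
    have h3 := ha (B.block a + 1)
    have h4 := B.lt_N_block_succ a
    have h5 : B.block q = i - 1 ∨ B.block q < i - 1 := by
      have := B.block_lt (show q < B.N i by omega)
      omega
    have h6 := B.N_block_le q
    have h7 := B.mono (show B.block q + 1 ≤ i by omega)
    change B.m _ + 1 + _ = B.m _ + 1 + _ at hu
    change -B.m _ = -B.m _ at hG
    omega

end BlockData

section Params

variable {n p : ℕ} [NeZero p]

/-- The extension of a sequence indexed by `Fin p` to all integers. -/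
def periodize (κ : ℤ) (f : Fin p → ℤ) (i : ℤ) : ℤ := f (res i) - ((res i : Fin p) + 1) - κ * (i / p)

theorem cases_res (i : ℤ) :
    (((res (i + 1) : Fin p) : ℕ) = (res i : Fin p) + 1 ∧ (i + 1) / (p : ℤ) = i / p) ∨
    (((res (i + 1) : Fin p) : ℕ) = 0 ∧ ((res i : Fin p) : ℕ) + 1 = p ∧
      (i + 1) / (p : ℤ) = i / p + 1) := by
  have h1 := res_add_mul_ediv (n := p) i
  have h2 := (res i : Fin p).isLt
  by_cases h : ((res i : Fin p) : ℕ) + 1 < p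
  · left
    have h3 : i + 1 = ((⟨(res i : Fin p) + 1, h⟩ : Fin p) : ℤ) + p * (i / p) := by
      push_cast
      linarith
    constructor
    · conv_lhs => rw [h3, res_fin_add]
    · conv_lhs => rw [h3, ediv_fin_add]
  · right
    have h3 : i + 1 = ((⟨0, by omega⟩ : Fin p) : ℤ) + p * (i / p + 1) := by
      have : (((res i : Fin p) : ℕ) : ℤ) + 1 = p := by exact_mod_cast (by omega)
      push_cast
      linarith
    refine ⟨?_, by omega, ?_⟩
    · conv_lhs => rw [h3, res_fin_add]
    · conv_lhs => rw [h3, ediv_fin_add]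

/-- Subtracting the index turns `[·]_i` into a difference of neighbours, and the drop by `κ` over a
period produces `[·]_0` at the wrap-around. -/
theorem periodize_sub (κ : ℤ) (f : Fin p → ℤ) (i : ℤ) :
    periodize κ f i - periodize κ f (i + 1) = bracket κ f (res (i + 1)) := by
  rw [periodize, periodize, bracket]
  rcases cases_res (p := p) i with ⟨h1, h2⟩ | ⟨h1, h2, h3⟩
  · rw [if_neg (by omega), h2]
    have : (⟨(res (i + 1) : Fin p) - 1, by omega⟩ : Fin p) = res i := by
      apply Fin.ext
      simp [h1]
    rw [this, h1]
    push_cast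
    ring
  · rw [if_pos h1, h3]
    have e1 : (⟨0, by omega⟩ : Fin p) = res (i + 1) := Fin.ext h1.symm
    have e2 : (⟨p - 1, by omega⟩ : Fin p) = res i := Fin.ext (by simp; omega)
    have e3 : (p : ℤ) = ((res i : Fin p) : ℕ) + 1 := by exact_mod_cast h2.symm
    rw [e1, e2, h1]
    push_cast
    linarith

theorem partialSum_succ (lam mu : Fin p → ℤ) (i : Fin p) :
    partialSum lam mu (i + 1) = partialSum lam mu i + (lam i - mu i) := by
  rw [partialSum, partialSum, ← sub_eq_iff_eq_add', ← Finset.sum_sub_distrib,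
    Finset.sum_eq_single i]
  · simp
  · intro j _ hj
    have : (j : ℕ) ≠ i := fun h => hj (Fin.ext h)
    by_cases h : (j : ℕ) < i
    · rw [if_pos h, if_pos (by omega), sub_self]
    · rw [if_neg h, if_neg (by omega), sub_self]
  · simp

/-- The starting points of the blocks. -/
def blockStart (n : ℕ) (lam mu : Fin p → ℤ) (i : ℤ) : ℤ :=
  partialSum lam mu (res i : Fin p) + n * (i / p)

theorem blockStart_succ {lam mu : Fin p → ℤ} (h : ∑ i, (lam i - mu i) = n) (i : ℤ) :
    blockStart n lam mu (i + 1) = blockStart n lam mu i + (lam (res i) - mu (res i)) := by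
  have h1 := partialSum_succ lam mu (res i)
  rw [blockStart, blockStart]
  rcases cases_res (p := p) i with ⟨h2, h3⟩ | ⟨h2, h3, h4⟩
  · rw [h2, h3, h1]
    ring
  · have h5 : partialSum lam mu p = n := by
      rw [← h]
      exact Finset.sum_congr rfl fun j _ => if_pos j.isLt
    have h6 : partialSum lam mu 0 = 0 := Finset.sum_eq_zero fun j _ => by simp
    rw [h3, h5] at h1
    rw [h2, h6, h4]
    linarith

theorem blockStart_add (lam mu : Fin p → ℤ) (i : ℤ) :
    blockStart n lam mu (i + p) = blockStart n lam mu i + n := by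
  have h1 := res_add_mul (n := p) i 1
  rw [mul_one] at h1
  have h2 : (i + p) / (p : ℤ) = i / p + 1 := by
    have := Int.add_mul_ediv_left i 1 (natCast_pos' (n := p)).ne'
    rwa [mul_one] at this
  rw [blockStart, blockStart, h1, h2]
  ring

theorem periodize_add (κ : ℤ) (f : Fin p → ℤ) (i : ℤ) :
    periodize κ f (i + p) = periodize κ f i - κ := by
  have h1 := res_add_mul (n := p) i 1
  rw [mul_one] at h1
  have h2 : (i + p) / (p : ℤ) = i / p + 1 := by
    have := Int.add_mul_ediv_left i 1 (natCast_pos' (n := p)).ne'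
    rwa [mul_one] at this
  rw [periodize, periodize, h1, h2]
  ring

theorem blockStart_sub {lam mu : Fin p → ℤ} (h : ∑ i, (lam i - mu i) = n) (κ i : ℤ) :
    blockStart n lam mu (i + 1) - blockStart n lam mu i = periodize κ lam i - periodize κ mu i := by
  rw [blockStart_succ h, periodize, periodize]
  ring

/-- The blocks of an affine dominant parameter. -/
def blocks (hn : 0 < n) {κ : ℤ} (hκ : 0 < κ) {lam mu : Fin p → ℤ}
    (h : (lam, mu) ∈ affParam n p κ) : BlockData n p κ where
  N := blockStart n lam mu
  m := periodize κ mu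
  pos := hκ
  npos := hn
  mono := monotone_int_of_le_succ fun i => by
    have h1 : 0 ≤ lam (res i) - mu (res i) := h.1.1 _
    have h2 : ∑ i, (lam i - mu i) = n := h.1.2
    rw [blockStart_succ h2]
    omega
  anti := antitone_int_of_succ_le fun i => by
    have h1 := periodize_sub κ mu i
    have h2 : 0 ≤ bracket κ mu (res (i + 1)) := h.2.1 _
    omega
  N_add := blockStart_add lam mu
  m_add := periodize_add κ mu
  -- Lengths are differences of the periodized `λ` and `μ`, so consecutive lengths differ by `[λ] -
  -- [μ]`; where `[μ] = 0` this is `[λ] ≥ 0`.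
  length_le i hi := by
    obtain ⟨i, rfl⟩ : ∃ j, i = j + 1 := ⟨i - 1, by ring⟩
    rw [add_sub_cancel_right] at hi ⊢
    have h0 : ∑ i, (lam i - mu i) = n := h.1.2
    rw [blockStart_sub h0 κ, blockStart_sub h0 κ]
    have h1 := periodize_sub κ mu i
    have h2 := periodize_sub κ lam i
    have h3 : 0 ≤ bracket κ lam (res (i + 1)) :=
      h.2.2 _ (by change bracket κ mu _ = 0; omega)
    omega

end Params

end DegenerateDAHA

/-! ### The weight, Young subgroup and induced module of a parameter -/

namespace DegenerateDAHA

open DDAHA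

section Weight

variable {n p : ℕ} [NeZero p] (hn : 0 < n) {κ : ℤ} (hκ : 0 < κ) {lam mu : Fin p → ℤ}
  (h : (lam, mu) ∈ affParam n p κ)

theorem blocks_N_fin (i : Fin p) : (blocks hn hκ h).N i = partialSum lam mu i := by
  change blockStart n lam mu i = _
  rw [blockStart, res_fin, fin_ediv, mul_zero, add_zero]

theorem blocks_N_fin_succ (i : Fin p) :
    (blocks hn hκ h).N (i + 1) = partialSum lam mu (i + 1) := by
  have h1 : ∑ i, (lam i - mu i) = n := h.1.2
  have h2 := blocks_N_fin hn hκ h i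
  change blockStart n lam mu _ = _ at h2
  change blockStart n lam mu _ = _
  rw [blockStart_succ h1, h2, res_fin, partialSum_succ]

theorem blocks_N_zero : (blocks hn hκ h).N 0 = 0 := by
  have := blocks_N_fin hn hκ h ⟨0, Nat.pos_of_neZero p⟩
  rw [partialSum, Finset.sum_eq_zero fun j _ => by simp] at this
  exact_mod_cast this

theorem blocks_N_self : (blocks hn hκ h).N p = n := by
  have := (blocks hn hκ h).N_add 0
  rwa [blocks_N_zero, zero_add, zero_add] at this

/-- The indices of the blocks in the fundamental period. -/
theorem exists_fin_of_N {i : ℤ} (h0 : 0 < (blocks hn hκ h).N i) (h1 : (blocks hn hκ h).N i < n) :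
    ∃ j : Fin p, i = j ∧ (j : ℕ) ≠ 0 := by
  have h2 : 0 < i := by
    by_contra h2
    have := (blocks hn hκ h).mono (not_lt.1 h2)
    rw [blocks_N_zero] at this
    omega
  have h3 : i < p := by
    by_contra h3
    have := (blocks hn hκ h).mono (not_lt.1 h3)
    rw [blocks_N_self] at this
    omega
  exact ⟨⟨i.toNat, by omega⟩, by simp; omega, by simp; omega⟩

theorem zetaCoeff_eq (j : Fin n) :
    zetaCoeff lam mu j = (blocks hn hκ h).segments.u j := by
  set B := blocks hn hκ h with hB
  have h1 : 0 ≤ B.block j := B.le_block (by rw [blocks_N_zero]; omega)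
  have h2 : B.block j < p := B.block_lt (by rw [blocks_N_self]; exact_mod_cast j.isLt)
  obtain ⟨i, hi⟩ : ∃ i : Fin p, B.block j = i := ⟨⟨(B.block j).toNat, by omega⟩, by simp; omega⟩
  have hN (i : Fin p) : B.N i = partialSum lam mu i := blocks_N_fin hn hκ h i
  have hN' (i : Fin p) : B.N (i + 1) = partialSum lam mu (i + 1) := blocks_N_fin_succ hn hκ h i
  have h3 := B.N_block_le j
  have h4 := B.lt_N_block_succ j
  change _ = B.m (B.block j) + 1 + (j - B.N (B.block j))
  rw [hi] at h3 h4 ⊢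
  have h5 : B.m i = mu i - (i + 1) := by
    change periodize κ mu i = _
    rw [periodize, res_fin, fin_ediv, mul_zero, sub_zero]
  rw [zetaCoeff, Finset.sum_eq_single i]
  · rw [← hN, ← hN', if_pos ⟨by omega, by omega⟩, h5]
    ring
  · intro i' _ hi'
    rw [← hN, ← hN', if_neg]
    rintro ⟨h6, h7⟩
    have h8 := B.block_eq (q := j) (i := i') (by omega) (by omega)
    rw [hi] at h8
    exact hi' (Fin.ext (by exact_mod_cast h8.symm))
  · simp

variable [NeZero n]

theorem isWeight_zeta : (blocks hn hκ h).segments.IsWeight (zeta n κ lam mu) := by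
  intro q
  have h1 := (blocks hn hκ h).segments.u_add_mul ((res q : Fin n) : ℕ) (q / n)
  rw [res_add_mul_ediv, ← zetaCoeff_eq] at h1
  rw [h1]
  simp only [zeta, epsCheck, LinearMap.coe_mk, AddHom.coe_mk]
  rw [Finset.sum_eq_single (res q) (fun j _ hj => by rw [Pi.single_eq_of_ne hj, mul_zero])
    (by simp), Pi.single_eq_same]
  push_cast
  ring

theorem refl_natCast {b : ℕ} (hb : b + 1 < n) :
    (refl (b : ℤ) ((b : ℤ) + 1) : AffWeyl n) =
      finite (Equiv.swap ⟨b, Nat.lt_of_succ_lt hb⟩ ⟨b + 1, hb⟩) := by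
  have h1 := res_fin (⟨b, Nat.lt_of_succ_lt hb⟩ : Fin n)
  have h2 := res_fin (⟨b + 1, hb⟩ : Fin n)
  have h3 := fin_ediv (⟨b, Nat.lt_of_succ_lt hb⟩ : Fin n)
  have h4 := fin_ediv (⟨b + 1, hb⟩ : Fin n)
  push_cast at h1 h2 h3 h4
  rw [refl, h1, h2, h3, h4]
  simp [translation]
  exact map_one SemidirectProduct.inl

/-- The reflections in the Young subgroup. -/
theorem mem_segments_Y {b : ℕ} (hb : b + 1 < n) : (b : ℤ) ∈ (blocks hn hκ h).segments.Y ↔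
    ∀ i : ℕ, 1 ≤ i → i < p → ((b + 1 : ℕ) : ℤ) ≠ partialSum lam mu i := by
  constructor
  · intro hY i _ hi h1
    refine hY i ?_
    rw [show (i : ℤ) = ((⟨i, hi⟩ : Fin p) : ℕ) from rfl, blocks_N_fin, ← h1]
    push_cast
    rfl
  · intro hY i hi
    obtain ⟨j, rfl, hj⟩ := exists_fin_of_N hn hκ h (i := i) (by omega) (by omega)
    rw [blocks_N_fin] at hi
    refine hY j (by omega) j.isLt ?_
    rw [hi]
    push_cast
    rfl

/-- The reflections exchanging neighbours in a block come from the Young subgroup. -/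
theorem exists_swap_of_mem_Y {j : ℤ} (hj : j ∈ (blocks hn hκ h).segments.Y) :
    ∃ w ∈ youngSubgroup n lam mu, (refl j (j + 1) : AffWeyl n) = finite w := by
  obtain ⟨b, hbn, h1⟩ : ∃ b : ℕ, b < n ∧ (b : ℤ) + n * (j / n) = j :=
    ⟨((res j : Fin n) : ℕ), (res j : Fin n).isLt, res_add_mul_ediv j⟩
  have h2 : (b : ℤ) ∈ (blocks hn hκ h).segments.Y := by
    intro i hi
    refine hj (i + p * (j / n)) ?_
    rw [BlockData.N_add_mul, hi]
    linarith
  -- The pair `(n - 1, n)` is never inside a block, as `n = N p` is a boundary; so the affine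
  -- reflection does not occur.
  have h3 : b + 1 < n := by
    by_contra h3
    refine h2 p ?_
    rw [blocks_N_self]
    omega
  refine ⟨_, Subgroup.subset_closure ⟨b, h3, (mem_segments_Y hn hκ h h3).1 h2, rfl⟩, ?_⟩
  rw [← refl_natCast h3, ← refl_add_mul (n := n) (b : ℤ) _ (j / n)]
  congr 1 <;> linarith

section Induced

variable {X : Type*} [AddCommGroup X] [Module (DDAHA n) X] [Module ℂ X]
  [IsScalarTower ℂ (DDAHA n) X]

theorem ofGroup_finite_smul {v : X}
    (hw : ∀ j ∈ (blocks hn hκ h).segments.Y, (ofGroup (refl j (j + 1)) : DDAHA n) • v = v)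
    {w : Equiv.Perm (Fin n)} (hwY : w ∈ youngSubgroup n lam mu) :
    (ofGroup (finite w) : DDAHA n) • v = v := by
  induction hwY using Subgroup.closure_induction with
  | mem g hg =>
    obtain ⟨b, hb, hY, rfl⟩ := hg
    rw [← refl_natCast hb]
    exact hw _ ((mem_segments_Y hn hκ h hb).2 hY)
  | one => rw [finite, map_one, ofGroup_one, one_smul]
  | mul x y _ _ hx hy =>
    rw [finite] at hx hy ⊢
    rw [map_mul, ofGroup_mul, mul_smul, hy, hx]
  | inv x _ hx =>
    rw [finite] at hx ⊢
    conv_lhs => rw [← hx]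
    rw [← mul_smul, ← ofGroup_mul, ← map_mul, inv_mul_cancel, map_one, ofGroup_one, one_smul]

/-- The universal property of the induced module. -/
theorem exists_inducedModule_hom {v : X} (hv : v ∈ weightSpace X (zeta n κ lam mu))
    (hw : ∀ j ∈ (blocks hn hκ h).segments.Y, (ofGroup (refl j (j + 1)) : DDAHA n) • v = v) :
    ∃ E : InducedModule n κ lam mu →ₗ[DDAHA n] X, E (inducedOne n κ lam mu) = v := by
  have hk : inducingIdeal n κ lam mu ≤ (LinearMap.toSpanSingleton (DDAHA n) X v).ker := by
    refine Submodule.span_le.2 ?_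
    rintro x (⟨w, hwY, rfl⟩ | ⟨h', rfl⟩)
    · rw [SetLike.mem_coe, LinearMap.mem_ker, LinearMap.toSpanSingleton_apply, sub_smul, one_smul,
        ofGroup_finite_smul hn hκ h hw hwY, sub_self]
    · rw [SetLike.mem_coe, LinearMap.mem_ker, LinearMap.toSpanSingleton_apply, sub_smul, hv,
        algebraMap_smul, sub_self]
  exact ⟨Submodule.liftQ _ _ hk, (Submodule.liftQ_apply _ _ _).trans (one_smul _ _)⟩

end Induced

/-- Coordinates come from the universal property applied to the model, where the vector of the
trivial coset has weight `ζ` and is invariant under the parabolic subgroup. -/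
theorem isInduced_inducedOne : IsInduced (blocks hn hκ h).segments.Y (zeta n κ lam mu)
    (inducedOne n κ lam mu) where
  mem_weightSpace h' := by
    rw [← algebraMap_smul (DDAHA n) (zeta n κ lam mu h'), inducedOne, ← Submodule.Quotient.mk_smul,
      ← Submodule.Quotient.mk_smul, Submodule.Quotient.eq, smul_eq_mul, smul_eq_mul, mul_one,
      mul_one]
    exact Submodule.subset_span (Or.inr ⟨h', rfl⟩)
  refl_smul j hj := by
    obtain ⟨w, hw, hj'⟩ := exists_swap_of_mem_Y hn hκ h hj
    rw [hj', inducedOne, ← Submodule.Quotient.mk_smul, Submodule.Quotient.eq, smul_eq_mul, mul_one]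
    exact Submodule.subset_span (Or.inl ⟨w, hw, rfl⟩)
  span_eq := by
    refine eq_top_iff.2 fun x _ => ?_
    obtain ⟨y, rfl⟩ := Submodule.Quotient.mk_surjective _ x
    refine Submodule.mem_span_singleton.2 ⟨y, ?_⟩
    rw [inducedOne, ← Submodule.Quotient.mk_smul, smul_eq_mul, mul_one]
  exists_coord := by
    have hζ := (isWeight_zeta hn hκ h).isSteinberg
    let Y := (blocks hn hκ h).segments.Y
    let _ : Module (DDAHA n) ((AffWeyl n ⧸ parabolic n Y) →₀ ℂ) :=
      Module.compHom _ (modelHom hζ).toRingHom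
    have hsmul (x : DDAHA n) (v : (AffWeyl n ⧸ parabolic n Y) →₀ ℂ) : x • v = modelHom hζ x v := rfl
    have : IsScalarTower ℂ (DDAHA n) ((AffWeyl n ⧸ parabolic n Y) →₀ ℂ) :=
      ⟨fun a x v => by rw [hsmul, hsmul, map_smul, LinearMap.smul_apply]⟩
    have hv : cosetVec (parabolic n Y) 1 ∈
        weightSpace ((AffWeyl n ⧸ parabolic n Y) →₀ ℂ) (zeta n κ lam mu) := fun h' => by
      rw [hsmul, modelHom_ofCartan, cartanOp_cosetVec hζ, cherednik_of_strictMono, inv_one, act_one]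
      intro a b hab
      simpa using hab
    have hw : ∀ j ∈ Y, (ofGroup (refl j (j + 1)) : DDAHA n) • cosetVec (parabolic n Y) 1 =
        cosetVec (parabolic n Y) 1 := fun j hj => by
      rw [hsmul, modelHom_ofGroup, groupOp_cosetVec, mul_one]
      conv_lhs => rw [← one_mul (refl j (j + 1))]
      exact cosetVec_mul 1 (Subgroup.subset_closure ⟨j, hj, rfl⟩)
    obtain ⟨E, hE⟩ := exists_inducedModule_hom hn hκ h hv hw
    refine ⟨E.restrictScalars ℂ, fun w => ?_⟩
    rw [LinearMap.restrictScalars_apply, map_smul, hE, hsmul, modelHom_ofGroup, groupOp_cosetVec,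
      mul_one]
  exists_lift _ hv hw := exists_inducedModule_hom hn hκ h hv hw

end Weight

end DegenerateDAHA

end

theorem mainTheorem1 (n p : ℕ) (hn : 0 < n) (hp : 0 < p) (κ : ℤ) (hκ : 0 < κ)
    (lam mu : Fin p → ℤ) (h : (lam, mu) ∈ DegenerateDAHA.affParam n p κ) :
    (∃! N : Submodule (DDAHA n) (DegenerateDAHA.InducedModule n κ lam mu),
      IsSimpleModule (DDAHA n) (DegenerateDAHA.InducedModule n κ lam mu ⧸ N)) ∧
    DDAHA.weightSpace (DegenerateDAHA.InducedModule n κ lam mu)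
        (DegenerateDAHA.zeta n κ lam mu) =
      Submodule.span ℂ {DegenerateDAHA.inducedOne n κ lam mu} ∧
    Module.finrank ℂ (DDAHA.weightSpace (DegenerateDAHA.InducedModule n κ lam mu)
        (DegenerateDAHA.zeta n κ lam mu)) = 1 := by
  have : NeZero n := ⟨hn.ne'⟩
  have : NeZero p := ⟨hp.ne'⟩
  have hM := DegenerateDAHA.isInduced_inducedOne hn hκ h
  have hζ := DegenerateDAHA.isWeight_zeta hn hκ h
  have hle : DDAHA.weightSpace (DegenerateDAHA.InducedModule n κ lam mu)
      (DegenerateDAHA.zeta n κ lam mu) ≤ Submodule.span ℂ {DegenerateDAHA.inducedOne n κ lam mu} :=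
    fun v hv => hM.mem_span_singleton hζ hv
  have heq := hle.antisymm ((Submodule.span_singleton_le_iff_mem _ _).2 hM.mem_weightSpace)
  exact ⟨hM.existsUnique_isSimpleModule hle, heq, heq ▸ finrank_span_singleton hM.ne_zero⟩
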